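/- Let $m\ge 1$ be an integer, $\underline a=(a_1,\dots,a_m)\in\mathbb C^m$, $P_m(x,\underline a)=x^m+a_1x^{m-1}+\dots+a_m$, and consider the equation $$\Phi''(x)=\frac{P_m(x,\underline a)}{x^2}\,\Phi(x)\qquad(\mathfrak E_m)$$ on the universal covering of $\mathbb C^*=\mathbb C\setminus\{0\}$, whose points $x$ have an argument $\arg x\in\mathbb R$; put $x^\alpha=\exp(\alpha\ln x)$ with $\ln x$ real for $\arg x=0$. Let $b_{m/2-k}(\underline a)$ be the coefficients of the expansion at infinity $\sqrt{P_m(x,\underline a)}/x=\sum_{k\ge0}b_{m/2-k}(\underline a)\,x^{m/2-k-1}$, $b_{m/2}=1$, and set $$S(x,\underline a)=\sum_{0\le k<m/2}\frac{b_{m/2-k}(\underline a)}{m/2-k}\,x^{m/2-k},\qquad r(\underline a)=\begin{cases}\frac12-\frac m4 & m\text{ odd},\\ \frac12-\frac m4-b_0(\underline a) & m\text{ even}.\end{cases}$$ There is a unique solution $\Phi_0(x,\underline a)$ of $(\mathfrak E_m)$, analytic on the universal covering of $\mathbb C^*$, which in every strict subsector of $\{|\arg x|<3\pi/m\}$ has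 at infinity an asymptotic expansion of the form $x^{r(\underline a)}e^{-S(x,\underline a)}\phi_0(x,\underline a)$, where $\phi_0$ is a formal power series with constant term $1$, in $x^{-1/2}$ if $m$ is odd and in $x^{-1}$ if $m$ is even. Let $\omega=e^{\pm 2i\pi/m}$ (either choice of sign), $\lambda\cdot\underline a=(\lambda a_1,\lambda^2a_2,\dots,\lambda^ma_m)$, and $\Phi_k(x,\underline a)=\Phi_0(\omega^kx,\omega^k\cdot\underline a)$ for $k\in\mathbb Z$, where multiplication by $\omega^k$ adds $\pm 2\pi k/m$ to $\arg x$. For every $k\in\mathbb Z$ there are unique complex numbers $C_k(\underline a),\tilde C_k(\underline a)$ (the Stokes–Sibuya coefficients) with $\Phi_{k-1}=C_k(\underline a)\Phi_k+\tilde C_k(\underline a)\Phi_{k+1}$. Let $$\mathfrak S_k(\underline a)=\begin{pmatrix}C_k(\underline a)&\tilde C_k(\underline a)\\1&0\end{pmatrix}$$ be the Stokes–Sibuya connection matrices. Then, for every $p\in\mathbb C$ with $p^2=1+4a_m$, $$\operatorname{Tr}\bigl(\mathfrak S_0(\underline a)\mathfrak S_1(\underline a)\cdots\mathfrak S_{m-1}(\underline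 a)\bigr)=-2\cos(\pi p).$$ Written out in the entries of the matrices, this is an explicit polynomial functional relation among the coefficients $C_0,\dots,C_{m-1},\tilde C_0,\dots,\tilde C_{m-1}$. -/

import Mathlib

noncomputable section

namespace StokesSibuya

open Complex Finset

/-- The monic polynomial `P_m(x, a) = x ^ m + a₁ x ^ (m - 1) + ⋯ + a_m`.
The coefficient `a_j` (`1 ≤ j ≤ m`) is stored as `a ⟨j - 1, _⟩`. -/
def poly (m : ℕ) (a : Fin m → ℂ) (x : ℂ) : ℂ :=
  x ^ m + ∑ j : Fin m, a j * x ^ (m - (j.val + 1))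

/-!
Functions on the universal covering of `ℂ \ {0}` (base point `1`) are functions of the coordinate
`t ∈ ℂ`, with projection `x = exp t`, so that `|x| = exp (Re t)`, `arg x = Im t` and
`x ^ α = exp (α * t)`.
-/

/-- The derivation `d/dx` in the coordinate `t`, where `x = exp t`. -/
def ddx (f : ℂ → ℂ) (t : ℂ) : ℂ := exp (-t) * deriv f t

/-- `Φ` is an analytic solution of `Φ'' = (P_m(x, a) / x ^ 2) Φ` (derivatives in `x`) on the universal
covering of `ℂ \ {0}`. -/
def IsSolution (m : ℕ) (a : Fin m → ℂ) (Φ : ℂ → ℂ) : Prop :=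
  Differentiable ℂ Φ ∧
    ∀ t : ℂ, ddx (ddx Φ) t = poly m a (exp t) / exp t ^ 2 * Φ t

/-- The coefficient of `x ^ (-k)` in `x ^ (-m) * P_m(x, a) = 1 + a₁ x⁻¹ + ⋯ + a_m x ^ (-m)`. -/
def revCoeff (m : ℕ) (a : Fin m → ℂ) : ℕ → ℂ
  | 0 => 1
  | k + 1 => if h : k < m then a ⟨k, h⟩ else 0

/-- The coefficient of `x ^ (-k)` in the expansion at infinity of
`(1 + a₁ x⁻¹ + ⋯ + a_m x ^ (-m)) ^ (1 / 2)` (with leading term `1`), computed by comparing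
coefficients in the square (see `sum_sqrtCoeff`). In other words, at infinity
`√P_m(x, a) / x = ∑ k, sqrtCoeff m a k * x ^ (m / 2 - k - 1)`, that is, `sqrtCoeff m a k` is the
coefficient `b_{m/2 - k}(a)`. -/
def sqrtCoeff (m : ℕ) (a : Fin m → ℂ) : ℕ → ℂ
  | 0 => 1
  | n + 1 => (revCoeff m a (n + 1) -
      ∑ i : Fin n, sqrtCoeff m a (i.val + 1) * sqrtCoeff m a (n - i.val)) / 2
decreasing_by
  all_goals have := i.isLt; omega

/-- The square of the series with coefficients `sqrtCoeff` is `1 + a₁ x⁻¹ + ⋯ + a_m x ^ (-m)`. -/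
theorem sum_sqrtCoeff (m : ℕ) (a : Fin m → ℂ) (n : ℕ) :
    ∑ i ∈ range (n + 1), sqrtCoeff m a i * sqrtCoeff m a (n - i) = revCoeff m a n := by
  cases n with
  | zero => simp [sqrtCoeff, revCoeff]
  | succ n =>
    have h := sqrtCoeff.eq_2 m a n
    have h0 : sqrtCoeff m a 0 = 1 := sqrtCoeff.eq_1 m a
    rw [Fin.sum_univ_eq_sum_range
      (fun i => sqrtCoeff m a (i + 1) * sqrtCoeff m a (n - i)) n] at h
    rw [sum_range_succ, sum_range_succ', Nat.sub_self, Nat.sub_zero, h0]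
    simp only [Nat.add_sub_add_right]
    rw [h]
    ring

/-- `S(x, a) = (2 / m) x ^ (m / 2) + ∑_{1 ≤ k < m / 2} b_{m/2-k}(a) / (m / 2 - k) x ^ (m / 2 - k)`
at `x = exp t`; the first term is the one with `k = 0`. -/
def expPart (m : ℕ) (a : Fin m → ℂ) (t : ℂ) : ℂ :=
  ∑ k ∈ (range m).filter (fun k => 2 * k < m),
    sqrtCoeff m a k / ((m : ℂ) / 2 - k) * exp (((m : ℂ) / 2 - k) * t)

/-- `r(a) = 1 / 2 - m / 4` for odd `m`, and `r(a) = 1 / 2 - m / 4 - b₀(a)` for even `m`. -/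
def expo (m : ℕ) (a : Fin m → ℂ) : ℂ :=
  1 / 2 - (m : ℂ) / 4 - if Even m then sqrtCoeff m a (m / 2) else 0

/-- In every strict subsector of `|arg x| < 3 π / m`, the function `Φ` has, at infinity, the
asymptotic expansion `x ^ r(a) * exp (-S(x, a)) * φ`, where `φ = 1 + ∑_{n ≥ 1} c n * x ^ (-n / 2)` is
a formal power series in `x ^ (-1/2)` if `m` is odd and in `x⁻¹` if `m` is even. -/
def HasExpansion (m : ℕ) (a : Fin m → ℂ) (Φ : ℂ → ℂ) : Prop :=
  ∃ c : ℕ → ℂ, c 0 = 1 ∧ (Even m → ∀ n, Odd n → c n = 0) ∧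
    ∀ δ : ℝ, δ < 3 * Real.pi / m → ∀ N : ℕ, ∃ K R : ℝ, ∀ t : ℂ, R ≤ t.re → |t.im| ≤ δ →
      ‖Φ t * exp (expPart m a t - expo m a * t) -
          ∑ n ∈ range N, c n * exp (-((n : ℂ) / 2) * t)‖ ≤
        K * Real.exp (-((N : ℝ) / 2) * t.re)

/-- `Φ` is the solution characterized by its asymptotic expansion at infinity. -/
def IsCanonical (m : ℕ) (a : Fin m → ℂ) (Φ : ℂ → ℂ) : Prop :=
  IsSolution m a Φ ∧ HasExpansion m a Φ

/-- The solution `Φ₀(·, a)`. -/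
def Phi0 (m : ℕ) (a : Fin m → ℂ) : ℂ → ℂ := Classical.epsilon (IsCanonical m a)

/-- `log ω = ± 2 π i / m`, with the sign `σ`. -/
def logOmega (m : ℕ) (σ : ℤˣ) : ℂ := ((σ : ℤ) : ℂ) * (2 * Real.pi * I / m)

/-- `ω = exp (± 2 π i / m)`. -/
def omega (m : ℕ) (σ : ℤˣ) : ℂ := exp (logOmega m σ)

/-- `z · a = (z a₁, z ^ 2 a₂, …, z ^ m a_m)`. -/
def scale {m : ℕ} (z : ℂ) (a : Fin m → ℂ) : Fin m → ℂ := fun j => z ^ (j.val + 1) * a j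

/-- `Φ_k(x, a) = Φ₀(ω ^ k x, ω ^ k · a)`; on the universal covering, multiplication of `x` by `ω ^ k`
adds `k log ω = ± 2 π i k / m` to `t`. -/
def Phi (m : ℕ) (σ : ℤˣ) (k : ℤ) (a : Fin m → ℂ) (t : ℂ) : ℂ :=
  Phi0 m (scale (omega m σ ^ k) a) (t + k * logOmega m σ)

/-- The relation `Φ_{k-1} = C Φ_k + C' Φ_{k+1}` that defines the Stokes-Sibuya coefficients
`(C, C')`. -/
def IsConnection (m : ℕ) (σ : ℤˣ) (k : ℤ) (a : Fin m → ℂ) (c : ℂ × ℂ) : Prop :=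
  ∀ t : ℂ, Phi m σ (k - 1) a t = c.1 * Phi m σ k a t + c.2 * Phi m σ (k + 1) a t

/-- The Stokes-Sibuya coefficient `C_k(a)` of `Φ_{k-1}` associated with `Φ_k`. -/
def coeffC (m : ℕ) (σ : ℤˣ) (k : ℤ) (a : Fin m → ℂ) : ℂ :=
  (Classical.epsilon (IsConnection m σ k a)).1

/-- The Stokes-Sibuya coefficient of `Φ_{k-1}` associated with `Φ_{k+1}` (`C_k(a)` with a tilde). -/
def coeffCt (m : ℕ) (σ : ℤˣ) (k : ℤ) (a : Fin m → ℂ) : ℂ :=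
  (Classical.epsilon (IsConnection m σ k a)).2

/-- The Stokes-Sibuya connection matrix `S_k(a)`. -/
def stokesMatrix (m : ℕ) (σ : ℤˣ) (k : ℤ) (a : Fin m → ℂ) : Matrix (Fin 2) (Fin 2) ℂ :=
  !![coeffC m σ k a, coeffCt m σ k a; 1, 0]

end StokesSibuya

end

noncomputable section

namespace StokesSibuya

open Complex Filter Topology Metric

/-! ### Linear differential equations `u'' = Q u` with entire coefficient -/

/-! Put x = e^t and Φ = e^(t/2) u. The equation becomes u'' = Q u with Q(t) = P_m(e^t) + 1/4 entire
and 2πi-periodic. Solutions are entire, Wronskians are constant, and a turn around x = 0 is the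
translation by 2πi.

Since ω^m = 1 acts trivially on the parameters, Φ_{k+m} is Φ_k after a full turn; for u the factor
e^(-t/2) adds a sign (`Phi_add_natCast`). The relations (Φ_{k-1}, Φ_k) = S_k (Φ_k, Φ_{k+1})
telescope, so M = S_0 ⋯ S_{m-1} takes (Φ_{m-1}, Φ_m) to (Φ_{-1}, Φ_0) (`prod_stokesMatrix_mulVec`).
Hence -M is the inverse monodromy of u in the basis coming from (Φ_{-1}, Φ_0). Constancy of the
Wronskian gives det M = 1, so one eigenvalue determines the trace. It comes from a Frobenius
solution at x = 0: there Q tends to a_m + 1/4 = p²/4, and e^(pt/2) Σ c_n e^(nt) is a solution with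
multiplier κ = e^(±iπp) (`exists_floquet`); then Tr M = -(κ + 1/κ) (`trace_eq_of_floquet`). Taking
Re p ≥ 0 avoids resonance, and det M = 1 makes a second, possibly logarithmic, solution unnecessary.

The analytic weight lies in Φ_0. Dividing u by its leading factor leaves an equation with a formal
power series solution in X = x^(-1/2) (`X_pow_dvd_formalOp_formalSum`); the exponent r(a) is exactly
what makes this work (`exists_ePoly`). A partial sum is corrected to a true solution by a remainder
that solves a Volterra equation in ζ = e^(-iα) (2/m) x^(m/2), integrated from +∞ along horizontal
rays (`exists_sol_volterra`, `exists_remainder`). The remainder is controlled for |arg ζ| ≤ π - ε;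
the angles α = ±(π/2 - ε) cover the two halves of |arg x| < 3π/m (`exists_entireSol_side`). The
solutions so obtained, for both sides and all truncation orders, coincide: on the positive axis they
decay like the same leading factor, while another solution grows there (`IsAsymp.unique`). The same
contrast of decay and growth makes Φ_k and Φ_{k+1} independent (`wronsk_Phi_ne_zero`), so the
connection coefficients exist and are unique. -/

/-- `u` is an entire solution of `u'' = Q u`. -/
def EntireSol (Q u : ℂ → ℂ) : Prop :=
  Differentiable ℂ u ∧ ∀ t, deriv (deriv u) t = Q t * u t

theorem exists_entire_primitive {f : ℂ → ℂ} (hf : Differentiable ℂ f) :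
    ∃ g : ℂ → ℂ, g 0 = 0 ∧ ∀ z, HasDerivAt g (f z) z := by
  obtain ⟨g, h0, h⟩ := hf.isExactOn_univ.with_val_at 0 0
  exact ⟨g, h0, fun z => h z (Set.mem_univ z)⟩

/-- On the segment from 0 to z, parametrized by s in [0, 1], the bound on the derivative of g is the
derivative of the bound on g. Iteration builds up the factorials that make Picard's series converge.
-/
theorem norm_primitive_le {f g : ℂ → ℂ} (g0 : g 0 = 0) (hg : ∀ z, HasDerivAt g (f z) z)
    {K R : ℝ} {n : ℕ} (hf : ∀ z, ‖z‖ < R → ‖f z‖ ≤ K * ‖z‖ ^ n / n.factorial) {z : ℂ}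
    (hz : ‖z‖ < R) : ‖g z‖ ≤ K * ‖z‖ ^ (n + 1) / (n + 1).factorial := by
  have hd : ∀ s : ℝ, HasDerivAt (fun s : ℝ => g (s * z)) (z * f (s * z)) s := by
    intro s
    have h1 : HasDerivAt (fun s : ℝ => (s : ℂ) * z) z s := by
      simpa using (HasDerivAt.ofReal_comp (hasDerivAt_id s)).mul_const z
    have := (hg (s * z)).scomp s h1
    simpa [smul_eq_mul, Function.comp_def] using! this
  have hB : ∀ s : ℝ, HasDerivAt
      (fun s : ℝ => K * ‖z‖ ^ (n + 1) / (n + 1).factorial * s ^ (n + 1))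
      (K * ‖z‖ ^ (n + 1) / n.factorial * s ^ n) s := by
    intro s
    have := (hasDerivAt_pow (n + 1) s).const_mul (K * ‖z‖ ^ (n + 1) / (n + 1).factorial)
    convert! this using 1
    rw [Nat.factorial_succ]
    push_cast
    field_simp
  have key := image_norm_le_of_norm_deriv_right_le_deriv_boundary
    (f := fun s : ℝ => g (s * z)) (f' := fun s : ℝ => z * f (s * z)) (a := 0) (b := 1)
    (fun s _ => (hd s).continuousAt.continuousWithinAt)
    (fun s _ => (hd s).hasDerivWithinAt) (by simp [g0]) hB ?_
    (Set.right_mem_Icc.2 zero_le_one)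
  · simpa using key
  · intro s hs
    have hsz : ‖(s : ℂ) * z‖ = s * ‖z‖ := by
      rw [norm_mul, norm_real, Real.norm_of_nonneg hs.1]
    have h1 : ‖(s : ℂ) * z‖ < R := by
      rw [hsz]
      exact (mul_le_of_le_one_left (norm_nonneg _) hs.2.le).trans_lt hz
    have h2 := hf _ h1
    rw [norm_mul]
    calc ‖z‖ * ‖f (s * z)‖ ≤ ‖z‖ * (K * ‖(s : ℂ) * z‖ ^ n / n.factorial) := by gcongr
      _ = _ := by rw [hsz]; ring

theorem tendstoLocallyUniformlyOn_sum_range {F : ℕ → ℂ → ℂ} {U : Set ℂ}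
    (h : ∀ z ∈ U, ∃ V ∈ 𝓝[U] z, ∃ u : ℕ → ℝ, Summable u ∧ ∀ n, ∀ w ∈ V, ‖F n w‖ ≤ u n) :
    TendstoLocallyUniformlyOn (fun N z => ∑ n ∈ Finset.range N, F n z) (fun z => ∑' n, F n z)
      atTop U := by
  refine tendstoLocallyUniformlyOn_of_forall_exists_nhds fun z hz => ?_
  obtain ⟨V, hV, u, hu, hb⟩ := h z hz
  exact ⟨V, hV, tendstoUniformlyOn_tsum_nat hu hb⟩

/-- Picard iteration: start from α + β t and repeatedly take the double primitive of Q times the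
previous term, normalized to vanish to second order at 0. The sum of all terms is the solution. -/
theorem exists_entireSol {Q : ℂ → ℂ} (hQ : Differentiable ℂ Q) (α β : ℂ) :
    ∃ u, EntireSol Q u ∧ u 0 = α ∧ deriv u 0 = β := by
  -- `choose` needs values for every function, so differentiability is a premise inside and other
  -- functions receive a dummy value.
  have step : ∀ f : ℂ → ℂ, ∃ g h : ℂ → ℂ, Differentiable ℂ f →
      g 0 = 0 ∧ h 0 = 0 ∧ (∀ z, HasDerivAt g (h z) z) ∧ ∀ z, HasDerivAt h (Q z * f z) z := by
    intro f
    by_cases hf : Differentiable ℂ f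
    · obtain ⟨h, h0, hh⟩ := exists_entire_primitive (hQ.mul hf)
      obtain ⟨g, g0, hg⟩ := exists_entire_primitive (fun z => (hh z).differentiableAt)
      exact ⟨g, h, fun _ => ⟨g0, h0, hg, hh⟩⟩
    · exact ⟨0, 0, fun h => absurd h hf⟩
  choose G H hGH using step
  let f : ℕ → ℂ → ℂ := fun n => Nat.rec (fun t => α + β * t) (fun _ g => G g) n
  have hf0 : f 0 = fun t => α + β * t := rfl
  have hfs : ∀ n, f (n + 1) = G (f n) := fun n => rfl
  have hd : ∀ n, Differentiable ℂ (f n) := by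
    intro n
    induction n with
    | zero => rw [hf0]; fun_prop
    | succ n ih => exact fun z => ((hGH _ ih).2.2.1 z).differentiableAt
  have hf0' : deriv (f 0) = fun _ => β := by
    funext t
    rw [hf0]
    simp
  have hfs' : ∀ n, deriv (f (n + 1)) = H (f n) := fun n =>
    funext fun z => ((hGH _ (hd n)).2.2.1 z).deriv
  have hfs'' : ∀ n, deriv (deriv (f (n + 1))) = fun z => Q z * f n z := fun n => by
    rw [hfs']
    exact funext fun z => ((hGH _ (hd n)).2.2.2 z).deriv
  -- With |Q| ≤ M on the disc, the n-th iterate is at most C (M R²)^n / (2n)!; weakening (2n)! to n!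
  -- leaves an exponential series.
  have hbound : ∀ R : ℝ, 0 ≤ R → ∃ u : ℕ → ℝ, Summable u ∧
      ∀ n, ∀ w ∈ ball (0 : ℂ) R, ‖f n w‖ ≤ u n := by
    intro R hR
    obtain ⟨M, hM⟩ := (isCompact_closedBall (0 : ℂ) R).exists_bound_of_continuousOn
      hQ.continuous.continuousOn
    have hM0 : 0 ≤ M := (norm_nonneg _).trans (hM 0 (by simp [hR]))
    set C := ‖α‖ + ‖β‖ * R
    have hC : 0 ≤ C := by positivity
    have hb : ∀ n, ∀ w, ‖w‖ < R → ‖f n w‖ ≤ C * M ^ n * ‖w‖ ^ (2 * n) / (2 * n).factorial := by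
      intro n
      induction n with
      | zero =>
        intro w hw
        simp only [hf0, pow_zero, mul_one, mul_zero, Nat.factorial_zero, Nat.cast_one, div_one]
        refine (norm_add_le _ _).trans ?_
        rw [norm_mul]
        exact add_le_add_right (mul_le_mul_of_nonneg_left hw.le (norm_nonneg _)) _
      | succ n ih =>
        have h := hGH _ (hd n)
        have h1 : ∀ w, ‖w‖ < R → ‖H (f n) w‖ ≤
            C * M ^ (n + 1) * ‖w‖ ^ (2 * n + 1) / (2 * n + 1).factorial := fun w hw =>
          norm_primitive_le h.2.1 h.2.2.2 (fun z hz => by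
            rw [norm_mul]
            calc ‖Q z‖ * ‖f n z‖ ≤ M * (C * M ^ n * ‖z‖ ^ (2 * n) / (2 * n).factorial) := by
                  gcongr
                  · exact hM z (by simpa using hz.le)
                  · exact ih z hz
              _ = _ := by ring) hw
        intro w hw
        exact norm_primitive_le h.1 h.2.2.1 h1 hw
    refine ⟨fun n => C * ((M * R ^ 2) ^ n / n.factorial),
      (Real.summable_pow_div_factorial _).mul_left C, fun n w hw => ?_⟩
    rw [mem_ball_zero_iff] at hw
    refine (hb n w hw).trans ?_
    calc C * M ^ n * ‖w‖ ^ (2 * n) / (2 * n).factorial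
        ≤ C * M ^ n * R ^ (2 * n) / n.factorial := by
          gcongr
          omega
      _ = C * ((M * R ^ 2) ^ n / n.factorial) := by rw [mul_pow, pow_mul]; ring
  have hlim : TendstoLocallyUniformlyOn (fun N z => ∑ n ∈ Finset.range N, f n z)
      (fun z => ∑' n, f n z) atTop Set.univ := by
    refine tendstoLocallyUniformlyOn_sum_range fun z _ => ?_
    obtain ⟨u, hu, hb⟩ := hbound (‖z‖ + 1) (by positivity)
    refine ⟨ball 0 (‖z‖ + 1), ?_, u, hu, hb⟩
    exact mem_nhdsWithin_of_mem_nhds (isOpen_ball.mem_nhds (by simp))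
  set u : ℂ → ℂ := fun z => ∑' n, f n z with hu
  have hS : ∀ N, Differentiable ℂ fun z => ∑ n ∈ Finset.range N, f n z := fun N =>
    Differentiable.fun_sum fun n _ => hd n
  have hS' : ∀ N, deriv (fun z => ∑ n ∈ Finset.range N, f n z) =
      fun z => ∑ n ∈ Finset.range N, deriv (f n) z := fun N =>
    funext fun z => deriv_fun_sum fun n _ => hd n z
  have hS'' : ∀ N, deriv (fun z => ∑ n ∈ Finset.range N, deriv (f n) z) =
      fun z => ∑ n ∈ Finset.range N, deriv (deriv (f n)) z := fun N =>
    funext fun z => deriv_fun_sum fun n _ => ((hd n).analyticAt z).deriv.differentiableAt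
  have hlim' := hlim.deriv (Eventually.of_forall fun N => (hS N).differentiableOn) isOpen_univ
  have hlim'' := hlim'.deriv (Eventually.of_forall fun N z _ =>
    (((hS N).analyticAt z).deriv.differentiableAt).differentiableWithinAt) isOpen_univ
  refine ⟨u, ⟨?_, fun t => ?_⟩, ?_, ?_⟩
  · exact differentiableOn_univ.1 (hlim.differentiableOn
      (Eventually.of_forall fun N => (hS N).differentiableOn) isOpen_univ)
  -- Since f_{n+1}'' = Q f_n and f_0'' = 0, the second derivative of the sum of N + 1 terms is Q
  -- times the sum of N terms; hence the shift of the index.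
  · have h1 := (hlim''.tendsto_at (Set.mem_univ t)).comp (tendsto_add_atTop_nat 1)
    have h2 := (hlim.tendsto_at (Set.mem_univ t)).const_mul (Q t)
    refine tendsto_nhds_unique h1 (h2.congr fun N => ?_)
    simp only [Function.comp_apply, hS', hS'', Finset.sum_range_succ', hfs'', Finset.mul_sum]
    rw [hf0']
    simp
  · refine tendsto_nhds_unique ((hlim.tendsto_at (Set.mem_univ 0)).comp
      (tendsto_add_atTop_nat 1)) (tendsto_const_nhds.congr fun N => ?_)
    simp [Finset.sum_range_succ', hfs, fun n => (hGH _ (hd n)).1, hf0]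
  · refine tendsto_nhds_unique ((hlim'.tendsto_at (Set.mem_univ 0)).comp
      (tendsto_add_atTop_nat 1)) (tendsto_const_nhds.congr fun N => ?_)
    simp [hS', Finset.sum_range_succ', hfs', fun n => (hGH _ (hd n)).2.1, hf0']

/-- The Wronskian. -/
def wronsk (f g : ℂ → ℂ) (t : ℂ) : ℂ := f t * deriv g t - deriv f t * g t

theorem hasDerivAt_wronsk {Q f g : ℂ → ℂ} {T : Set ℂ} (hT : IsOpen T)
    (hf : DifferentiableOn ℂ f T) (hf2 : ∀ t ∈ T, deriv (deriv f) t = Q t * f t)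
    (hg : DifferentiableOn ℂ g T) (hg2 : ∀ t ∈ T, deriv (deriv g) t = Q t * g t)
    {t : ℂ} (ht : t ∈ T) : HasDerivAt (wronsk f g) 0 t := by
  have h1 := (hf.differentiableAt (hT.mem_nhds ht)).hasDerivAt
  have h2 := (hg.differentiableAt (hT.mem_nhds ht)).hasDerivAt
  have h3 := ((hf.deriv hT).differentiableAt (hT.mem_nhds ht)).hasDerivAt
  have h4 := ((hg.deriv hT).differentiableAt (hT.mem_nhds ht)).hasDerivAt
  convert! (h1.mul h4).sub (h3.mul h2) using 1
  rw [hf2 t ht, hg2 t ht]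
  ring

theorem EntireSol.wronsk_eq {Q f g : ℂ → ℂ} (hf : EntireSol Q f) (hg : EntireSol Q g) (t s : ℂ) :
    wronsk f g t = wronsk f g s := by
  have h : ∀ t, HasDerivAt (wronsk f g) 0 t := fun t =>
    hasDerivAt_wronsk isOpen_univ hf.1.differentiableOn (fun t _ => hf.2 t)
      hg.1.differentiableOn (fun t _ => hg.2 t) (Set.mem_univ t)
  exact is_const_of_deriv_eq_zero (fun t => (h t).differentiableAt) (fun t => (h t).deriv) t s

theorem EntireSol.lincomb {Q f g : ℂ → ℂ} (hf : EntireSol Q f) (hg : EntireSol Q g) (a b : ℂ) :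
    EntireSol Q fun t => a * f t + b * g t := by
  have hf' : Differentiable ℂ (deriv f) := fun t => (hf.1.analyticAt t).deriv.differentiableAt
  have hg' : Differentiable ℂ (deriv g) := fun t => (hg.1.analyticAt t).deriv.differentiableAt
  have h1 : deriv (fun t => a * f t + b * g t) = fun t => a * deriv f t + b * deriv g t :=
    funext fun t => (((hf.1 t).hasDerivAt.const_mul a).add ((hg.1 t).hasDerivAt.const_mul b)).deriv
  refine ⟨(hf.1.const_mul a).add (hg.1.const_mul b), fun t => ?_⟩
  have h2 := (((hf' t).hasDerivAt.const_mul a).add ((hg' t).hasDerivAt.const_mul b)).deriv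
  rw [hf.2, hg.2] at h2
  rw [h1]
  refine h2.trans ?_
  ring

theorem EntireSol.comp_add {Q f : ℂ → ℂ} (hf : EntireSol Q f) (s : ℂ) :
    EntireSol (fun t => Q (t + s)) fun t => f (t + s) := by
  refine ⟨hf.1.comp (differentiable_id.add_const s), fun t => ?_⟩
  have h1 : deriv (fun t => f (t + s)) = fun t => deriv f (t + s) :=
    funext fun t => deriv_comp_add_const f s t
  rw [h1, deriv_comp_add_const, hf.2]

/-- A solution on a connected open set extends to an entire solution. -/
theorem exists_entireSol_extending {Q u : ℂ → ℂ} (hQ : Differentiable ℂ Q) {T : Set ℂ}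
    (hT : IsOpen T) (hT' : IsPreconnected T) (hu : DifferentiableOn ℂ u T)
    (hu2 : ∀ t ∈ T, deriv (deriv u) t = Q t * u t) :
    ∃ U, EntireSol Q U ∧ ∀ t ∈ T, U t = u t := by
  obtain ⟨f, hf, f0, f1⟩ := exists_entireSol hQ 1 0
  obtain ⟨g, hg, g0, g1⟩ := exists_entireSol hQ 0 1
  have hfg : ∀ t, wronsk f g t = 1 := fun t => by
    rw [hf.wronsk_eq hg t 0]
    simp [wronsk, f0, f1, g0, g1]
  -- On T the Wronskians of u with the fundamental pair f, g are constants, and W(f, g) = 1 gives u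
  -- = W(u, g) f - W(u, f) g; the right side is entire.
  have const : ∀ h, EntireSol Q h → ∃ a, ∀ t ∈ T, wronsk u h t = a := fun h hh => by
    have hd : ∀ t ∈ T, HasDerivAt (wronsk u h) 0 t := fun t ht =>
      hasDerivAt_wronsk hT hu hu2 hh.1.differentiableOn (fun t _ => hh.2 t) ht
    exact hT.exists_is_const_of_deriv_eq_zero hT'
      (fun t ht => (hd t ht).differentiableAt.differentiableWithinAt) (fun t ht => (hd t ht).deriv)
  obtain ⟨a, ha⟩ := const g hg
  obtain ⟨b, hb⟩ := const f hf
  refine ⟨_, hf.lincomb hg a (-b), fun t ht => ?_⟩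
  rw [← ha t ht, ← hb t ht, ← mul_one (u t), ← hfg t]
  simp only [wronsk]
  ring

/-- If the Wronskian of two solutions vanishes and the first one is not zero, the second one is a
multiple of it. -/
theorem EntireSol.exists_eq_mul {Q f g : ℂ → ℂ} (hf : EntireSol Q f) (hg : EntireSol Q g)
    (h0 : wronsk f g 0 = 0) (hne : ∃ t, f t ≠ 0) : ∃ c, ∀ t, g t = c * f t := by
  obtain ⟨s, hs⟩ := hne
  refine ⟨g s / f s, fun t => ?_⟩
  -- f may vanish elsewhere, so g / f is shown constant only near s; the identity theorem then gives
  -- the relation everywhere.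
  have hev : ∀ᶠ t in 𝓝 s, f t ≠ 0 := hf.1.continuous.continuousAt.eventually_ne hs
  obtain ⟨r, hr, hball⟩ := Metric.eventually_nhds_iff_ball.1 hev
  have hd : ∀ t ∈ ball s r, HasDerivAt (fun t => g t / f t) 0 t := fun t ht => by
    have := (hg.1 t).hasDerivAt.div (hf.1 t).hasDerivAt (hball t ht)
    convert! this using 1
    have hw := hf.wronsk_eq hg t 0
    rw [h0, wronsk] at hw
    rw [eq_comm, div_eq_zero_iff]
    left
    linear_combination hw
  obtain ⟨c, hc⟩ := isOpen_ball.exists_is_const_of_deriv_eq_zero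
    (convex_ball s r).isPreconnected
    (fun t ht => (hd t ht).differentiableAt.differentiableWithinAt) (fun t ht => (hd t ht).deriv)
  have hcs : c = g s / f s := (hc s (mem_ball_self hr)).symm
  have heq : g =ᶠ[𝓝 s] fun t => g s / f s * f t := by
    filter_upwards [ball_mem_nhds s hr] with t ht
    rw [← hcs, ← hc t ht, div_mul_cancel₀ _ (hball t ht)]
  exact congrFun (AnalyticOnNhd.eq_of_eventuallyEq
    (fun t _ => hg.1.analyticAt t)
    (fun t _ => (hf.1.const_mul (g s / f s)).analyticAt t) heq) t

/-- Three solutions satisfy the linear relation given by their Wronskians. -/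
theorem EntireSol.wronsk_relation {Q f g h : ℂ → ℂ} (hf : EntireSol Q f) (hg : EntireSol Q g)
    (hh : EntireSol Q h) (t : ℂ) :
    wronsk g h 0 * f t - wronsk f h 0 * g t + wronsk f g 0 * h t = 0 := by
  rw [← hg.wronsk_eq hh t 0, ← hf.wronsk_eq hh t 0, ← hf.wronsk_eq hg t 0]
  simp only [wronsk]
  ring

end StokesSibuya

end

noncomputable section

namespace StokesSibuya

open Complex Filter Topology Metric MeasureTheory Set

/-! ### A Volterra equation on the complement of a cone around the negative real axis -/

/-- A piecewise linear function that grows at rate `c` along horizontal lines. -/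
def rho (c : ℝ) (z : ℂ) : ℝ := c * z.re + |z.im|

/-- The complement of a closed cone around the negative real axis. -/
def coneCompl (c L : ℝ) : Set ℂ := {z | L < rho c z}

theorem continuous_rho (c : ℝ) : Continuous (rho c) := by
  unfold rho
  fun_prop

theorem isOpen_coneCompl (c L : ℝ) : IsOpen (coneCompl c L) :=
  isOpen_lt continuous_const (continuous_rho c)

theorem rho_add_ofReal (c : ℝ) (z : ℂ) (τ : ℝ) : rho c (z + τ) = rho c z + c * τ := by
  simp [rho]
  ring

theorem add_ofReal_mem_coneCompl {c L : ℝ} (hc : 0 < c) {z : ℂ} (hz : z ∈ coneCompl c L) {τ : ℝ}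
    (hτ : 0 ≤ τ) : z + τ ∈ coneCompl c L := by
  have : 0 ≤ c * τ := by positivity
  simp only [coneCompl, mem_ofPred_eq, rho_add_ofReal] at *
  linarith

/-- `rho` is affine on every segment issuing from a real point, because |Im| is merely scaled there.
So the set is star-shaped about a point far out on the positive axis. -/
theorem isPreconnected_coneCompl {c : ℝ} (L : ℝ) (hc : 0 < c) :
    IsPreconnected (coneCompl c L) := by
  have hmem : (((|L| + 1) / c : ℝ) : ℂ) ∈ coneCompl c L := by
    simp only [coneCompl, rho, mem_ofPred_eq, ofReal_re, ofReal_im, abs_zero, add_zero]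
    rw [mul_div_cancel₀ _ hc.ne']
    exact (le_abs_self L).trans_lt (lt_add_one _)
  have hstar : StarConvex ℝ (((|L| + 1) / c : ℝ) : ℂ) (coneCompl c L) := by
    intro z hz a b ha hb hab
    simp only [coneCompl, rho, mem_ofPred_eq, add_re, add_im, real_smul, mul_re, mul_im, ofReal_re,
      ofReal_im, mul_zero, zero_mul, add_zero, sub_zero, zero_add, abs_zero] at *
    rw [abs_mul, abs_of_nonneg hb]
    have h1 : c * (a * ((|L| + 1) / c) + b * z.re) + b * |z.im| =
        a * (|L| + 1) + b * (c * z.re + |z.im|) := by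
      field_simp
      ring
    rw [h1]
    have h2 : L < |L| + 1 := (le_abs_self L).trans_lt (lt_add_one _)
    rcases ha.eq_or_lt with rfl | ha
    · have : b = 1 := by linarith
      subst this
      linarith
    · have h3 := mul_le_mul_of_nonneg_left hz.le hb
      have h4 := mul_lt_mul_of_pos_left h2 ha
      have h5 : a * L + b * L = L := by rw [← add_mul, hab, one_mul]
      linarith
  exact (StarConvex.isPathConnected (s := coneCompl c L) hstar hmem).isConnected.isPreconnected

/-- The integral runs over the horizontal ray from z to +∞, so its derivative is -g. Differentiating
under the integral needs an integrable bound on g'; Cauchy's estimate on discs of radius r / 2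
extracts it from the bound on g, since these discs lie in translates of a ball around z₀. -/
theorem hasDerivAt_integral_Ioi_add {g : ℂ → ℂ} {D : Set ℂ} (hD : IsOpen D)
    (hDadd : ∀ z ∈ D, ∀ τ : ℝ, 0 ≤ τ → z + τ ∈ D) (hg : DifferentiableOn ℂ g D) {z₀ : ℂ}
    (hz₀ : z₀ ∈ D) {V : Set ℂ} (hV : V ∈ 𝓝 z₀) {b : ℝ → ℝ} (hb : IntegrableOn b (Ioi 0))
    (hgb : ∀ w ∈ V, w ∈ D → ∀ τ : ℝ, 0 < τ → ‖g (w + τ)‖ ≤ b τ) :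
    HasDerivAt (fun z => ∫ τ in Ioi (0 : ℝ), g (z + τ)) (-g z₀) z₀ := by
  obtain ⟨r, hr, hball⟩ := Metric.mem_nhds_iff.1 (inter_mem hV (hD.mem_nhds hz₀))
  have hgd : ∀ z ∈ D, HasDerivAt g (deriv g z) z := fun z hz =>
    (hg.differentiableAt (hD.mem_nhds hz)).hasDerivAt
  have hg' : DifferentiableOn ℂ (deriv g) D := hg.deriv hD
  have hshift : ∀ z ∈ D, ContinuousOn (fun τ : ℝ => z + (τ : ℂ)) (Ioi 0) := fun z _ => by fun_prop
  have hmaps : ∀ z ∈ D, MapsTo (fun τ : ℝ => z + (τ : ℂ)) (Ioi 0) D := fun z hz τ hτ =>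
    hDadd z hz τ (le_of_lt hτ)
  have hmeas : ∀ z ∈ D, AEStronglyMeasurable (fun τ : ℝ => g (z + τ))
      (volume.restrict (Ioi 0)) := fun z hz =>
    (hg.continuousOn.comp (hshift z hz) (hmaps z hz)).aestronglyMeasurable measurableSet_Ioi
  have hint : IntegrableOn (fun τ : ℝ => g (z₀ + τ)) (Ioi 0) := by
    refine Integrable.mono' hb (hmeas z₀ hz₀) ?_
    filter_upwards [ae_restrict_mem measurableSet_Ioi] with τ hτ
    exact hgb z₀ (hball (mem_ball_self hr)).1 hz₀ τ hτ
  have hbound : ∀ τ : ℝ, 0 < τ → ∀ w ∈ ball z₀ (r / 2),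
      ‖deriv g (w + τ)‖ ≤ b τ / (r / 2) := by
    intro τ hτ w hw
    have hsub : closedBall (w + τ : ℂ) (r / 2) ⊆ (fun y : ℂ => y + τ) '' ball z₀ r := by
      intro y hy
      refine ⟨y - τ, ?_, sub_add_cancel _ _⟩
      rw [mem_ball] at hw ⊢
      rw [mem_closedBall] at hy
      calc dist (y - τ) z₀ ≤ dist (y - τ) w + dist w z₀ := dist_triangle _ _ _
        _ = dist y (w + τ) + dist w z₀ := by
          rw [dist_eq_norm, dist_eq_norm y]
          congr 2
          ring
        _ < r := by linarith
    have hsubD : closedBall (w + τ : ℂ) (r / 2) ⊆ D := by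
      intro y hy
      obtain ⟨x, hx, rfl⟩ := hsub hy
      exact hDadd x (hball hx).2 τ hτ.le
    refine norm_deriv_le_of_forall_mem_sphere_norm_le (by positivity) ?_ ?_
    · exact (hg.mono hsubD).diffContOnCl_ball subset_rfl
    · intro y hy
      obtain ⟨x, hx, rfl⟩ := hsub (sphere_subset_closedBall hy)
      exact hgb x (hball hx).1 (hball hx).2 τ hτ
  have key := hasDerivAt_integral_of_dominated_loc_of_deriv_le
    (μ := volume.restrict (Ioi (0 : ℝ))) (F := fun (z : ℂ) (τ : ℝ) => g (z + τ))
    (F' := fun (z : ℂ) (τ : ℝ) => deriv g (z + τ)) (bound := fun τ => b τ / (r / 2)) (x₀ := z₀)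
    (ball_mem_nhds z₀ (half_pos hr))
    (by filter_upwards [hD.mem_nhds hz₀] with z hz using hmeas z hz) hint
    ((hg'.continuousOn.comp (hshift z₀ hz₀) (hmaps z₀ hz₀)).aestronglyMeasurable
      measurableSet_Ioi)
    (by filter_upwards [ae_restrict_mem measurableSet_Ioi] with τ hτ using hbound τ hτ)
    (hb.div_const _)
    (by
      filter_upwards [ae_restrict_mem measurableSet_Ioi] with τ hτ w hw
      have hwD : w ∈ D := (hball (ball_subset_ball (half_le_self hr.le) hw)).2
      exact (hgd _ (hDadd w hwD τ (le_of_lt hτ))).comp_add_const w _)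
  have hd : ∀ τ : ℝ, 0 ≤ τ → HasDerivAt (fun τ : ℝ => g (z₀ + τ)) (deriv g (z₀ + τ)) τ := by
    intro τ hτ
    have h1 : HasDerivAt (fun s : ℝ => z₀ + (s : ℂ)) 1 τ :=
      (HasDerivAt.ofReal_comp (hasDerivAt_id τ)).const_add z₀
    have := (hgd _ (hDadd z₀ hz₀ τ hτ)).scomp τ h1
    simpa [Function.comp_def] using! this
  have hlim : Tendsto (fun τ : ℝ => g (z₀ + τ)) atTop (𝓝 0) :=
    tendsto_zero_of_hasDerivAt_of_integrableOn_Ioi (fun τ hτ => hd τ (le_of_lt hτ)) key.1 hint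
  have hval := integral_Ioi_of_hasDerivAt_of_tendsto' (fun τ hτ => hd τ hτ) key.1 hlim
  have := key.2
  rw [hval] at this
  simpa using this

theorem integral_Ioi_rpow_add_mul {A c β : ℝ} (hA : 0 < A) (hc : 0 < c) (hβ : 0 < β) :
    IntegrableOn (fun τ : ℝ => (A + c * τ) ^ (-(β + 1))) (Ioi 0) ∧
      ∫ τ in Ioi (0 : ℝ), (A + c * τ) ^ (-(β + 1)) = A ^ (-β) / (c * β) := by
  have hd : ∀ τ ∈ Ici (0 : ℝ), HasDerivAt (fun τ : ℝ => -((A + c * τ) ^ (-β) / (c * β)))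
      ((A + c * τ) ^ (-(β + 1))) τ := by
    intro τ hτ
    have hpos : 0 < A + c * τ := by
      have : 0 ≤ c * τ := mul_nonneg hc.le hτ
      linarith
    have h1 : HasDerivAt (fun τ : ℝ => A + c * τ) c τ := by
      simpa using ((hasDerivAt_id τ).const_mul c).const_add A
    have h2 := ((h1.rpow_const (p := -β) (Or.inl hpos.ne')).div_const (c * β)).neg
    convert! h2 using 1
    rw [show -β - 1 = -(β + 1) by ring]
    field_simp
  have hnn : ∀ τ ∈ Ioi (0 : ℝ), 0 ≤ (A + c * τ) ^ (-(β + 1)) := by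
    intro τ hτ
    have : 0 ≤ c * τ := mul_nonneg hc.le (le_of_lt hτ)
    positivity
  have hlim : Tendsto (fun τ : ℝ => -((A + c * τ) ^ (-β) / (c * β))) atTop (𝓝 0) := by
    have h1 : Tendsto (fun τ : ℝ => A + c * τ) atTop atTop :=
      tendsto_atTop_add_const_left _ _ (tendsto_id.const_mul_atTop hc)
    have h2 := (((tendsto_rpow_neg_atTop hβ).comp h1).div_const (c * β)).neg
    simpa using h2
  refine ⟨integrableOn_Ioi_deriv_of_nonneg' hd hnn hlim, ?_⟩
  rw [integral_Ioi_of_hasDerivAt_of_nonneg' hd hnn hlim]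
  simp

section Volterra

variable {c L lam β : ℝ} {G : ℂ → ℂ}

/-- Gives the exponential decay of e^G along rightward rays, which makes integration from +∞
converge. -/
theorem re_add_le_of_deriv (hc : 0 < c) (hG : DifferentiableOn ℂ G (coneCompl c L))
    (hG' : ∀ z ∈ coneCompl c L, (deriv G z).re ≤ -lam) {z : ℂ} (hz : z ∈ coneCompl c L) {τ : ℝ}
    (hτ : 0 ≤ τ) : (G (z + τ)).re ≤ (G z).re - lam * τ := by
  have hd : ∀ s : ℝ, 0 ≤ s → HasDerivAt (fun s : ℝ => (G (z + s)).re) (deriv G (z + s)).re s := by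
    intro s hs
    have h0 := (hG.differentiableAt ((isOpen_coneCompl c L).mem_nhds
      (add_ofReal_mem_coneCompl hc hz hs))).hasDerivAt
    have h1 : HasDerivAt (fun s : ℝ => z + (s : ℂ)) 1 s :=
      (HasDerivAt.ofReal_comp (hasDerivAt_id s)).const_add z
    have h2 := h0.scomp s h1
    rw [one_smul] at h2
    exact reCLM.hasFDerivAt.comp_hasDerivAt s h2
  have key := image_le_of_deriv_right_le_deriv_boundary (f := fun s : ℝ => (G (z + s)).re)
    (f' := fun s : ℝ => (deriv G (z + s)).re) (a := 0) (b := τ)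
    (B := fun s => (G z).re - lam * s) (B' := fun _ => -lam)
    (fun s hs => (hd s hs.1).continuousAt.continuousWithinAt)
    (fun s hs => (hd s hs.1).hasDerivWithinAt) (by simp) (by fun_prop)
    (fun s _ => by
      have := ((hasDerivAt_id s).const_mul lam).const_sub (G z).re
      simpa using! this.hasDerivWithinAt)
    (fun s hs => hG' _ (add_ofReal_mem_coneCompl hc hz hs.1))
  exact key (right_mem_Icc.2 hτ)

/-- The first order equation `y' + G' y + F = 0`. -/
theorem exists_sol_first_order (hc : 0 < c) (hL : 0 < L) (hlam : 0 < lam)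
    (hG : DifferentiableOn ℂ G (coneCompl c L))
    (hG' : ∀ z ∈ coneCompl c L, (deriv G z).re ≤ -lam) {F : ℂ → ℂ}
    (hF : DifferentiableOn ℂ F (coneCompl c L)) {s M : ℝ} (hs : 0 < s) (hM : 0 ≤ M)
    (hFb : ∀ z ∈ coneCompl c L, ‖F z‖ ≤ M * rho c z ^ (-s)) :
    ∃ y : ℂ → ℂ, (∀ z ∈ coneCompl c L, HasDerivAt y (-(deriv G z * y z) - F z) z) ∧
      ∀ z ∈ coneCompl c L, ‖y z‖ ≤ M / lam * rho c z ^ (-s) := by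
  have hD := isOpen_coneCompl c L
  have hadd : ∀ z ∈ coneCompl c L, ∀ τ : ℝ, 0 ≤ τ → z + τ ∈ coneCompl c L := fun z hz τ hτ =>
    add_ofReal_mem_coneCompl hc hz hτ
  -- e^G is the integrating factor: y(z) = e^(-G(z)) ∫ e^G F over the ray from z to +∞. The decay
  -- rate `lam` of e^G costs the factor 1 / `lam`.
  set g : ℂ → ℂ := fun z => exp (G z) * F z with hg
  have hgd : DifferentiableOn ℂ g (coneCompl c L) := hG.cexp.mul hF
  have hgb : ∀ z ∈ coneCompl c L, ∀ τ : ℝ, 0 < τ →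
      ‖g (z + τ)‖ ≤ Real.exp (G z).re * (M * rho c z ^ (-s)) * Real.exp (-lam * τ) := by
    intro z hz τ hτ
    have hρ : 0 < rho c z := hL.trans hz
    rw [hg, norm_mul, norm_exp]
    calc Real.exp (G (z + τ)).re * ‖F (z + τ)‖
        ≤ Real.exp ((G z).re - lam * τ) * (M * rho c z ^ (-s)) := by
          gcongr
          · exact re_add_le_of_deriv hc hG hG' hz hτ.le
          · refine (hFb _ (hadd z hz τ hτ.le)).trans ?_
            rw [rho_add_ofReal]
            refine mul_le_mul_of_nonneg_left
              (Real.rpow_le_rpow_of_nonpos hρ ?_ (neg_nonpos.2 hs.le)) hM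
            have : 0 ≤ c * τ := by positivity
            linarith
      _ = _ := by
          rw [sub_eq_add_neg, Real.exp_add, ← neg_mul]
          ring
  have hexpint : IntegrableOn (fun τ : ℝ => Real.exp (-lam * τ)) (Ioi 0) :=
    integrableOn_exp_mul_Ioi (neg_lt_zero.2 hlam) 0
  refine ⟨fun z => exp (-G z) * ∫ τ in Ioi (0 : ℝ), g (z + τ), fun z hz => ?_, fun z hz => ?_⟩
  · have hGz : HasDerivAt G (deriv G z) z := (hG.differentiableAt (hD.mem_nhds hz)).hasDerivAt
    -- Near z, Re G stays below Re G(z) + 1, which makes the dominating function independent of the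
    -- point.
    have hV : {w : ℂ | (G w).re < (G z).re + 1} ∈ 𝓝 z :=
      (continuous_re.continuousAt.comp hGz.continuousAt).eventually_lt_const (by simp)
    have h1 : HasDerivAt (fun z => ∫ τ in Ioi (0 : ℝ), g (z + τ)) (-g z) z := by
      refine hasDerivAt_integral_Ioi_add hD hadd hgd hz hV
        (b := fun τ => Real.exp ((G z).re + 1) * (M * L ^ (-s)) * Real.exp (-lam * τ))
        (hexpint.const_mul _) ?_
      intro w hw hwD τ hτ
      refine (hgb w hwD τ hτ).trans ?_
      have h3 : rho c w ^ (-s) ≤ L ^ (-s) :=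
        Real.rpow_le_rpow_of_nonpos hL (le_of_lt (show L < rho c w from hwD)) (neg_nonpos.2 hs.le)
      have h4 : Real.exp (G w).re ≤ Real.exp ((G z).re + 1) := Real.exp_le_exp.2 (le_of_lt hw)
      have hρ : 0 < rho c w := hL.trans hwD
      gcongr
    have h2 := hGz.neg.cexp.mul h1
    convert! h2 using 1
    have h3 : exp (-G z) * exp (G z) = 1 := by rw [← exp_add]; simp
    simp only [hg]
    linear_combination F z * h3
  · have hρ : 0 < rho c z := hL.trans hz
    have h1 : ‖∫ τ in Ioi (0 : ℝ), g (z + τ)‖ ≤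
        ∫ τ in Ioi (0 : ℝ), Real.exp (G z).re * (M * rho c z ^ (-s)) * Real.exp (-lam * τ) := by
      refine norm_integral_le_of_norm_le (hexpint.const_mul _) ?_
      filter_upwards [ae_restrict_mem measurableSet_Ioi] with τ hτ using hgb z hz τ hτ
    have h2 : ∫ τ in Ioi (0 : ℝ), Real.exp (-lam * τ) = 1 / lam := by
      rw [integral_exp_mul_Ioi (neg_lt_zero.2 hlam) 0]
      simp
    rw [integral_const_mul, h2] at h1
    rw [norm_mul, norm_exp, neg_re]
    calc Real.exp (-(G z).re) * ‖∫ τ in Ioi (0 : ℝ), g (z + τ)‖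
        ≤ Real.exp (-(G z).re) * (Real.exp (G z).re * (M * rho c z ^ (-s)) * (1 / lam)) := by
          gcongr
      _ = M / lam * rho c z ^ (-s) := by
          rw [Real.exp_neg]
          field_simp

/-- The inhomogeneous equation `w'' + G' w' + F = 0`. -/
theorem exists_sol_inhomogeneous (hc : 0 < c) (hL : 0 < L) (hlam : 0 < lam) (hβ : 0 < β)
    (hG : DifferentiableOn ℂ G (coneCompl c L))
    (hG' : ∀ z ∈ coneCompl c L, (deriv G z).re ≤ -lam) {F : ℂ → ℂ}
    (hF : DifferentiableOn ℂ F (coneCompl c L)) {M : ℝ} (hM : 0 ≤ M)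
    (hFb : ∀ z ∈ coneCompl c L, ‖F z‖ ≤ M * rho c z ^ (-(β + 1))) :
    ∃ w : ℂ → ℂ, DifferentiableOn ℂ w (coneCompl c L) ∧
      (∀ z ∈ coneCompl c L, deriv (deriv w) z = -(deriv G z * deriv w z) - F z) ∧
      ∀ z ∈ coneCompl c L, ‖w z‖ ≤ M / (lam * (c * β)) * rho c z ^ (-β) := by
  have hD := isOpen_coneCompl c L
  have hadd : ∀ z ∈ coneCompl c L, ∀ τ : ℝ, 0 ≤ τ → z + τ ∈ coneCompl c L := fun z hz τ hτ =>
    add_ofReal_mem_coneCompl hc hz hτ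
  -- y plays the role of w'. The second integration, again from +∞, lowers the decay from β + 1 to β
  -- and costs 1 / (c β).
  obtain ⟨y, hy, hyb⟩ := exists_sol_first_order hc hL hlam hG hG' hF (s := β + 1) (by linarith)
    hM hFb
  have hyd : DifferentiableOn ℂ y (coneCompl c L) := fun z hz =>
    (hy z hz).differentiableAt.differentiableWithinAt
  have hyb' : ∀ z ∈ coneCompl c L, ∀ τ : ℝ, 0 < τ →
      ‖y (z + τ)‖ ≤ M / lam * (rho c z + c * τ) ^ (-(β + 1)) := by
    intro z hz τ hτ
    rw [← rho_add_ofReal]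
    exact hyb _ (hadd z hz τ hτ.le)
  have hw : ∀ z ∈ coneCompl c L,
      HasDerivAt (fun z => -∫ τ in Ioi (0 : ℝ), y (z + τ)) (y z) z := by
    intro z hz
    have := (hasDerivAt_integral_Ioi_add hD hadd hyd hz univ_mem
      (b := fun τ => M / lam * (L + c * τ) ^ (-(β + 1)))
      ((integral_Ioi_rpow_add_mul hL hc hβ).1.const_mul _) ?_).neg
    · simpa using! this
    · intro w _ hw τ hτ
      refine (hyb' w hw τ hτ).trans ?_
      have h1 : 0 < c * τ := by positivity
      gcongr ?_ * ?_
      exact Real.rpow_le_rpow_of_nonpos (by linarith) (by linarith [show L < rho c w from hw])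
        (by linarith)
  have hderiv : ∀ z ∈ coneCompl c L,
      deriv (fun z => -∫ τ in Ioi (0 : ℝ), y (z + τ)) z = y z := fun z hz => (hw z hz).deriv
  refine ⟨fun z => -∫ τ in Ioi (0 : ℝ), y (z + τ), fun z hz =>
    (hw z hz).differentiableAt.differentiableWithinAt, fun z hz => ?_, fun z hz => ?_⟩
  · have hev : deriv (fun z => -∫ τ in Ioi (0 : ℝ), y (z + τ)) =ᶠ[𝓝 z] y := by
      filter_upwards [hD.mem_nhds hz] with x hx using hderiv x hx
    rw [hev.deriv_eq, hderiv z hz, (hy z hz).deriv]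
  · have hρ : 0 < rho c z := hL.trans hz
    have hint := integral_Ioi_rpow_add_mul hρ hc hβ
    have h1 : ‖∫ τ in Ioi (0 : ℝ), y (z + τ)‖ ≤
        ∫ τ in Ioi (0 : ℝ), M / lam * (rho c z + c * τ) ^ (-(β + 1)) := by
      refine norm_integral_le_of_norm_le (hint.1.const_mul _) ?_
      filter_upwards [ae_restrict_mem measurableSet_Ioi] with τ hτ using hyb' z hz τ hτ
    rw [integral_const_mul, hint.2] at h1
    rw [norm_neg]
    refine h1.trans (le_of_eq ?_)
    field_simp

/-- The equation `w'' + G' w' + E w + F = 0` with a small coefficient `E`. -/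
theorem exists_sol_volterra (hc : 0 < c) (hL : 0 < L) (hlam : 0 < lam) (hβ : 0 < β)
    (hG : DifferentiableOn ℂ G (coneCompl c L))
    (hG' : ∀ z ∈ coneCompl c L, (deriv G z).re ≤ -lam) {E F : ℂ → ℂ}
    (hE : DifferentiableOn ℂ E (coneCompl c L)) (hF : DifferentiableOn ℂ F (coneCompl c L))
    {A M : ℝ} (hA : 0 ≤ A) (hM : 0 ≤ M) (hAs : A / (lam * (c * β)) ≤ 1 / 2)
    (hEb : ∀ z ∈ coneCompl c L, ‖E z‖ ≤ A * (rho c z)⁻¹)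
    (hFb : ∀ z ∈ coneCompl c L, ‖F z‖ ≤ M * rho c z ^ (-(β + 1))) :
    ∃ (w : ℂ → ℂ) (K : ℝ), DifferentiableOn ℂ w (coneCompl c L) ∧
      (∀ z ∈ coneCompl c L,
        deriv (deriv w) z = -(deriv G z * deriv w z) - (E z * w z + F z)) ∧
      ∀ z ∈ coneCompl c L, ‖w z‖ ≤ K * rho c z ^ (-β) := by
  have hD := isOpen_coneCompl c L
  set κ := lam * (c * β) with hκ
  have hκ0 : 0 < κ := by positivity
  -- One Neumann step, with E f as inhomogeneity. E contributes one power of 1/ρ, lost again by the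
  -- integrations, and the smallness of A halves the constant; the iterates therefore sum
  -- geometrically.
  have step : ∀ (f : ℂ → ℂ) (K : ℝ), ∃ w : ℂ → ℂ, 0 ≤ K →
      DifferentiableOn ℂ f (coneCompl c L) →
      (∀ z ∈ coneCompl c L, ‖f z‖ ≤ K * rho c z ^ (-β)) →
      DifferentiableOn ℂ w (coneCompl c L) ∧
      (∀ z ∈ coneCompl c L, deriv (deriv w) z = -(deriv G z * deriv w z) - E z * f z) ∧
      ∀ z ∈ coneCompl c L, ‖w z‖ ≤ K / 2 * rho c z ^ (-β) := by
    intro f K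
    by_cases h : 0 ≤ K ∧ DifferentiableOn ℂ f (coneCompl c L) ∧
      ∀ z ∈ coneCompl c L, ‖f z‖ ≤ K * rho c z ^ (-β)
    · obtain ⟨hK, hf, hfb⟩ := h
      obtain ⟨w, hw, hw2, hwb⟩ := exists_sol_inhomogeneous hc hL hlam hβ hG hG' (hE.mul hf)
        (mul_nonneg hA hK) (fun z hz => by
          have hρ : 0 < rho c z := hL.trans hz
          rw [Pi.mul_apply, norm_mul, neg_add, Real.rpow_add hρ, Real.rpow_neg_one]
          calc ‖E z‖ * ‖f z‖ ≤ (A * (rho c z)⁻¹) * (K * rho c z ^ (-β)) := by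
                gcongr
                · exact hEb z hz
                · exact hfb z hz
            _ = _ := by ring)
      refine ⟨w, fun _ _ _ => ⟨hw, hw2, fun z hz => (hwb z hz).trans ?_⟩⟩
      have hρ : 0 < rho c z := hL.trans hz
      refine mul_le_mul_of_nonneg_right ?_ (by positivity)
      calc A * K / κ = K * (A / κ) := by ring
        _ ≤ K * (1 / 2) := by gcongr
        _ = K / 2 := by ring
    · exact ⟨0, fun h1 h2 h3 => absurd ⟨h1, h2, h3⟩ h⟩
  choose W hW using step
  obtain ⟨w₀, hw₀, hw₀2, hw₀b⟩ := exists_sol_inhomogeneous hc hL hlam hβ hG hG' hF hM hFb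
  set K := M / κ with hK
  have hK0 : 0 ≤ K := by positivity
  let f : ℕ → ℂ → ℂ := fun n => Nat.rec w₀ (fun n g => W g (K * (1 / 2) ^ n)) n
  have hf0 : f 0 = w₀ := rfl
  have hfs : ∀ n, f (n + 1) = W (f n) (K * (1 / 2) ^ n) := fun n => rfl
  have hf : ∀ n, DifferentiableOn ℂ (f n) (coneCompl c L) ∧
      ∀ z ∈ coneCompl c L, ‖f n z‖ ≤ K * (1 / 2) ^ n * rho c z ^ (-β) := by
    intro n
    induction n with
    | zero => exact ⟨hw₀, by simpa [hf0] using hw₀b⟩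
    | succ n ih =>
      have := hW (f n) (K * (1 / 2) ^ n) (by positivity) ih.1 ih.2
      refine ⟨this.1, fun z hz => (this.2.2 z hz).trans_eq ?_⟩
      ring
  have hf2 : ∀ n, ∀ z ∈ coneCompl c L, deriv (deriv (f (n + 1))) z =
      -(deriv G z * deriv (f (n + 1)) z) - E z * f n z := fun n =>
    (hW (f n) (K * (1 / 2) ^ n) (by positivity) (hf n).1 (hf n).2).2.1
  have hsum : Summable fun n : ℕ => K * (1 / 2 : ℝ) ^ n :=
    (summable_geometric_of_lt_one (by norm_num) (by norm_num)).mul_left K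
  have hlim : TendstoLocallyUniformlyOn (fun N z => ∑ n ∈ Finset.range N, f n z)
      (fun z => ∑' n, f n z) atTop (coneCompl c L) := by
    refine tendstoLocallyUniformlyOn_sum_range fun z _ =>
      ⟨coneCompl c L, self_mem_nhdsWithin, _, hsum.mul_right (L ^ (-β)), fun n w hw =>
        ((hf n).2 w hw).trans ?_⟩
    exact mul_le_mul_of_nonneg_left (Real.rpow_le_rpow_of_nonpos hL
      (le_of_lt (show L < rho c w from hw)) (neg_nonpos.2 hβ.le)) (by positivity)
  have hS : ∀ N, DifferentiableOn ℂ (fun z => ∑ n ∈ Finset.range N, f n z) (coneCompl c L) :=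
    fun N => DifferentiableOn.fun_sum fun n _ => (hf n).1
  have hS' : ∀ N, ∀ z ∈ coneCompl c L, deriv (fun z => ∑ n ∈ Finset.range N, f n z) z =
      ∑ n ∈ Finset.range N, deriv (f n) z := fun N z hz =>
    deriv_fun_sum fun n _ => (hf n).1.differentiableAt (hD.mem_nhds hz)
  have hS'' : ∀ N, ∀ z ∈ coneCompl c L, deriv (deriv (fun z => ∑ n ∈ Finset.range N, f n z)) z =
      ∑ n ∈ Finset.range N, deriv (deriv (f n)) z := fun N z hz => by
    have hev : deriv (fun z => ∑ n ∈ Finset.range N, f n z) =ᶠ[𝓝 z]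
        fun z => ∑ n ∈ Finset.range N, deriv (f n) z := by
      filter_upwards [hD.mem_nhds hz] with x hx using hS' N x hx
    rw [hev.deriv_eq]
    exact deriv_fun_sum fun n _ => ((hf n).1.deriv hD).differentiableAt (hD.mem_nhds hz)
  have hlim' := hlim.deriv (Eventually.of_forall hS) hD
  have hlim'' := hlim'.deriv (Eventually.of_forall fun N => (hS N).deriv hD) hD
  refine ⟨fun z => ∑' n, f n z, K * 2, hlim.differentiableOn (Eventually.of_forall hS) hD,
    fun z hz => ?_, fun z hz => ?_⟩
  · have h1 := (hlim''.tendsto_at hz).comp (tendsto_add_atTop_nat 1)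
    have h2 := ((hlim'.tendsto_at hz).comp (tendsto_add_atTop_nat 1)).const_mul (deriv G z)
    have h3 := ((hlim.tendsto_at hz).const_mul (E z)).add_const (F z)
    refine tendsto_nhds_unique h1 ((h2.neg.sub h3).congr fun N => ?_)
    simp only [Function.comp_apply, hS' _ z hz, hS'' _ z hz, Finset.sum_range_succ', hf2 _ z hz,
      Finset.mul_sum, Finset.sum_sub_distrib, Finset.sum_neg_distrib, hf0, hw₀2 z hz]
    rw [mul_add, Finset.mul_sum]
    ring
  · refine (tsum_of_norm_bounded ((hsum.mul_right (rho c z ^ (-β))).hasSum)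
      fun n => (hf n).2 z hz).trans_eq ?_
    rw [tsum_mul_right, tsum_mul_left, tsum_geometric_of_lt_one (by norm_num) (by norm_num)]
    norm_num

end Volterra

end StokesSibuya

end

noncomputable section

namespace StokesSibuya

open Polynomial

/-! ### Formal solutions in `X = x ^ (-1/2)` -/

/-- The Euler derivation `X d/dX`. -/
def euler (p : ℂ[X]) : ℂ[X] := X * derivative p

/-- The operator whose formal kernel gives the formal solutions at infinity. -/
def formalOp (m : ℕ) (h e p : ℂ[X]) : ℂ[X] :=
  C (1 / 4) * X ^ m * euler (euler p) - h * euler p + e * p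

/-- Evenness of a polynomial. -/
def IsEvenPoly (p : ℂ[X]) : Prop := p.comp (-X) = p

theorem IsEvenPoly.coeff_eq_zero {p : ℂ[X]} (hp : IsEvenPoly p) {n : ℕ} (hn : Odd n) :
    p.coeff n = 0 := by
  have h := congrArg (fun q => q.coeff n) hp
  rw [show (-X : ℂ[X]) = C (-1) * X by simp] at h
  simp only [comp_C_mul_X_coeff, hn.neg_one_pow] at h
  linear_combination -(1 / 2) * h

theorem IsEvenPoly.mul {p q : ℂ[X]} (hp : IsEvenPoly p) (hq : IsEvenPoly q) :
    IsEvenPoly (p * q) := by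
  unfold IsEvenPoly at *
  rw [mul_comp, hp, hq]

theorem IsEvenPoly.add {p q : ℂ[X]} (hp : IsEvenPoly p) (hq : IsEvenPoly q) :
    IsEvenPoly (p + q) := by
  unfold IsEvenPoly at *
  rw [add_comp, hp, hq]

theorem IsEvenPoly.neg {p : ℂ[X]} (hp : IsEvenPoly p) : IsEvenPoly (-p) := by
  unfold IsEvenPoly at *
  rw [neg_comp, hp]

theorem IsEvenPoly.sub {p q : ℂ[X]} (hp : IsEvenPoly p) (hq : IsEvenPoly q) :
    IsEvenPoly (p - q) := by
  unfold IsEvenPoly at *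
  rw [sub_comp, hp, hq]

theorem isEvenPoly_C (c : ℂ) : IsEvenPoly (C c) := C_comp

theorem isEvenPoly_X_pow {n : ℕ} (hn : Even n) : IsEvenPoly (X ^ n) := by
  unfold IsEvenPoly
  rw [X_pow_comp, hn.neg_pow]

theorem IsEvenPoly.euler {p : ℂ[X]} (hp : IsEvenPoly p) : IsEvenPoly (euler p) := by
  unfold IsEvenPoly StokesSibuya.euler at *
  have h := congrArg derivative hp
  rw [derivative_comp] at h
  rw [mul_comp, X_comp]
  calc -X * (derivative p).comp (-X) = X * (derivative (-X) * (derivative p).comp (-X)) := by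
        simp
    _ = X * derivative p := by rw [h]

theorem IsEvenPoly.formalOp {m : ℕ} {h e p : ℂ[X]} (hm : Even m) (hh : IsEvenPoly h)
    (he : IsEvenPoly e) (hp : IsEvenPoly p) : IsEvenPoly (formalOp m h e p) :=
  ((((isEvenPoly_C _).mul (isEvenPoly_X_pow hm)).mul hp.euler.euler).sub (hh.mul hp.euler)).add
    (he.mul hp)

theorem euler_C_mul_X_pow (c : ℂ) (n : ℕ) : euler (C c * X ^ n) = C (n * c) * X ^ n := by
  unfold euler
  rw [derivative_C_mul_X_pow]
  rcases n with _ | n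
  · simp
  · simp only [Nat.add_sub_cancel, pow_succ, mul_comm (c : ℂ)]
    ring

theorem euler_add (p q : ℂ[X]) : euler (p + q) = euler p + euler q := by
  simp [euler, mul_add]

theorem formalOp_add (m : ℕ) (h e p q : ℂ[X]) :
    formalOp m h e (p + q) = formalOp m h e p + formalOp m h e q := by
  simp only [formalOp, euler_add]
  ring

/-- A partial sum of the formal solution (up to degree `k`). -/
def formalSum (m : ℕ) (h e : ℂ[X]) : ℕ → ℂ[X]
  | 0 => 1
  | k + 1 => formalSum m h e k +
      C (-(formalOp m h e (formalSum m h e k)).coeff (k + 1) / (k + 1 : ℕ)) * X ^ (k + 1)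

/-- The coefficients of the formal solution. -/
def formalCoeff (m : ℕ) (h e : ℂ[X]) : ℕ → ℂ
  | 0 => 1
  | k + 1 => -(formalOp m h e (formalSum m h e k)).coeff (k + 1) / (k + 1 : ℕ)

theorem formalSum_eq (m : ℕ) (h e : ℂ[X]) (k : ℕ) :
    formalSum m h e k = ∑ n ∈ Finset.range (k + 1), C (formalCoeff m h e n) * X ^ n := by
  induction k with
  | zero => simp [formalSum, formalCoeff]
  | succ k ih =>
    rw [Finset.sum_range_succ, ← ih]
    rfl

/-- As h(0) = -1, the term -h X d/dX multiplies X^n by n to leading order, while X^m and e raise the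
degree. So the coefficient in degree n is solved for by dividing by n, and a new term does not
disturb lower degrees. -/
theorem X_pow_dvd_formalOp_formalSum {m : ℕ} (hm : 0 < m) {h e : ℂ[X]} (h0 : h.coeff 0 = -1)
    (e0 : e.coeff 0 = 0) (k : ℕ) : X ^ (k + 1) ∣ formalOp m h e (formalSum m h e k) := by
  induction k with
  | zero =>
    simp only [formalSum, formalOp, euler, derivative_one, mul_zero, sub_zero, zero_add, mul_one,
      pow_one, derivative_zero]
    exact X_dvd_iff.2 e0
  | succ k ih =>
    rw [X_pow_dvd_iff] at ih ⊢
    intro d hd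
    set c := -(formalOp m h e (formalSum m h e k)).coeff (k + 1) / (k + 1 : ℕ) with hc
    have hs : formalSum m h e (k + 1) = formalSum m h e k + C c * X ^ (k + 1) := rfl
    have hop : formalOp m h e (C c * X ^ (k + 1)) =
        (C (1 / 4 * ((k + 1 : ℕ) * ((k + 1 : ℕ) * c))) * X ^ m - C ((k + 1 : ℕ) * c) * h
          + C c * e) * X ^ (k + 1) := by
      simp only [formalOp, euler_C_mul_X_pow]
      rw [C_mul (a := (1 / 4 : ℂ))]
      ring
    rw [hs, formalOp_add, coeff_add, hop, coeff_mul_X_pow']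
    have hk : ((k + 1 : ℕ) : ℂ) ≠ 0 := Nat.cast_ne_zero.2 k.succ_ne_zero
    rcases Nat.lt_or_ge d (k + 1) with hlt | hge
    · rw [ih d hlt, if_neg (by omega), add_zero]
    · have hd' : d = k + 1 := by omega
      subst hd'
      rw [if_pos le_rfl, Nat.sub_self]
      simp only [coeff_add, coeff_sub, coeff_C_mul, coeff_X_pow, h0, e0]
      rw [if_neg hm.ne]
      rw [hc]
      field_simp
      ring

theorem isEvenPoly_formalSum {m : ℕ} {h e : ℂ[X]} (hm : Even m) (hh : IsEvenPoly h)
    (he : IsEvenPoly e) (k : ℕ) : IsEvenPoly (formalSum m h e k) := by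
  induction k with
  | zero => exact isEvenPoly_C 1
  | succ k ih =>
    refine ih.add ?_
    rcases Nat.even_or_odd (k + 1) with h1 | h1
    · exact (isEvenPoly_C _).mul (isEvenPoly_X_pow h1)
    · rw [(hh.formalOp hm he ih).coeff_eq_zero h1]
      simpa using isEvenPoly_C 0

theorem formalCoeff_eq_zero {m : ℕ} {h e : ℂ[X]} (hm : Even m) (hh : IsEvenPoly h)
    (he : IsEvenPoly e) {n : ℕ} (hn : Odd n) : formalCoeff m h e n = 0 := by
  rcases n with _ | k
  · exact absurd hn (by decide)
  · rw [formalCoeff, (hh.formalOp hm he (isEvenPoly_formalSum hm hh he k)).coeff_eq_zero hn]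
    simp

/-! ### The formal equation attached to `P_m` -/

/-- `x ^ (-m / 2) x S'(x)` as a polynomial in `x ^ (-1/2)`. -/
def wkbPoly (m : ℕ) (a : Fin m → ℂ) : ℂ[X] :=
  ∑ k ∈ (Finset.range m).filter (fun k => 2 * k < m), C (sqrtCoeff m a k) * X ^ (2 * k)

/-- `x ^ (-m) P_m(x)` as a polynomial in `x ^ (-1/2)`. -/
def revPoly (m : ℕ) (a : Fin m → ℂ) : ℂ[X] :=
  ∑ k ∈ Finset.range (m + 1), C (revCoeff m a k) * X ^ (2 * k)

theorem isEvenPoly_sum {s : Finset ℕ} (f : ℕ → ℂ) :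
    IsEvenPoly (∑ k ∈ s, C (f k) * X ^ (2 * k)) := by
  classical
  induction s using Finset.induction_on with
  | empty => simpa using isEvenPoly_C 0
  | insert k s hk ih =>
    rw [Finset.sum_insert hk]
    exact ((isEvenPoly_C _).mul (isEvenPoly_X_pow (even_two_mul k))).add ih

/-- The middle coefficient `b₀` for even `m`, and `0` for odd `m`. -/
def midCoeff (m : ℕ) (a : Fin m → ℂ) : ℂ := if Even m then sqrtCoeff m a (m / 2) else 0

theorem sum_range_half_eq (m : ℕ) (a : Fin m → ℂ) :
    ∑ k ∈ Finset.range (m / 2 + 1), C (sqrtCoeff m a k) * X ^ (2 * k) =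
      wkbPoly m a + C (midCoeff m a) * X ^ m := by
  unfold wkbPoly midCoeff
  rcases Nat.even_or_odd m with hm | hm
  · have h2 : 2 * (m / 2) = m := Nat.two_mul_div_two_of_even hm
    have hf : (Finset.range m).filter (fun k => 2 * k < m) = Finset.range (m / 2) := by
      ext k
      simp only [Finset.mem_filter, Finset.mem_range]
      omega
    rw [hf, if_pos hm, Finset.sum_range_succ, h2]
  · have hf : (Finset.range m).filter (fun k => 2 * k < m) = Finset.range (m / 2 + 1) := by
      ext k
      have := Nat.two_mul_div_two_add_one_of_odd hm
      simp only [Finset.mem_filter, Finset.mem_range]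
      omega
    rw [hf, if_neg (Nat.not_even_iff_odd.2 hm)]
    simp

theorem wkbPoly_coeff_zero {m : ℕ} (hm : 0 < m) (a : Fin m → ℂ) : (wkbPoly m a).coeff 0 = 1 := by
  unfold wkbPoly
  rw [finsetSum_coeff, Finset.sum_eq_single 0]
  · simp [sqrtCoeff]
  · intro k _ hk
    rw [coeff_C_mul_X_pow, if_neg (by omega)]
  · intro h
    simp [hm] at h

/-- Both polynomials are polynomials in X² = 1/x. The square root truncated at k ≤ m/2 is correct up
to that order in 1/x, and 2 (⌊m/2⌋ + 1) ≥ m + 1. -/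
theorem X_pow_dvd_sq_sub (m : ℕ) (a : Fin m → ℂ) :
    X ^ (m + 1) ∣ (wkbPoly m a + C (midCoeff m a) * X ^ m) ^ 2 - revPoly m a := by
  have hexp : ∀ (f : ℕ → ℂ) (n : ℕ), ∑ k ∈ Finset.range n, C (f k) * X ^ (2 * k) =
      expand ℂ 2 (∑ k ∈ Finset.range n, C (f k) * X ^ k) := by
    intro f n
    simp [map_sum, expand_C, ← pow_mul]
  have hcoeff : ∀ (f : ℕ → ℂ) (n d : ℕ), d < n →
      (∑ k ∈ Finset.range n, C (f k) * X ^ k : ℂ[X]).coeff d = f d := by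
    intro f n d hd
    simp [coeff_X_pow, hd]
  rw [← sum_range_half_eq, revPoly, hexp, hexp, ← map_pow, ← map_sub]
  have hdvd : X ^ (m / 2 + 1) ∣
      (∑ k ∈ Finset.range (m / 2 + 1), C (sqrtCoeff m a k) * X ^ k) ^ 2 -
        ∑ k ∈ Finset.range (m + 1), C (revCoeff m a k) * X ^ k := by
    rw [X_pow_dvd_iff]
    intro d hd
    rw [coeff_sub, hcoeff _ _ _ (by omega), sq, coeff_mul, ← sum_sqrtCoeff,
      Finset.Nat.sum_antidiagonal_eq_sum_range_succ_mk, sub_eq_zero]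
    refine Finset.sum_congr rfl fun i hi => ?_
    rw [Finset.mem_range] at hi
    rw [hcoeff _ _ _ (by omega), hcoeff _ _ _ (by omega)]
  have := map_dvd (expand ℂ 2) hdvd
  rw [map_pow, expand_X, ← pow_mul] at this
  exact (pow_dvd_pow X (by omega)).trans this

/-- The logarithmic derivative of the leading factor, times `x ^ (-m / 2)`. -/
def hPoly (m : ℕ) (a : Fin m → ℂ) : ℂ[X] :=
  -wkbPoly m a + C (expo m a - 1 / 2) * X ^ m

/-- This is where r(a) is determined. With B = `wkbPoly`, ρ = r - 1/2 and b the middle coefficient,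
modulo X^(m+1) the right side is -(2ρ + 2b + m/2) X^m B, which vanishes exactly for ρ = -m/4 - b.
The extra factor X, that is e(0) = 0, makes e a small perturbation. -/
theorem exists_ePoly {m : ℕ} (hm : 0 < m) (a : Fin m → ℂ) :
    ∃ e : ℂ[X], e.coeff 0 = 0 ∧ (Even m → IsEvenPoly e) ∧
      X ^ m * e = hPoly m a ^ 2 -
        X ^ m * (C ((m : ℂ) / 2) * wkbPoly m a - C (1 / 2) * euler (wkbPoly m a)) -
        revPoly m a - C (1 / 4) * X ^ (2 * m) := by
  have hdvd : X ^ (m + 1) ∣ hPoly m a ^ 2 -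
        X ^ m * (C ((m : ℂ) / 2) * wkbPoly m a - C (1 / 2) * euler (wkbPoly m a)) -
        revPoly m a - C (1 / 4) * X ^ (2 * m) := by
    set B := wkbPoly m a with hB
    set ρ := expo m a - 1 / 2 with hρ
    set b := midCoeff m a with hb
    have hρb : ρ = -((m : ℂ) / 4) - b := by
      rw [hρ, hb, expo, midCoeff]
      ring
    obtain ⟨B', hB'⟩ : X ∣ B - 1 := by
      rw [X_dvd_iff, coeff_sub, wkbPoly_coeff_zero hm]
      simp
    have hB1 : B = 1 + X * B' := by rw [← hB']; ring
    -- Writing m = n + 1 exhibits X^(2m) as X^(m+1) X^n; it is here that m ≥ 1 enters.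
    obtain ⟨n, rfl⟩ : ∃ n, m = n + 1 := ⟨m - 1, by omega⟩
    obtain ⟨D, hD⟩ := X_pow_dvd_sq_sub (n + 1) a
    rw [← hB, ← hb] at hD
    have hC : C ρ = -(C (((n + 1 : ℕ) : ℂ) / 4)) - C b := by
      rw [hρb]
      simp
    have hm2 : C (((n + 1 : ℕ) : ℂ) / 2) = 2 * C (((n + 1 : ℕ) : ℂ) / 4) := by
      rw [show (((n + 1 : ℕ) : ℂ) / 2) = 2 * (((n + 1 : ℕ) : ℂ) / 4) by ring, C_mul]
      rfl
    have hR : revPoly (n + 1) a = (B + C b * X ^ (n + 1)) ^ 2 - X ^ (n + 1 + 1) * D := by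
      rw [← hD]
      ring
    refine ⟨D - C b ^ 2 * X ^ n - 2 * C b * B' - 2 * C ρ * B' + C ρ ^ 2 * X ^ n
      - 2 * C (((n + 1 : ℕ) : ℂ) / 4) * B' + C (1 / 2) * derivative B - C (1 / 4) * X ^ n, ?_⟩
    rw [hR, hPoly, hm2, euler, ← hB, ← hρ]
    linear_combination (-2 * X ^ (n + 1) * (C b + C ρ + C (((n + 1 : ℕ) : ℂ) / 4))) * hB1
      - 2 * X ^ (n + 1) * hC
  obtain ⟨e, he⟩ := hdvd
  refine ⟨X * e, by simp, fun hev => ?_, ?_⟩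
  · have hB : IsEvenPoly (wkbPoly m a) := isEvenPoly_sum _
    have hR : IsEvenPoly (revPoly m a) := isEvenPoly_sum _
    have hX := isEvenPoly_X_pow hev
    have hh : IsEvenPoly (hPoly m a) := hB.neg.add ((isEvenPoly_C _).mul hX)
    have hrhs : IsEvenPoly (X ^ m * (X * e)) := by
      rw [← mul_assoc, ← pow_succ, ← he, sq]
      exact (((hh.mul hh).sub (hX.mul (((isEvenPoly_C _).mul hB).sub
        ((isEvenPoly_C _).mul hB.euler)))).sub hR).sub
          ((isEvenPoly_C _).mul (isEvenPoly_X_pow (even_two_mul m)))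
    unfold IsEvenPoly at hrhs hX ⊢
    rw [mul_comp, hX] at hrhs
    exact mul_left_cancel₀ (pow_ne_zero m X_ne_zero) hrhs
  · rw [he, pow_succ]
    ring

end StokesSibuya

end

noncomputable section

namespace StokesSibuya

open Complex Filter Topology Metric Set

/-! ### The leading factor of the solutions -/

/-- `x ^ (-1/2)` at `x = exp t`. -/
def invSqrt (t : ℂ) : ℂ := exp (-t / 2)

theorem hasDerivAt_invSqrt (t : ℂ) : HasDerivAt invSqrt (-(1 / 2) * invSqrt t) t := by
  have h : HasDerivAt (fun t : ℂ => -t / 2) (-1 / 2) t := ((hasDerivAt_id t).neg).div_const 2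
  convert! h.cexp using 1
  rw [invSqrt]
  ring

theorem norm_invSqrt (t : ℂ) : ‖invSqrt t‖ = Real.exp (-t.re / 2) := by
  rw [invSqrt, norm_exp]
  congr 1
  simp

theorem invSqrt_pow (t : ℂ) (n : ℕ) : invSqrt t ^ n = exp (-((n : ℂ) / 2) * t) := by
  rw [invSqrt, ← exp_nat_mul]
  congr 1
  ring

theorem exp_half_mul_invSqrt_pow (m : ℕ) (t : ℂ) : exp ((m : ℂ) / 2 * t) * invSqrt t ^ m = 1 := by
  rw [invSqrt_pow, ← exp_add]
  simp

theorem hasDerivAt_eval_invSqrt (p : Polynomial ℂ) (t : ℂ) :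
    HasDerivAt (fun t => p.eval (invSqrt t)) (-(1 / 2) * (euler p).eval (invSqrt t)) t := by
  have h := (p.hasDerivAt (invSqrt t)).comp t (hasDerivAt_invSqrt t)
  convert! h using 1
  simp only [euler, Polynomial.eval_mul, Polynomial.eval_X]
  ring

theorem hasDerivAt_exp_half (m : ℕ) (t : ℂ) :
    HasDerivAt (fun t => exp ((m : ℂ) / 2 * t)) ((m : ℂ) / 2 * exp ((m : ℂ) / 2 * t)) t := by
  have h : HasDerivAt (fun t : ℂ => (m : ℂ) / 2 * t) ((m : ℂ) / 2) t := by
    simpa using (hasDerivAt_id t).const_mul ((m : ℂ) / 2)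
  convert! h.cexp using 1
  ring

theorem hasDerivAt_exp_half_mul_eval (m : ℕ) (p : Polynomial ℂ) (t : ℂ) :
    HasDerivAt (fun t => exp ((m : ℂ) / 2 * t) * p.eval (invSqrt t))
      (exp ((m : ℂ) / 2 * t) *
        ((m : ℂ) / 2 * p.eval (invSqrt t) - 1 / 2 * (euler p).eval (invSqrt t))) t := by
  convert! (hasDerivAt_exp_half m t).mul (hasDerivAt_eval_invSqrt p t) using 1
  ring

theorem hasDerivAt_expPart (m : ℕ) (a : Fin m → ℂ) (t : ℂ) :
    HasDerivAt (expPart m a) (exp ((m : ℂ) / 2 * t) * (wkbPoly m a).eval (invSqrt t)) t := by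
  have h : ∀ k ∈ (Finset.range m).filter (fun k => 2 * k < m), HasDerivAt
      (fun t => sqrtCoeff m a k / ((m : ℂ) / 2 - k) * exp (((m : ℂ) / 2 - k) * t))
      (sqrtCoeff m a k * exp (((m : ℂ) / 2 - k) * t)) t := by
    intro k hk
    have hne : (m : ℂ) / 2 - k ≠ 0 := by
      intro h0
      have h1 : (m : ℂ) = (2 * k : ℕ) := by
        push_cast
        linear_combination 2 * h0
      have h2 := Nat.cast_injective h1
      have := (Finset.mem_filter.1 hk).2
      omega
    have h1 : HasDerivAt (fun t : ℂ => ((m : ℂ) / 2 - k) * t) ((m : ℂ) / 2 - k) t := by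
      simpa using (hasDerivAt_id t).const_mul ((m : ℂ) / 2 - k)
    convert! h1.cexp.const_mul (sqrtCoeff m a k / ((m : ℂ) / 2 - k)) using 1
    rw [mul_comm (exp _), ← mul_assoc, div_mul_cancel₀ _ hne]
  have hs := HasDerivAt.fun_sum h
  convert! hs using 1
  simp only [wkbPoly, Polynomial.eval_finsetSum, Polynomial.eval_mul, Polynomial.eval_C,
    Polynomial.eval_pow, Polynomial.eval_X, Finset.mul_sum]
  refine Finset.sum_congr rfl fun k _ => ?_
  rw [invSqrt_pow, sub_mul, exp_sub, show -(((2 * k : ℕ) : ℂ) / 2) * t = -(k * t) by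
    push_cast; ring, exp_neg]
  ring

/-- The logarithm of the leading factor (without `x ^ (1/2)`). -/
def wkbLog (m : ℕ) (a : Fin m → ℂ) (t : ℂ) : ℂ := -expPart m a t + (expo m a - 1 / 2) * t

theorem hasDerivAt_wkbLog (m : ℕ) (a : Fin m → ℂ) (t : ℂ) :
    HasDerivAt (wkbLog m a) (exp ((m : ℂ) / 2 * t) * (hPoly m a).eval (invSqrt t)) t := by
  have h := (hasDerivAt_expPart m a t).neg.add ((hasDerivAt_id t).const_mul (expo m a - 1 / 2))
  convert! h using 1
  simp only [hPoly, Polynomial.eval_add, Polynomial.eval_neg, Polynomial.eval_mul,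
    Polynomial.eval_C, Polynomial.eval_pow, Polynomial.eval_X]
  linear_combination (expo m a - 1 / 2) * exp_half_mul_invSqrt_pow m t

/-- The coefficient of the normal form `u'' = Q u`, with `Φ = exp (t / 2) u`. -/
def normalCoeff (m : ℕ) (a : Fin m → ℂ) (t : ℂ) : ℂ := poly m a (exp t) + 1 / 4

theorem differentiable_normalCoeff (m : ℕ) (a : Fin m → ℂ) :
    Differentiable ℂ (normalCoeff m a) := by
  unfold normalCoeff poly
  fun_prop

theorem poly_exp_eq (m : ℕ) (a : Fin m → ℂ) (t : ℂ) :
    poly m a (exp t) = exp ((m : ℂ) / 2 * t) ^ 2 * (revPoly m a).eval (invSqrt t) := by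
  have hterm : ∀ k ≤ m, exp ((m : ℂ) / 2 * t) ^ 2 * invSqrt t ^ (2 * k) = exp t ^ (m - k) := by
    intro k hk
    rw [invSqrt_pow, ← exp_nat_mul, ← exp_add, ← exp_nat_mul]
    congr 1
    push_cast [hk]
    ring
  simp only [revPoly, Polynomial.eval_finsetSum, Polynomial.eval_mul, Polynomial.eval_C,
    Polynomial.eval_pow, Polynomial.eval_X, Finset.mul_sum]
  rw [Finset.sum_range_succ', poly, ← Fin.sum_univ_eq_sum_range
    (fun k => exp ((m : ℂ) / 2 * t) ^ 2 * (revCoeff m a (k + 1) * invSqrt t ^ (2 * (k + 1)))) m,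
    add_comm]
  congr 1
  · refine Finset.sum_congr rfl fun j _ => ?_
    rw [← hterm (j + 1) j.isLt, revCoeff, dif_pos j.isLt]
    ring
  · have h0 := hterm 0 (Nat.zero_le m)
    rw [Nat.sub_zero] at h0
    rw [← h0, revCoeff]
    ring

theorem euler_hPoly (m : ℕ) (a : Fin m → ℂ) :
    euler (hPoly m a) = -euler (wkbPoly m a) +
      Polynomial.C (m * (expo m a - 1 / 2)) * Polynomial.X ^ m := by
  rw [hPoly, euler_add, euler_C_mul_X_pow]
  congr 1
  simp [euler]

/-- The Riccati defect of the leading factor. -/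
theorem riccati_defect {m : ℕ} {a : Fin m → ℂ} {e : Polynomial ℂ}
    (he : Polynomial.X ^ m * e = hPoly m a ^ 2 - Polynomial.X ^ m *
      (Polynomial.C ((m : ℂ) / 2) * wkbPoly m a - Polynomial.C (1 / 2) * euler (wkbPoly m a)) -
        revPoly m a - Polynomial.C (1 / 4) * Polynomial.X ^ (2 * m)) (t : ℂ) :
    exp ((m : ℂ) / 2 * t) * ((m : ℂ) / 2 * (hPoly m a).eval (invSqrt t) -
        1 / 2 * (euler (hPoly m a)).eval (invSqrt t)) +
      (exp ((m : ℂ) / 2 * t) * (hPoly m a).eval (invSqrt t)) ^ 2 =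
    normalCoeff m a t + exp ((m : ℂ) / 2 * t) * e.eval (invSqrt t) := by
  have h1 := congrArg (Polynomial.eval (invSqrt t)) he
  simp only [Polynomial.eval_sub, Polynomial.eval_mul, Polynomial.eval_C, Polynomial.eval_pow,
    Polynomial.eval_X] at h1
  rw [normalCoeff, poly_exp_eq, euler_hPoly]
  have hB : (wkbPoly m a).eval (invSqrt t) =
      (expo m a - 1 / 2) * invSqrt t ^ m - (hPoly m a).eval (invSqrt t) := by
    simp [hPoly]
  rw [hB] at h1
  simp only [Polynomial.eval_add, Polynomial.eval_neg, Polynomial.eval_mul,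
    Polynomial.eval_C, Polynomial.eval_pow, Polynomial.eval_X]
  have hE := exp_half_mul_invSqrt_pow m t
  set E := exp ((m : ℂ) / 2 * t)
  set q := invSqrt t
  set h := (hPoly m a).eval q
  set ev := e.eval q
  set r := (revPoly m a).eval q
  set B := (euler (wkbPoly m a)).eval q
  set ρ := expo m a - 1 / 2
  rw [pow_mul'] at h1
  linear_combination (-E ^ 2) * h1 + (E * ev + 1 / 4 * (E * q ^ m + 1) +
    E * ((m : ℂ) / 2 * (ρ * q ^ m - h) - 1 / 2 * B)) * hE

theorem differentiable_wkbLog (m : ℕ) (a : Fin m → ℂ) : Differentiable ℂ (wkbLog m a) :=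
  fun t => (hasDerivAt_wkbLog m a t).differentiableAt

/-- Passing from the equation for the quotient by the leading factor to the equation for `u`. -/
theorem normalForm_of_quotient {m : ℕ} {a : Fin m → ℂ} {e : Polynomial ℂ}
    (he : Polynomial.X ^ m * e = hPoly m a ^ 2 - Polynomial.X ^ m *
      (Polynomial.C ((m : ℂ) / 2) * wkbPoly m a - Polynomial.C (1 / 2) * euler (wkbPoly m a)) -
        revPoly m a - Polynomial.C (1 / 4) * Polynomial.X ^ (2 * m))
    {T : Set ℂ} (hT : IsOpen T) {v v₁ v₂ : ℂ → ℂ} (hv : ∀ t ∈ T, HasDerivAt v (v₁ t) t)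
    (hv₁ : ∀ t ∈ T, HasDerivAt v₁ (v₂ t) t)
    (hv₂ : ∀ t ∈ T, v₂ t + 2 * (exp ((m : ℂ) / 2 * t) * (hPoly m a).eval (invSqrt t)) * v₁ t +
      exp ((m : ℂ) / 2 * t) * e.eval (invSqrt t) * v t = 0) {t : ℂ} (ht : t ∈ T) :
    deriv (deriv fun t => exp (wkbLog m a t) * v t) t =
      normalCoeff m a t * (exp (wkbLog m a t) * v t) := by
  have h1 : ∀ t ∈ T, HasDerivAt (fun t => exp (wkbLog m a t) * v t)
      (exp (wkbLog m a t) * (exp ((m : ℂ) / 2 * t) * (hPoly m a).eval (invSqrt t) * v t + v₁ t))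
      t := by
    intro t ht
    convert! (hasDerivAt_wkbLog m a t).cexp.mul (hv t ht) using 1
    ring
  have h2 : deriv (fun t => exp (wkbLog m a t) * v t) =ᶠ[𝓝 t] fun t => exp (wkbLog m a t) *
      (exp ((m : ℂ) / 2 * t) * (hPoly m a).eval (invSqrt t) * v t + v₁ t) := by
    filter_upwards [hT.mem_nhds ht] with x hx using (h1 x hx).deriv
  rw [h2.deriv_eq]
  have h3 := (hasDerivAt_wkbLog m a t).cexp.mul
    (((hasDerivAt_exp_half_mul_eval m (hPoly m a) t).mul (hv t ht)).add (hv₁ t ht))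
  refine (HasDerivAt.deriv h3).trans ?_
  simp only [Pi.mul_apply, Pi.add_apply]
  linear_combination exp (wkbLog m a t) * (v t * riccati_defect he t + hv₂ t ht)

end StokesSibuya

end

noncomputable section

namespace StokesSibuya

open Complex Filter Topology Metric Set

/-! ### Actual solutions with a prescribed expansion -/

theorem exists_norm_eval_le_of_X_pow_dvd {p : Polynomial ℂ} {N : ℕ} (h : Polynomial.X ^ N ∣ p) :
    ∃ C : ℝ, 0 ≤ C ∧ ∀ q : ℂ, ‖q‖ ≤ 1 → ‖p.eval q‖ ≤ C * ‖q‖ ^ N := by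
  obtain ⟨r, rfl⟩ := h
  obtain ⟨C, hC⟩ := (isCompact_closedBall (0 : ℂ) 1).exists_bound_of_continuousOn
    r.continuous.continuousOn
  refine ⟨C, (norm_nonneg _).trans (hC 0 (by simp)), fun q hq => ?_⟩
  rw [Polynomial.eval_mul, Polynomial.eval_pow, Polynomial.eval_X, norm_mul, norm_pow, mul_comm]
  gcongr
  exact hC q (by simpa using hq)

theorem half_natCast_ne_zero {m : ℕ} (hm : 0 < m) : (m : ℂ) / 2 ≠ 0 :=
  div_ne_zero (Nat.cast_ne_zero.2 hm.ne') two_ne_zero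

/-- The constant relating `t` and `log ζ`, where `ζ` is the rotated variable
`exp (-i α) (2 / m) x ^ (m / 2)`. -/
def logShift (m : ℕ) (α : ℝ) : ℂ := Real.log ((m : ℝ) / 2) + α * I

/-- The coordinate `t` as a function of `ζ`. -/
def coordOf (m : ℕ) (α : ℝ) (z : ℂ) : ℂ := (log z + logShift m α) / ((m : ℂ) / 2)

/-- The variable `ζ` as a function of `t`. -/
def zetaOf (m : ℕ) (α : ℝ) (t : ℂ) : ℂ := exp ((m : ℂ) / 2 * t - logShift m α)

theorem exp_logShift {m : ℕ} (hm : 0 < m) (α : ℝ) :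
    exp (logShift m α) = (m : ℂ) / 2 * exp (α * I) := by
  have hm' : (0 : ℝ) < m / 2 := by positivity
  rw [logShift, exp_add, ← ofReal_exp, Real.exp_log hm']
  push_cast
  rfl

theorem exp_half_coordOf {m : ℕ} (hm : 0 < m) (α : ℝ) {z : ℂ} (hz : z ≠ 0) :
    exp ((m : ℂ) / 2 * coordOf m α z) = (m : ℂ) / 2 * exp (α * I) * z := by
  have hm' : (m : ℂ) / 2 ≠ 0 := half_natCast_ne_zero hm
  rw [coordOf, mul_div_cancel₀ _ hm', exp_add, exp_log hz, exp_logShift hm]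
  ring

theorem hasDerivAt_coordOf (m : ℕ) (α : ℝ) {z : ℂ} (hz : z ∈ slitPlane) :
    HasDerivAt (coordOf m α) (1 / ((m : ℂ) / 2 * z)) z := by
  have h := ((hasDerivAt_log hz).add_const (logShift m α)).div_const ((m : ℂ) / 2)
  convert! h using 1
  rw [one_div, mul_inv_rev, div_eq_mul_inv z⁻¹]

theorem norm_invSqrt_coordOf {m : ℕ} (hm : 0 < m) (α : ℝ) {z : ℂ} (hz : z ≠ 0) :
    ‖invSqrt (coordOf m α z)‖ = ((m : ℝ) / 2 * ‖z‖) ^ (-(1 / (m : ℝ))) := by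
  have hm' : (0 : ℝ) < m := by positivity
  have hz' : 0 < ‖z‖ := norm_pos_iff.2 hz
  rw [norm_invSqrt, Real.rpow_def_of_pos (by positivity), Real.log_mul (by positivity) hz'.ne']
  congr 1
  have : coordOf m α z = (log z + logShift m α) / ((m / 2 : ℝ) : ℂ) := by
    rw [coordOf]
    push_cast
    rfl
  rw [this, div_ofReal_re, add_re, log_re, logShift]
  simp only [add_re, ofReal_re, mul_re, I_re, ofReal_im, I_im, mul_zero, mul_one, sub_zero,
    add_zero]
  field_simp
  ring

theorem hasDerivAt_zetaOf (m : ℕ) (α : ℝ) (t : ℂ) :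
    HasDerivAt (zetaOf m α) ((m : ℂ) / 2 * zetaOf m α t) t := by
  have h : HasDerivAt (fun t : ℂ => (m : ℂ) / 2 * t - logShift m α) ((m : ℂ) / 2) t := by
    simpa using ((hasDerivAt_id t).const_mul ((m : ℂ) / 2)).sub_const (logShift m α)
  convert! h.cexp using 1
  rw [zetaOf]
  ring

theorem mem_slitPlane_of_mem_coneCompl {c L : ℝ} (hc : 0 < c) (hL : 0 < L) {z : ℂ}
    (hz : z ∈ coneCompl c L) : z ∈ slitPlane := by
  rw [mem_slitPlane_iff]
  by_contra! h
  have hz' : L < c * z.re + |z.im| := hz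
  rw [h.2, abs_zero, add_zero] at hz'
  nlinarith [mul_nonneg hc.le (sub_nonneg.2 h.1)]

theorem rho_le_two_mul_norm {c : ℝ} (hc : 0 < c) (hc1 : c ≤ 1) (z : ℂ) : rho c z ≤ 2 * ‖z‖ := by
  have h1 : c * z.re ≤ 1 * ‖z‖ := by
    refine (mul_le_mul_of_nonneg_left (re_le_norm z) hc.le).trans ?_
    gcongr
  have h2 := abs_im_le_norm z
  rw [rho]
  linarith

/-- The region of the `t`-plane on which the solution is constructed. -/
def coordRegion (m : ℕ) (α c L : ℝ) : Set ℂ :=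
  {t | |((m : ℂ) / 2 * t - logShift m α).im| < Real.pi ∧ zetaOf m α t ∈ coneCompl c L}

theorem coordOf_zetaOf {m : ℕ} (hm : 0 < m) {α c L : ℝ} {t : ℂ} (ht : t ∈ coordRegion m α c L) :
    coordOf m α (zetaOf m α t) = t := by
  have hm' : (m : ℂ) / 2 ≠ 0 := half_natCast_ne_zero hm
  have h := abs_lt.1 ht.1
  rw [coordOf, zetaOf, log_exp h.1 h.2.le, sub_add_cancel, mul_div_cancel_left₀ _ hm']

theorem isOpen_coordRegion (m : ℕ) (α c L : ℝ) : IsOpen (coordRegion m α c L) := by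
  have h1 : Continuous fun t : ℂ => |((m : ℂ) / 2 * t - logShift m α).im| :=
    (continuous_im.comp (by fun_prop)).abs
  refine IsOpen.inter (isOpen_lt h1 continuous_const) ?_
  refine (isOpen_coneCompl c L).preimage ?_
  unfold zetaOf
  fun_prop

/-- The region is the continuous image of the cone complement under the branch ζ ↦ t of the
logarithm, well defined because the cone complement avoids the negative axis. -/
theorem isPreconnected_coordRegion {m : ℕ} (hm : 0 < m) (α : ℝ) {c L : ℝ} (hc : 0 < c)
    (hL : 0 < L) : IsPreconnected (coordRegion m α c L) := by
  have hm' : (m : ℂ) / 2 ≠ 0 := half_natCast_ne_zero hm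
  have himg : coordRegion m α c L = coordOf m α '' coneCompl c L := by
    ext t
    refine ⟨fun ht => ⟨zetaOf m α t, ht.2, coordOf_zetaOf hm ht⟩, ?_⟩
    rintro ⟨z, hz, rfl⟩
    have hs := mem_slitPlane_of_mem_coneCompl hc hL hz
    have h1 : (m : ℂ) / 2 * coordOf m α z - logShift m α = log z := by
      rw [coordOf, mul_div_cancel₀ _ hm', add_sub_cancel_right]
    refine ⟨?_, ?_⟩
    · rw [h1, log_im]
      exact abs_lt.2 ⟨neg_pi_lt_arg z, lt_of_le_of_ne (arg_le_pi z) (slitPlane_arg_ne_pi hs)⟩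
    · rw [zetaOf, h1, exp_log (slitPlane_ne_zero hs)]
      exact hz
  rw [himg]
  exact (isPreconnected_coneCompl L hc).image _ fun z hz =>
    (hasDerivAt_coordOf m α (mem_slitPlane_of_mem_coneCompl hc hL hz)).continuousAt.continuousWithinAt

/-- A solution with `N` correct terms of the formal expansion, in the rotated variable. -/
theorem exists_remainder {m : ℕ} (hm : 0 < m) (a : Fin m → ℂ) {e : Polynomial ℂ}
    (e0 : e.coeff 0 = 0) (k : ℕ) {α c : ℝ} (hα : 0 < Real.cos α) (hc : 0 < c) (hc1 : c ≤ 1) :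
    ∃ (L : ℝ) (w : ℂ → ℂ) (K : ℝ), 0 < L ∧ DifferentiableOn ℂ w (coneCompl c L) ∧
      (∀ z ∈ coneCompl c L, deriv (deriv w) z =
        -((2 * exp (α * I) * (hPoly m a).eval (invSqrt (coordOf m α z)) + 1 / z) * deriv w z) -
        (exp (α * I) * e.eval (invSqrt (coordOf m α z)) / ((m : ℂ) / 2 * z) * w z +
          exp (α * I) * (formalOp m (hPoly m a) e (formalSum m (hPoly m a) e k)).eval
            (invSqrt (coordOf m α z)) / ((m : ℂ) / 2 * z))) ∧
      ∀ z ∈ coneCompl c L, ‖w z‖ ≤ K * rho c z ^ (-((k + 1 : ℕ) / (m : ℝ))) := by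
  have hmR : (0 : ℝ) < m := Nat.cast_pos.2 hm
  -- |X| is of order |ζ|^(-1/m), so X^(k+1) decays like |ζ|^(-β); the 1/ζ from the change of
  -- variable supplies the further power required of F.
  set β : ℝ := (k + 1 : ℕ) / (m : ℝ) with hβ
  have hβ0 : 0 < β := by positivity
  have h0 : (hPoly m a).coeff 0 = -1 := by
    rw [hPoly, Polynomial.coeff_add, Polynomial.coeff_neg, wkbPoly_coeff_zero hm,
      Polynomial.coeff_C_mul_X_pow, if_neg hm.ne, add_zero]
  obtain ⟨C₁, hC₁, hb₁⟩ := exists_norm_eval_le_of_X_pow_dvd (p := hPoly m a + 1) (N := 1) (by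
    rw [pow_one, Polynomial.X_dvd_iff, Polynomial.coeff_add, h0]
    simp)
  obtain ⟨C₂, hC₂, hb₂⟩ := exists_norm_eval_le_of_X_pow_dvd (p := e) (N := 1) (by
    rw [pow_one, Polynomial.X_dvd_iff, e0])
  obtain ⟨C₃, hC₃, hb₃⟩ := exists_norm_eval_le_of_X_pow_dvd
    (X_pow_dvd_formalOp_formalSum hm h0 e0 k)
  set lam := Real.cos α with hlam
  -- Far out |X| ≤ 1, the derivative of G is within `lam` of -2 e^(iα), and E meets the contraction
  -- bound. The last is possible because e vanishes at X = 0.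
  obtain ⟨X₀, hX₀⟩ : ∃ X₀ : ℝ, ∀ x, X₀ ≤ x → ((m : ℝ) / 2 * x) ^ (-(1 / (m : ℝ))) ≤ 1 ∧
      2 * C₁ * ((m : ℝ) / 2 * x) ^ (-(1 / (m : ℝ))) ≤ lam / 2 ∧
      4 * C₂ / m * ((m : ℝ) / 2 * x) ^ (-(1 / (m : ℝ))) ≤ lam * (c * β) / 2 ∧
      x⁻¹ ≤ lam / 2 := by
    have hq : Tendsto (fun x : ℝ => ((m : ℝ) / 2 * x) ^ (-(1 / (m : ℝ)))) atTop (𝓝 0) :=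
      (tendsto_rpow_neg_atTop (by positivity)).comp (tendsto_id.const_mul_atTop (by positivity))
    have hq1 := hq.const_mul (2 * C₁)
    have hq2 := hq.const_mul (4 * C₂ / m)
    rw [mul_zero] at hq1 hq2
    refine Filter.eventually_atTop.1 ?_
    filter_upwards [hq.eventually_le_const one_pos,
      hq1.eventually_le_const (show 0 < lam / 2 by positivity),
      hq2.eventually_le_const (show 0 < lam * (c * β) / 2 by positivity),
      tendsto_inv_atTop_zero.eventually_le_const (show 0 < lam / 2 by positivity)]
      with x h1 h2 h3 h4 using ⟨h1, h2, h3, h4⟩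
  -- The factor 2 matches `rho` ≤ 2 |z|, so |z| exceeds X₀ on the whole region.
  set L := 2 * max X₀ 1 with hL
  have hL0 : 0 < L := by
    have : (1 : ℝ) ≤ max X₀ 1 := le_max_right _ _
    linarith
  have hz0 : ∀ z ∈ coneCompl c L, X₀ ≤ ‖z‖ := by
    intro z hz
    have h1 : L < rho c z := hz
    have h2 := rho_le_two_mul_norm hc hc1 z
    have h3 : X₀ ≤ max X₀ 1 := le_max_left _ _
    linarith
  have hslit : ∀ z ∈ coneCompl c L, z ∈ slitPlane := fun z hz =>
    mem_slitPlane_of_mem_coneCompl hc hL0 hz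
  have hne : ∀ z ∈ coneCompl c L, z ≠ 0 := fun z hz => slitPlane_ne_zero (hslit z hz)
  have hmC : (m : ℂ) / 2 ≠ 0 := half_natCast_ne_zero hm
  have hnorm1 : ‖exp (α * I)‖ = 1 := norm_exp_ofReal_mul_I α
  have hnormm : ‖(m : ℂ) / 2‖ = (m : ℝ) / 2 := by simp
  -- Twice the logarithm of the leading factor produces the first-order term 2 e^(iα) h. The summand
  -- log z accounts for the 1/z that arises in writing d²/dt² in terms of ζ.
  set G : ℂ → ℂ := fun z => 2 * wkbLog m a (coordOf m α z) + log z with hG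
  have hGd : ∀ z ∈ coneCompl c L, HasDerivAt G
      (2 * exp (α * I) * (hPoly m a).eval (invSqrt (coordOf m α z)) + 1 / z) z := by
    intro z hz
    have h1 := (((hasDerivAt_wkbLog m a (coordOf m α z)).comp z
      (hasDerivAt_coordOf m α (hslit z hz))).const_mul 2).add (hasDerivAt_log (hslit z hz))
    convert! h1 using 1
    rw [exp_half_coordOf hm α (hne z hz), one_div]
    have hz' := hne z hz
    have hm' : (m : ℂ) ≠ 0 := Nat.cast_ne_zero.2 hm.ne'
    field_simp
  have hcoordd : DifferentiableOn ℂ (coordOf m α) (coneCompl c L) := fun z hz =>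
    (hasDerivAt_coordOf m α (hslit z hz)).differentiableAt.differentiableWithinAt
  have hinvd : Differentiable ℂ invSqrt := fun t => (hasDerivAt_invSqrt t).differentiableAt
  have hqd : ∀ p : Polynomial ℂ, DifferentiableOn ℂ
      (fun z => exp (α * I) * p.eval (invSqrt (coordOf m α z)) / ((m : ℂ) / 2 * z))
      (coneCompl c L) := by
    intro p
    refine DifferentiableOn.div ?_ (by fun_prop) fun z hz => mul_ne_zero hmC (hne z hz)
    exact (p.differentiable.comp_differentiableOn
      (hinvd.comp_differentiableOn hcoordd)).const_mul _
  have hqn : ∀ z ∈ coneCompl c L, ‖invSqrt (coordOf m α z)‖ ≤ 1 := fun z hz => by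
    rw [norm_invSqrt_coordOf hm α (hne z hz)]
    exact (hX₀ _ (hz0 z hz)).1
  have hpn : ∀ (p : Polynomial ℂ) (C : ℝ) (n : ℕ), 0 ≤ C →
      (∀ q : ℂ, ‖q‖ ≤ 1 → ‖p.eval q‖ ≤ C * ‖q‖ ^ n) → ∀ z ∈ coneCompl c L,
      ‖exp (α * I) * p.eval (invSqrt (coordOf m α z)) / ((m : ℂ) / 2 * z)‖ ≤
        4 * C / m * ‖invSqrt (coordOf m α z)‖ ^ n * (rho c z)⁻¹ := by
    intro p C n hC hp z hz
    have hρ : 0 < rho c z := hL0.trans hz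
    have hzn : 0 < ‖z‖ := norm_pos_iff.2 (hne z hz)
    rw [norm_div, norm_mul, norm_mul, hnorm1, one_mul, hnormm]
    have h1 : (m : ℝ) / 4 * rho c z ≤ (m : ℝ) / 2 * ‖z‖ := by
      have := mul_le_mul_of_nonneg_left (rho_le_two_mul_norm hc hc1 z) hmR.le
      linarith
    calc ‖p.eval (invSqrt (coordOf m α z))‖ / ((m : ℝ) / 2 * ‖z‖)
        ≤ C * ‖invSqrt (coordOf m α z)‖ ^ n / ((m : ℝ) / 4 * rho c z) := by
          gcongr
          exact hp _ (hqn z hz)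
      _ = _ := by field_simp
  obtain ⟨w, K, hw, hw2, hwb⟩ := exists_sol_volterra (c := c) (L := L) (lam := lam) (β := β)
    (G := G) hc hL0 hα hβ0
    (fun z hz => (hGd z hz).differentiableAt.differentiableWithinAt)
    (fun z hz => by
      rw [(hGd z hz).deriv]
      have h1 := hb₁ _ (hqn z hz)
      obtain ⟨-, h2, -, h4⟩ := hX₀ _ (hz0 z hz)
      rw [norm_invSqrt_coordOf hm α (hne z hz), pow_one, Polynomial.eval_add,
        Polynomial.eval_one] at h1
      set hv := (hPoly m a).eval (invSqrt (coordOf m α z))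
      have h5 : 2 * exp (α * I) * hv + 1 / z =
          -(2 * exp (α * I)) + (2 * exp (α * I) * (hv + 1) + z⁻¹) := by
        rw [one_div]
        ring
      have h6 : (2 * exp (α * I)).re = 2 * lam := by
        rw [hlam, show (2 : ℂ) = ((2 : ℝ) : ℂ) by norm_num, re_ofReal_mul, exp_ofReal_mul_I_re]
      have h7 : ‖2 * exp (α * I) * (hv + 1) + z⁻¹‖ ≤ lam := by
        refine (norm_add_le _ _).trans ?_
        rw [norm_mul, norm_mul, hnorm1, norm_inv, Complex.norm_ofNat, mul_one]
        linarith
      have h8 := (re_le_norm _).trans h7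
      rw [h5, add_re, neg_re, h6]
      linarith)
    (hqd e) (hqd (formalOp m (hPoly m a) e (formalSum m (hPoly m a) e k)))
    (A := lam * (c * β) / 2) (M := 4 * C₃ / m * ((m : ℝ) / 4) ^ (-β))
    (by positivity) (by positivity)
    (by
      have : lam * (c * β) ≠ 0 := by positivity
      field_simp
      exact le_refl _)
    (fun z hz => by
      have hρ : 0 < rho c z := hL0.trans hz
      refine (hpn e C₂ 1 hC₂ hb₂ z hz).trans ?_
      rw [pow_one, norm_invSqrt_coordOf hm α (hne z hz)]
      gcongr
      exact (hX₀ _ (hz0 z hz)).2.2.1)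
    (fun z hz => by
      have hρ : 0 < rho c z := hL0.trans hz
      refine (hpn _ C₃ (k + 1) hC₃ hb₃ z hz).trans ?_
      have hzn : 0 < ‖z‖ := norm_pos_iff.2 (hne z hz)
      have h1 : (m : ℝ) / 4 * rho c z ≤ (m : ℝ) / 2 * ‖z‖ := by
        have := mul_le_mul_of_nonneg_left (rho_le_two_mul_norm hc hc1 z) hmR.le
        linarith
      have h2 : ‖invSqrt (coordOf m α z)‖ ^ (k + 1) ≤ ((m : ℝ) / 4) ^ (-β) * rho c z ^ (-β) := by
        rw [norm_invSqrt_coordOf hm α (hne z hz), ← Real.rpow_natCast, ← Real.rpow_mul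
          (by positivity), ← Real.mul_rpow (by positivity) hρ.le,
          show -(1 / (m : ℝ)) * ((k + 1 : ℕ) : ℝ) = -β by rw [hβ]; ring]
        exact Real.rpow_le_rpow_of_nonpos (by positivity) h1 (neg_nonpos.2 hβ0.le)
      rw [neg_add, Real.rpow_add hρ, Real.rpow_neg_one]
      calc 4 * C₃ / m * ‖invSqrt (coordOf m α z)‖ ^ (k + 1) * (rho c z)⁻¹
          ≤ 4 * C₃ / m * (((m : ℝ) / 4) ^ (-β) * rho c z ^ (-β)) * (rho c z)⁻¹ := by gcongr
        _ = _ := by ring)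
  refine ⟨L, w, K, hL0, hw, fun z hz => ?_, hwb⟩
  rw [hw2 z hz, (hGd z hz).deriv]

end StokesSibuya

end

noncomputable section

namespace StokesSibuya

open Complex Filter Topology Metric Set

/-! ### From the cone complement to half-strips in the t-plane -/

/-- Makes `rho` with c = sin ε / 2 at least c |ζ| off the ε-cone. Where the cosine is negative, |sin
θ| ≥ sin ε = 2c outweighs the loss of at most c; this explains the half. -/
theorem le_mul_cos_add_abs_sin {ε θ : ℝ} (hε : 0 < ε) (hε' : ε < Real.pi / 2)
    (hθ : |θ| ≤ Real.pi - ε) :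
    Real.sin ε / 2 ≤ Real.sin ε / 2 * Real.cos θ + |Real.sin θ| := by
  have hs : 0 < Real.sin ε := Real.sin_pos_of_pos_of_lt_pi hε (by linarith [Real.pi_pos])
  have hs1 := Real.sin_le_one ε
  have hcos : Real.cos θ = Real.cos |θ| := (Real.cos_abs θ).symm
  have hsin : |Real.sin θ| = Real.sin |θ| := by
    rcases abs_cases θ with ⟨h, h'⟩ | ⟨h, h'⟩
    · rw [h, abs_of_nonneg (Real.sin_nonneg_of_nonneg_of_le_pi h' (by linarith))]
    · rw [h, Real.sin_neg, abs_of_nonpos (Real.sin_nonpos_of_nonpos_of_neg_pi_le h'.le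
        (by linarith))]
  rw [hcos, hsin]
  set φ := |θ| with hφ
  have hφ0 : 0 ≤ φ := abs_nonneg θ
  rcases le_total φ (Real.pi / 2) with h | h
  · have h1 : 0 ≤ Real.cos φ := Real.cos_nonneg_of_mem_Icc ⟨by linarith, h⟩
    have h2 : 0 ≤ Real.sin φ := Real.sin_nonneg_of_nonneg_of_le_pi hφ0 (by linarith)
    have h3 : 1 ≤ Real.cos φ + Real.sin φ := by
      nlinarith [Real.sin_sq_add_cos_sq φ, mul_nonneg h1 h2]
    nlinarith
  · have h1 : Real.sin ε ≤ Real.sin φ := by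
      rw [← Real.sin_pi_sub φ]
      exact Real.sin_le_sin_of_le_of_le_pi_div_two (by linarith) (by linarith) (by linarith)
    have h2 := Real.neg_one_le_cos φ
    nlinarith

theorem rho_exp (c x y : ℝ) : rho c (exp (x + y * I)) =
    Real.exp x * (c * Real.cos y + |Real.sin y|) := by
  rw [rho, exp_re, exp_im]
  simp only [add_re, ofReal_re, mul_re, I_re, mul_zero, ofReal_im, I_im, mul_one, sub_zero,
    add_zero, add_im, mul_im, zero_add, abs_mul, abs_of_pos (Real.exp_pos x)]
  ring

/-- A solution whose quotient by the leading factor is approximated by a partial sum of the formal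
solution on a closed half-strip `0 ≤ s * Im t ≤ δ` with `δ < 3 π / m`. -/
theorem exists_entireSol_side {m : ℕ} (hm : 0 < m) (a : Fin m → ℂ) {e : Polynomial ℂ}
    (e0 : e.coeff 0 = 0)
    (he : Polynomial.X ^ m * e = hPoly m a ^ 2 - Polynomial.X ^ m *
      (Polynomial.C ((m : ℂ) / 2) * wkbPoly m a - Polynomial.C (1 / 2) * euler (wkbPoly m a)) -
        revPoly m a - Polynomial.C (1 / 4) * Polynomial.X ^ (2 * m))
    (k : ℕ) {s ε : ℝ} (hs : s = 1 ∨ s = -1) (hε : 0 < ε) (hε' : ε < Real.pi / 2) :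
    ∃ U : ℂ → ℂ, EntireSol (normalCoeff m a) U ∧ ∃ K R : ℝ, ∀ t : ℂ, R ≤ t.re → 0 ≤ s * t.im →
      (m : ℝ) * (s * t.im) ≤ 3 * Real.pi - 4 * ε →
      ‖U t * exp (-wkbLog m a t) - (formalSum m (hPoly m a) e k).eval (invSqrt t)‖ ≤
        K * Real.exp (-((k + 1 : ℕ) / 2) * t.re) := by
  have hmR : (0 : ℝ) < m := Nat.cast_pos.2 hm
  have hsε : 0 < Real.sin ε := Real.sin_pos_of_pos_of_lt_pi hε (by linarith [Real.pi_pos])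
  set α : ℝ := s * (Real.pi / 2 - ε) with hα
  have hcosα : Real.cos α = Real.sin ε := by
    rcases hs with rfl | rfl
    · rw [hα, one_mul, Real.cos_pi_div_two_sub]
    · rw [hα, neg_one_mul, Real.cos_neg, Real.cos_pi_div_two_sub]
  set c : ℝ := Real.sin ε / 2 with hc
  have hc0 : 0 < c := by positivity
  have hc1 : c ≤ 1 := by linarith [Real.sin_le_one ε]
  obtain ⟨L, w, K, hL, hw, hw2, hwb⟩ := exists_remainder hm a e0 k (hcosα ▸ hsε : 0 < Real.cos α)
    hc0 hc1
  set P := formalSum m (hPoly m a) e k with hP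
  set T := coordRegion m α c L with hT
  have hD := isOpen_coneCompl c L
  have hTo : IsOpen T := isOpen_coordRegion m α c L
  set z : ℂ → ℂ := zetaOf m α with hz
  have hzT : ∀ t ∈ T, z t ∈ coneCompl c L := fun t ht => ht.2
  have hwd : ∀ x ∈ coneCompl c L, HasDerivAt w (deriv w x) x := fun x hx =>
    (hw.differentiableAt (hD.mem_nhds hx)).hasDerivAt
  have hwd2 : ∀ x ∈ coneCompl c L, HasDerivAt (deriv w) (deriv (deriv w) x) x := fun x hx =>
    ((hw.deriv hD).differentiableAt (hD.mem_nhds hx)).hasDerivAt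
  set v : ℂ → ℂ := fun t => P.eval (invSqrt t) + w (z t) with hv
  set v₁ : ℂ → ℂ := fun t => -(1 / 2) * (euler P).eval (invSqrt t) +
    deriv w (z t) * ((m : ℂ) / 2 * z t) with hv₁
  set v₂ : ℂ → ℂ := fun t => -(1 / 2) * (-(1 / 2) * (euler (euler P)).eval (invSqrt t)) +
    (deriv (deriv w) (z t) * ((m : ℂ) / 2 * z t) * ((m : ℂ) / 2 * z t) +
      deriv w (z t) * ((m : ℂ) / 2 * ((m : ℂ) / 2 * z t))) with hv₂
  have hd1 : ∀ t ∈ T, HasDerivAt v (v₁ t) t := fun t ht =>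
    (hasDerivAt_eval_invSqrt P t).add ((hwd _ (hzT t ht)).comp t (hasDerivAt_zetaOf m α t))
  have hd2 : ∀ t ∈ T, HasDerivAt v₁ (v₂ t) t := fun t ht =>
    ((hasDerivAt_eval_invSqrt (euler P) t).const_mul (-(1 / 2) : ℂ)).add
      (((hwd2 _ (hzT t ht)).comp t (hasDerivAt_zetaOf m α t)).mul
        ((hasDerivAt_zetaOf m α t).const_mul ((m : ℂ) / 2)))
  have heq : ∀ t ∈ T, v₂ t + 2 * (exp ((m : ℂ) / 2 * t) * (hPoly m a).eval (invSqrt t)) * v₁ t +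
      exp ((m : ℂ) / 2 * t) * e.eval (invSqrt t) * v t = 0 := by
    intro t ht
    have hzn : z t ≠ 0 := exp_ne_zero _
    have hcoord : coordOf m α (z t) = t := coordOf_zetaOf hm ht
    have hE : exp ((m : ℂ) / 2 * t) = (m : ℂ) / 2 * exp (α * I) * z t := by
      rw [← exp_half_coordOf hm α hzn, hcoord]
    have h2 := hw2 (z t) (hzT t ht)
    rw [hcoord] at h2
    have hEq := exp_half_mul_invSqrt_pow m t
    simp only [hv, hv₁, hv₂, h2]
    have hL : (formalOp m (hPoly m a) e P).eval (invSqrt t) =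
        1 / 4 * invSqrt t ^ m * (euler (euler P)).eval (invSqrt t) -
          (hPoly m a).eval (invSqrt t) * (euler P).eval (invSqrt t) +
          e.eval (invSqrt t) * P.eval (invSqrt t) := by
      simp only [formalOp, Polynomial.eval_add, Polynomial.eval_sub, Polynomial.eval_mul,
        Polynomial.eval_C, Polynomial.eval_pow, Polynomial.eval_X]
    rw [hL]
    rw [hE] at hEq ⊢
    have hm' : (m : ℂ) ≠ 0 := Nat.cast_ne_zero.2 hm.ne'
    generalize (euler (euler P)).eval (invSqrt t) = p₂ at *
    generalize (euler P).eval (invSqrt t) = p₁ at *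
    generalize P.eval (invSqrt t) = p₀ at *
    generalize (hPoly m a).eval (invSqrt t) = h at *
    generalize e.eval (invSqrt t) = ev at *
    generalize invSqrt t ^ m = Q at *
    generalize w (z t) = w₀ at *
    generalize deriv w (z t) = w₁ at *
    generalize z t = ζ at *
    generalize exp (α * I) = A at *
    field_simp
    linear_combination (-4 * p₂) * hEq
  obtain ⟨U, hU, hUT⟩ := exists_entireSol_extending (differentiable_normalCoeff m a) hTo
    (isPreconnected_coordRegion hm α hc0 hL) (u := fun t => exp (wkbLog m a t) * v t)
    (fun t ht => ((differentiable_wkbLog m a t).cexp.mul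
      (hd1 t ht).differentiableAt).differentiableWithinAt)
    (fun t ht => normalForm_of_quotient he hTo hd1 hd2 heq ht)
  set β : ℝ := (k + 1 : ℕ) / (m : ℝ) with hβ
  have hβ0 : 0 < β := by positivity
  -- R is chosen so that |ζ| ≥ 2L/c, whence `rho` ≥ c |ζ| ≥ 2L > L. The constant converts ρ^(-β)
  -- into a power of |x| through |ζ| = (2/m) |x|^(m/2).
  refine ⟨U, hU, |K| * (c * (2 / m)) ^ (-β), (2 / m) * Real.log ((m : ℝ) / 2 * (2 * L / c)),
    fun t hR h1 h2 => ?_⟩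
  have hexpr : (m : ℂ) / 2 * t - logShift m α =
      ((m / 2 * t.re - Real.log (m / 2) : ℝ) : ℂ) + ((m / 2 * t.im - α : ℝ) : ℂ) * I := by
    conv_lhs => rw [← re_add_im t]
    rw [logShift]
    push_cast
    ring
  set x : ℝ := m / 2 * t.re - Real.log (m / 2) with hx
  set θ : ℝ := m / 2 * t.im - α with hθ
  have hθb : |θ| ≤ Real.pi - ε := by
    rw [abs_le]
    rcases hs with rfl | rfl
    · constructor <;> nlinarith [mul_nonneg hmR.le h1]
    · constructor <;> nlinarith [mul_nonneg hmR.le h1]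
  have hzt : z t = exp (x + θ * I) := by rw [hz, zetaOf, hexpr]
  have hρ : c * Real.exp x ≤ rho c (z t) := by
    rw [hzt, rho_exp, mul_comm]
    exact mul_le_mul_of_nonneg_left (le_mul_cos_add_abs_sin hε hε' hθb) (Real.exp_pos x).le
  have hexpx : Real.exp x = 2 / m * Real.exp (m / 2 * t.re) := by
    rw [hx, Real.exp_sub, Real.exp_log (by positivity)]
    field_simp
  have hbig : 2 * L / c ≤ Real.exp x := by
    have h3 : Real.log ((m : ℝ) / 2 * (2 * L / c)) ≤ m / 2 * t.re := by
      have := mul_le_mul_of_nonneg_left hR (show (0 : ℝ) ≤ m / 2 by positivity)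
      calc Real.log ((m : ℝ) / 2 * (2 * L / c)) =
          m / 2 * (2 / m * Real.log ((m : ℝ) / 2 * (2 * L / c))) := by field_simp
        _ ≤ _ := this
    rw [Real.log_le_iff_le_exp (by positivity)] at h3
    rw [hexpx]
    calc 2 * L / c = 2 / m * ((m : ℝ) / 2 * (2 * L / c)) := by field_simp
      _ ≤ _ := by gcongr
  have hmem : z t ∈ coneCompl c L := by
    have h3 : c * (2 * L / c) = 2 * L := by field_simp
    have h4 := mul_le_mul_of_nonneg_left hbig hc0.le
    have : L < rho c (z t) := by linarith
    exact this
  have htT : t ∈ T := by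
    refine ⟨?_, hmem⟩
    rw [hexpr]
    have him : ((x : ℂ) + (θ : ℂ) * I).im = θ := by simp
    rw [him]
    linarith
  rw [hUT t htT]
  have hval : exp (wkbLog m a t) * v t * exp (-wkbLog m a t) - P.eval (invSqrt t) = w (z t) := by
    have h3 : exp (wkbLog m a t) * exp (-wkbLog m a t) = 1 := by rw [← exp_add]; simp
    simp only [hv]
    linear_combination (P.eval (invSqrt t) + w (z t)) * h3
  rw [hval]
  refine (hwb _ hmem).trans ?_
  have h3 : rho c (z t) ^ (-β) ≤ (c * Real.exp x) ^ (-β) :=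
    Real.rpow_le_rpow_of_nonpos (by positivity) hρ (neg_nonpos.2 hβ0.le)
  have h4 : (c * Real.exp x) ^ (-β) =
      (c * (2 / m)) ^ (-β) * Real.exp (-((k + 1 : ℕ) / 2) * t.re) := by
    rw [hexpx, ← mul_assoc, Real.mul_rpow (by positivity) (Real.exp_pos _).le, ← Real.exp_mul]
    congr 2
    rw [hβ]
    field_simp
  have hρ0 : 0 < rho c (z t) := hL.trans hmem
  calc K * rho c (z t) ^ (-β) ≤ |K| * rho c (z t) ^ (-β) := by
        gcongr
        exact le_abs_self K
    _ ≤ |K| * (c * Real.exp x) ^ (-β) := by gcongr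
    _ = _ := by rw [h4]; ring

end StokesSibuya

end

noncomputable section

namespace StokesSibuya

open Complex Filter Topology Metric Set

/-! ### Existence and uniqueness of the canonical solution -/

/-- The term (2/m) x^(m/2) of S dominates: the other terms have smaller exponents and r(a) - 1/2
multiplies only a logarithm. The sign of Re x^(m/2) thus decides between decay and growth along a
ray. -/
theorem tendsto_wkbLog_mul_exp {m : ℕ} (hm : 0 < m) (a : Fin m → ℂ) (θ : ℝ) :
    Tendsto (fun τ : ℝ => wkbLog m a (τ + θ * I) * (Real.exp (-((m : ℝ) / 2) * τ) : ℂ)) atTop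
      (𝓝 (-(2 / m * exp ((m : ℂ) / 2 * (θ * I))))) := by
  have hmR : (0 : ℝ) < m := Nat.cast_pos.2 hm
  have hterm : ∀ k ∈ (Finset.range m).filter (fun k => 2 * k < m), Tendsto
      (fun τ : ℝ => sqrtCoeff m a k / ((m : ℂ) / 2 - k) *
        exp (((m : ℂ) / 2 - k) * (τ + θ * I)) * (Real.exp (-((m : ℝ) / 2) * τ) : ℂ)) atTop
      (𝓝 (if k = 0 then 2 / m * exp ((m : ℂ) / 2 * (θ * I)) else 0)) := by
    intro k _
    have hrw : ∀ τ : ℝ, sqrtCoeff m a k / ((m : ℂ) / 2 - k) *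
        exp (((m : ℂ) / 2 - k) * (τ + θ * I)) * (Real.exp (-((m : ℝ) / 2) * τ) : ℂ) =
        sqrtCoeff m a k / ((m : ℂ) / 2 - k) * exp (((m : ℂ) / 2 - k) * (θ * I)) *
          (Real.exp (-((k : ℝ) * τ)) : ℂ) := by
      intro τ
      rw [mul_assoc, mul_assoc]
      congr 1
      push_cast
      rw [← exp_add, ← exp_add]
      congr 1
      ring
    simp only [hrw]
    rcases Nat.eq_zero_or_pos k with rfl | hk
    · simp [sqrtCoeff]
    · rw [if_neg hk.ne']
      have h1 : Tendsto (fun τ : ℝ => Real.exp (-((k : ℝ) * τ))) atTop (𝓝 0) :=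
        Real.tendsto_exp_neg_atTop_nhds_zero.comp
          (tendsto_id.const_mul_atTop (by positivity : (0 : ℝ) < k))
      have h2 := ((continuous_ofReal.tendsto 0).comp h1).const_mul
        (sqrtCoeff m a k / ((m : ℂ) / 2 - k) * exp (((m : ℂ) / 2 - k) * (θ * I)))
      simpa using h2
  have hsum := tendsto_finsetSum _ hterm
  rw [Finset.sum_ite_eq' , if_pos (by simp [hm])] at hsum
  have hlin : Tendsto (fun τ : ℝ => (expo m a - 1 / 2) * (τ + θ * I) *
      (Real.exp (-((m : ℝ) / 2) * τ) : ℂ)) atTop (𝓝 0) := by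
    have h1 : Tendsto (fun τ : ℝ => τ ^ 1 * Real.exp (-((m : ℝ) / 2) * τ)) atTop (𝓝 0) := by
      simpa using tendsto_rpow_mul_exp_neg_mul_atTop_nhds_zero 1 ((m : ℝ) / 2) (by positivity)
    have h2 : Tendsto (fun τ : ℝ => Real.exp (-((m : ℝ) / 2) * τ)) atTop (𝓝 0) := by
      have := Real.tendsto_exp_neg_atTop_nhds_zero.comp
          (tendsto_id.const_mul_atTop (by positivity : (0 : ℝ) < m / 2))
      refine this.congr fun τ => ?_
      simp [Function.comp]
    have h3 := ((continuous_ofReal.tendsto 0).comp h1).const_mul (expo m a - 1 / 2)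
    have h4 := ((continuous_ofReal.tendsto 0).comp h2).const_mul ((expo m a - 1 / 2) * (θ * I))
    have h5 := h3.add h4
    simp only [ofReal_zero, mul_zero, add_zero] at h5
    refine h5.congr fun τ => ?_
    simp only [Function.comp_apply]
    push_cast
    ring
  have h := hsum.neg.add hlin
  rw [add_zero] at h
  refine h.congr fun τ => ?_
  rw [wkbLog, expPart, ← Finset.sum_mul]
  ring

theorem tendsto_exp_half_atTop {m : ℕ} (hm : 0 < m) :
    Tendsto (fun τ : ℝ => Real.exp ((m : ℝ) / 2 * τ)) atTop atTop :=
  Real.tendsto_exp_atTop.comp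
    (tendsto_id.const_mul_atTop (by have : (0 : ℝ) < m := Nat.cast_pos.2 hm; positivity))

theorem tendsto_re_wkbLog_mul {m : ℕ} (hm : 0 < m) (a : Fin m → ℂ) {θ κ : ℝ}
    (hθ : exp ((m : ℂ) / 2 * (θ * I)) = κ) :
    Tendsto (fun τ : ℝ => (wkbLog m a (τ + θ * I)).re * Real.exp (-((m : ℝ) / 2) * τ)) atTop
      (𝓝 (-(2 / m * κ))) := by
  have h := (continuous_re.tendsto _).comp (tendsto_wkbLog_mul_exp hm a θ)
  rw [hθ] at h
  have h1 : (-(2 / (m : ℂ) * κ)).re = -(2 / m * κ) := by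
    rw [show (-(2 / (m : ℂ) * κ)) = ((-(2 / m * κ) : ℝ) : ℂ) by push_cast; rfl, ofReal_re]
  rw [h1] at h
  refine h.congr fun τ => ?_
  simp only [Function.comp_apply]
  rw [re_mul_ofReal]

theorem exp_neg_mul_exp_half (m : ℕ) (τ : ℝ) :
    Real.exp (-((m : ℝ) / 2) * τ) * Real.exp ((m : ℝ) / 2 * τ) = 1 := by
  rw [← Real.exp_add]
  simp

theorem tendsto_re_wkbLog_atBot {m : ℕ} (hm : 0 < m) (a : Fin m → ℂ) :
    Tendsto (fun τ : ℝ => (wkbLog m a (τ + (0 : ℝ) * I)).re) atTop atBot := by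
  have hmR : (0 : ℝ) < m := Nat.cast_pos.2 hm
  have h := tendsto_re_wkbLog_mul hm a (θ := 0) (κ := 1) (by simp)
  have h2 := h.neg_mul_atTop (by
    have : (0 : ℝ) < 2 / m := by positivity
    linarith) (tendsto_exp_half_atTop hm)
  refine h2.congr fun τ => ?_
  rw [mul_assoc, exp_neg_mul_exp_half, mul_one]

theorem tendsto_re_wkbLog_atTop {m : ℕ} (hm : 0 < m) (a : Fin m → ℂ) {θ : ℝ}
    (hθ : exp ((m : ℂ) / 2 * (θ * I)) = -1) :
    Tendsto (fun τ : ℝ => (wkbLog m a (τ + θ * I)).re) atTop atTop := by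
  have hmR : (0 : ℝ) < m := Nat.cast_pos.2 hm
  have h := tendsto_re_wkbLog_mul hm a (θ := θ) (κ := -1) (by rw [hθ]; simp)
  have h2 := h.pos_mul_atTop (by
    have : (0 : ℝ) < 2 / m := by positivity
    linarith) (tendsto_exp_half_atTop hm)
  refine h2.congr fun τ => ?_
  rw [mul_assoc, exp_neg_mul_exp_half, mul_one]

/-- Along `Im t = θ`, the function `u` is equivalent to the leading factor at infinity. -/
def IsAsymp (m : ℕ) (a : Fin m → ℂ) (θ : ℝ) (u : ℂ → ℂ) : Prop :=
  Tendsto (fun τ : ℝ => u (τ + θ * I) * exp (-wkbLog m a (τ + θ * I))) atTop (𝓝 1)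

theorem IsAsymp.tendsto_zero {m : ℕ} (hm : 0 < m) {a : Fin m → ℂ} {u : ℂ → ℂ}
    (hu : IsAsymp m a 0 u) : Tendsto (fun τ : ℝ => u (τ + (0 : ℝ) * I)) atTop (𝓝 0) := by
  have h1 : Tendsto (fun τ : ℝ => exp (wkbLog m a (τ + (0 : ℝ) * I))) atTop (𝓝 0) := by
    rw [tendsto_zero_iff_norm_tendsto_zero]
    simp only [norm_exp]
    exact Real.tendsto_exp_atBot.comp (tendsto_re_wkbLog_atBot hm a)
  have h2 := hu.mul h1
  rw [mul_zero] at h2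
  refine h2.congr fun τ => ?_
  rw [mul_assoc, ← exp_add]
  simp

theorem IsAsymp.tendsto_norm_atTop {m : ℕ} (hm : 0 < m) {a : Fin m → ℂ} {u : ℂ → ℂ} {θ : ℝ}
    (hθ : exp ((m : ℂ) / 2 * (θ * I)) = -1) (hu : IsAsymp m a θ u) :
    Tendsto (fun τ : ℝ => ‖u (τ + θ * I)‖) atTop atTop := by
  have h1 : Tendsto (fun τ : ℝ => ‖exp (wkbLog m a (τ + θ * I))‖) atTop atTop := by
    simp only [norm_exp]
    exact Real.tendsto_exp_atTop.comp (tendsto_re_wkbLog_atTop hm a hθ)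
  have h2 := hu.norm.pos_mul_atTop (by simp) h1
  refine h2.congr fun τ => ?_
  rw [← norm_mul, mul_assoc, ← exp_add]
  simp

theorem IsAsymp.exists_ne_zero {m : ℕ} {a : Fin m → ℂ} {u : ℂ → ℂ} {θ : ℝ}
    (hu : IsAsymp m a θ u) : ∃ t, u t ≠ 0 := by
  by_contra! h
  have := tendsto_nhds_unique hu (tendsto_const_nhds.congr fun τ => by rw [h, zero_mul])
  exact one_ne_zero this

/-! ### The rotation symmetry, and growing and decaying solutions -/

theorem omega_pow {m : ℕ} (hm : 0 < m) (σ : ℤˣ) : omega m σ ^ m = 1 := by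
  have hm' : (m : ℂ) ≠ 0 := Nat.cast_ne_zero.2 hm.ne'
  rw [omega, ← exp_nat_mul, logOmega, exp_eq_one_iff]
  refine ⟨(σ : ℤ), ?_⟩
  field_simp

theorem exp_int_mul_logOmega (m : ℕ) (σ : ℤˣ) (k : ℤ) :
    exp (k * logOmega m σ) = omega m σ ^ k := by
  rw [omega, ← exp_int_mul]

theorem poly_scale {m : ℕ} (z : ℂ) (a : Fin m → ℂ) (x : ℂ) :
    poly m (scale z a) (z * x) = z ^ m * poly m a x := by
  rw [poly, poly, mul_add, Finset.mul_sum, mul_pow]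
  congr 1
  refine Finset.sum_congr rfl fun j _ => ?_
  have h : m = (j.val + 1) + (m - (j.val + 1)) := by omega
  have h2 : z ^ m = z ^ (j.val + 1) * z ^ (m - (j.val + 1)) := by rw [← pow_add, ← h]
  rw [scale, mul_pow, h2]
  ring

/-- P_m is weighted homogeneous of degree m and ω^m = 1. Hence rotated solutions of rotated
equations solve the original one, as needed for every Φ_k. -/
theorem normalCoeff_scale {m : ℕ} (hm : 0 < m) (σ : ℤˣ) (k : ℤ) (a : Fin m → ℂ) (t : ℂ) :
    normalCoeff m (scale (omega m σ ^ k) a) (t + k * logOmega m σ) = normalCoeff m a t := by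
  rw [normalCoeff, normalCoeff, exp_add, exp_int_mul_logOmega, mul_comm (exp t), poly_scale,
    ← zpow_natCast, ← zpow_mul, mul_comm k, zpow_mul, zpow_natCast, omega_pow hm, one_zpow, one_mul]

theorem isAsymp_of_bound {m : ℕ} {a : Fin m → ℂ} {e : Polynomial ℂ} {k : ℕ} {θ : ℝ} {u : ℂ → ℂ}
    {K R : ℝ} (h : ∀ τ : ℝ, R ≤ τ →
      ‖u (τ + θ * I) * exp (-wkbLog m a (τ + θ * I)) -
        (formalSum m (hPoly m a) e k).eval (invSqrt (τ + θ * I))‖ ≤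
        K * Real.exp (-((k + 1 : ℕ) / 2) * τ)) : IsAsymp m a θ u := by
  have h1 : Tendsto (fun τ : ℝ => K * Real.exp (-((k + 1 : ℕ) / 2) * τ)) atTop (𝓝 0) := by
    have := (Real.tendsto_exp_neg_atTop_nhds_zero.comp (tendsto_id.const_mul_atTop
      (by positivity : (0 : ℝ) < (k + 1 : ℕ) / 2))).const_mul K
    rw [mul_zero] at this
    refine this.congr fun τ => ?_
    simp only [Function.comp_apply, id, neg_mul]
  have h2 := squeeze_zero_norm' (Filter.eventually_atTop.2 ⟨R, h⟩) h1
  have h3 : Tendsto (fun τ : ℝ => invSqrt (τ + θ * I)) atTop (𝓝 0) := by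
    rw [tendsto_zero_iff_norm_tendsto_zero]
    simp only [norm_invSqrt]
    have := Real.tendsto_exp_neg_atTop_nhds_zero.comp
      (tendsto_id.const_mul_atTop (by positivity : (0 : ℝ) < 1 / 2))
    refine this.congr fun τ => ?_
    simp only [Function.comp_apply, id]
    congr 1
    simp
    ring
  have h4 := ((formalSum m (hPoly m a) e k).continuous.tendsto 0).comp h3
  have h5 : (formalSum m (hPoly m a) e k).eval 0 = 1 := by
    rw [formalSum_eq, Polynomial.eval_finsetSum, Finset.sum_eq_single 0]
    · simp [formalCoeff]
    · intro n _ hn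
      simp [hn]
    · simp
  rw [h5] at h4
  have h6 := h2.add h4
  rw [zero_add] at h6
  refine h6.congr fun τ => ?_
  simp

theorem exp_half_mul_two_pi_div {m : ℕ} (hm : 0 < m) (σ : ℤˣ) :
    exp ((m : ℂ) / 2 * (((σ : ℤ) * (2 * Real.pi / m) : ℝ) * I)) = -1 := by
  have hm' : (m : ℂ) ≠ 0 := Nat.cast_ne_zero.2 hm.ne'
  rcases Int.units_eq_one_or σ with rfl | rfl
  · rw [← exp_pi_mul_I]
    congr 1
    push_cast
    field_simp
  · rw [← exp_neg_pi_mul_I]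
    congr 1
    push_cast
    field_simp

/-- Rotation of the solution built for ω·a. Along arg x = 2π/m its leading factor grows, since
x^(m/2) is negative there, and translation by log ω brings this ray to the real axis. -/
theorem exists_growing {m : ℕ} (hm : 0 < m) (a : Fin m → ℂ) :
    ∃ g, EntireSol (normalCoeff m a) g ∧
      Tendsto (fun τ : ℝ => ‖g (τ + (0 : ℝ) * I)‖) atTop atTop := by
  have hmR : (0 : ℝ) < m := Nat.cast_pos.2 hm
  obtain ⟨e, e0, -, he⟩ := exists_ePoly hm (scale (omega m 1 ^ (1 : ℤ)) a)
  -- ε = π/8 leaves 3π - 4ε = 5π/2 ≥ 2π, so the half-strip contains Im t = 2π/m. Order k = 0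
  -- suffices for the leading behaviour.
  obtain ⟨U, hU, K, R, hb⟩ := exists_entireSol_side hm (scale (omega m 1 ^ (1 : ℤ)) a) e0 he 0 (s := 1) (ε := Real.pi / 8)
    (Or.inl rfl) (by positivity) (by linarith [Real.pi_pos])
  have hA : IsAsymp m (scale (omega m 1 ^ (1 : ℤ)) a) (((1 : ℤˣ) : ℤ) * (2 * Real.pi / m)) U := by
    refine isAsymp_of_bound (e := e) (k := 0) (K := K) (R := R) fun τ hτ => ?_
    have := hb (τ + ((((1 : ℤˣ) : ℤ) * (2 * Real.pi / m) : ℝ) : ℂ) * I)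
    simp only [add_re, ofReal_re, mul_re, I_re, mul_zero, ofReal_im, I_im, mul_one, sub_zero,
      add_zero, add_im, mul_im, zero_add, one_mul] at this
    refine this hτ ?_ ?_
    · simp only [Units.val_one, Int.cast_one, one_mul]
      positivity
    · simp only [Units.val_one, Int.cast_one, one_mul]
      rw [mul_div_cancel₀ _ hmR.ne']
      linarith [Real.pi_pos]
  have hG := hU.comp_add (((1 : ℤ) : ℂ) * logOmega m 1)
  simp only [normalCoeff_scale hm] at hG
  refine ⟨_, hG, (hA.tendsto_norm_atTop hm (exp_half_mul_two_pi_div hm 1)).congr fun τ => ?_⟩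
  congr 2
  rw [logOmega]
  push_cast
  ring

/-- Two solutions equivalent to the leading factor on the real axis coincide. -/
theorem IsAsymp.unique {m : ℕ} (hm : 0 < m) {a : Fin m → ℂ} {u₁ u₂ : ℂ → ℂ}
    (h₁ : EntireSol (normalCoeff m a) u₁) (h₂ : EntireSol (normalCoeff m a) u₂)
    (hA₁ : IsAsymp m a 0 u₁) (hA₂ : IsAsymp m a 0 u₂) : u₁ = u₂ := by
  obtain ⟨g, hg, hgt⟩ := exists_growing hm a
  have hw : wronsk u₁ u₂ 0 = 0 := by
    -- Two independent solutions tending to 0 on the real axis would force every solution, including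
    -- g, to tend to 0.
    by_contra hne
    have hrel : ∀ t, g t = (wronsk u₁ g 0 / wronsk u₁ u₂ 0) * u₂ t -
        (wronsk u₂ g 0 / wronsk u₁ u₂ 0) * u₁ t := by
      intro t
      field_simp
      linear_combination h₁.wronsk_relation h₂ hg t
    have hlim := (((hA₂.tendsto_zero hm).const_mul (wronsk u₁ g 0 / wronsk u₁ u₂ 0)).sub
      ((hA₁.tendsto_zero hm).const_mul (wronsk u₂ g 0 / wronsk u₁ u₂ 0))).norm
    simp only [← hrel] at hlim
    exact not_tendsto_nhds_of_tendsto_atTop hgt _ hlim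
  obtain ⟨c, hc⟩ := h₁.exists_eq_mul h₂ hw hA₁.exists_ne_zero
  have hlim := hA₁.const_mul c
  have hc1 : c * 1 = 1 := by
    refine tendsto_nhds_unique hlim (Tendsto.congr (fun τ => ?_) hA₂)
    rw [hc, mul_assoc]
  funext t
  rw [hc, ← mul_one c, hc1, one_mul]

/-- The normal form `u = exp (-t / 2) Φ`. -/
theorem isSolution_iff {m : ℕ} {a : Fin m → ℂ} {Φ u : ℂ → ℂ}
    (h : ∀ t, Φ t = exp (t / 2) * u t) : IsSolution m a Φ ↔ EntireSol (normalCoeff m a) u := by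
  have hE : ∀ t : ℂ, HasDerivAt (fun t => exp (t / 2)) (exp (t / 2) / 2) t := fun t => by
    have := ((hasDerivAt_id t).div_const 2).cexp
    convert! this using 1
    simp only [id]
    ring
  have hE' : ∀ t : ℂ, HasDerivAt (fun t => exp (-t / 2)) (-(exp (-t / 2) / 2)) t := fun t => by
    have := (((hasDerivAt_id t).neg).div_const 2).cexp
    convert! this using 1
    simp only [id, Pi.neg_apply]
    ring
  have hΦ : Φ = fun t => exp (t / 2) * u t := funext h
  have hu : u = fun t => exp (-t / 2) * Φ t := by
    funext t
    rw [h, ← mul_assoc, ← exp_add]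
    ring_nf
    simp
  have hdiff : Differentiable ℂ Φ ↔ Differentiable ℂ u := by
    constructor
    · intro hd
      rw [hu]
      exact fun t => ((hE' t).differentiableAt).mul (hd t)
    · intro hd
      rw [hΦ]
      exact fun t => ((hE t).differentiableAt).mul (hd t)
  rw [IsSolution, EntireSol, hdiff]
  refine and_congr_right fun hd => forall_congr' fun t => ?_
  have hd' : Differentiable ℂ (deriv u) := fun t => (hd.analyticAt t).deriv.differentiableAt
  have h1 : ∀ t, deriv Φ t = exp (t / 2) / 2 * u t + exp (t / 2) * deriv u t := fun t => by
    rw [hΦ]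
    exact ((hE t).mul (hd t).hasDerivAt).deriv
  have h2 : ddx Φ = fun t => exp (-t) * (exp (t / 2) / 2 * u t + exp (t / 2) * deriv u t) := by
    funext t
    rw [ddx, h1]
  have h3 : HasDerivAt (ddx Φ) (exp (-t) * (exp (t / 2) * (deriv (deriv u) t - u t / 4))) t := by
    rw [h2]
    have := ((hasDerivAt_id t).neg.cexp).mul ((((hE t).div_const 2).mul (hd t).hasDerivAt).add
      ((hE t).mul (hd' t).hasDerivAt))
    convert! this using 1
    simp only [id, Pi.neg_apply, Pi.mul_apply, Pi.add_apply]
    ring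
  rw [ddx, h3.deriv, h, normalCoeff]
  have he : exp (-t) * exp t = 1 := by rw [← exp_add]; simp
  have hne := exp_ne_zero t
  have hne2 := exp_ne_zero (t / 2)
  have hkey : exp (-t) * (exp (-t) * (exp (t / 2) * (deriv (deriv u) t - u t / 4))) -
      poly m a (exp t) / exp t ^ 2 * (exp (t / 2) * u t) =
      exp (t / 2) / exp t ^ 2 * (deriv (deriv u) t - (poly m a (exp t) + 1 / 4) * u t) := by
    rw [exp_neg]
    field_simp
    ring
  rw [← sub_eq_zero, hkey, mul_eq_zero, sub_eq_zero]
  constructor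
  · rintro (h0 | h0)
    · exact absurd h0 (div_ne_zero hne2 (pow_ne_zero 2 hne))
    · exact h0
  · exact Or.inr

/-- The normal form of a function. -/
def normalForm (Φ : ℂ → ℂ) (t : ℂ) : ℂ := exp (-t / 2) * Φ t

theorem eq_exp_mul_normalForm (Φ : ℂ → ℂ) (t : ℂ) : Φ t = exp (t / 2) * normalForm Φ t := by
  rw [normalForm, ← mul_assoc, ← exp_add]
  ring_nf
  simp

theorem normalForm_mul_exp (m : ℕ) (a : Fin m → ℂ) (Φ : ℂ → ℂ) (t : ℂ) :
    normalForm Φ t * exp (-wkbLog m a t) = Φ t * exp (expPart m a t - expo m a * t) := by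
  rw [normalForm, mul_comm (exp _), mul_assoc, ← exp_add, wkbLog]
  congr 2
  ring

theorem HasExpansion.isAsymp {m : ℕ} {a : Fin m → ℂ} {Φ : ℂ → ℂ} (h : HasExpansion m a Φ) {θ : ℝ}
    (hθ : |θ| < 3 * Real.pi / m) : IsAsymp m a θ (normalForm Φ) := by
  obtain ⟨c, c0, -, hc⟩ := h
  obtain ⟨K, R, hb⟩ := hc |θ| hθ 1
  -- The partial sum of index 0 is 1 for any e, so e = 0 will do, and the expansion with N = 1 is
  -- just the bound required.
  refine isAsymp_of_bound (e := 0) (k := 0) (K := K) (R := R) fun τ hτ => ?_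
  have := hb (τ + θ * I) (by simpa using hτ) (by simp)
  rw [normalForm_mul_exp]
  simpa [formalSum, c0] using this

/-- One U is fixed by a crude order and sector. For each further order k and width δ, the solutions
built on the upper and lower half-strips are equivalent to the leading factor on the real axis and
so equal U, which therefore has all the expansions at once. -/
theorem exists_isCanonical {m : ℕ} (hm : 0 < m) (a : Fin m → ℂ) : ∃ Φ, IsCanonical m a Φ := by
  have hmR : (0 : ℝ) < m := Nat.cast_pos.2 hm
  have hpi := Real.pi_pos
  obtain ⟨e, e0, heven, he⟩ := exists_ePoly hm a
  have hside := fun (k : ℕ) (s ε : ℝ) (hs : s = 1 ∨ s = -1) (hε : 0 < ε)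
    (hε' : ε < Real.pi / 2) => exists_entireSol_side hm a e0 he k hs hε hε'
  have hreal : ∀ (U : ℂ → ℂ) (k : ℕ) (s ε K R : ℝ), ε < Real.pi / 2 →
      (∀ t : ℂ, R ≤ t.re → 0 ≤ s * t.im → (m : ℝ) * (s * t.im) ≤ 3 * Real.pi - 4 * ε →
      ‖U t * exp (-wkbLog m a t) - (formalSum m (hPoly m a) e k).eval (invSqrt t)‖ ≤
        K * Real.exp (-((k + 1 : ℕ) / 2) * t.re)) → IsAsymp m a 0 U := by
    intro U k s ε K R hε hb
    refine isAsymp_of_bound (e := e) (k := k) (K := K) (R := R) fun τ hτ => ?_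
    have := hb (τ + (0 : ℝ) * I)
    simp only [add_re, ofReal_re, mul_re, I_re, mul_zero, ofReal_im, I_im, mul_one, sub_zero,
      add_zero, add_im, mul_im] at this
    exact this hτ le_rfl (by linarith)
  obtain ⟨U, hU, K₀, R₀, hb₀⟩ := hside 0 1 (Real.pi / 8) (Or.inl rfl) (by positivity)
    (by linarith)
  have hUA := hreal U 0 1 _ K₀ R₀ (by linarith) hb₀
  have hnf : normalForm (fun t => exp (t / 2) * U t) = U := by
    funext t
    rw [normalForm, ← mul_assoc, ← exp_add]
    ring_nf
    simp
  -- K ≥ 0 and R ≥ 0 are recorded for the order N = 0, which is deduced from k = 0 using e^(-Re t /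
  -- 2) ≤ 1.
  have hpos : ∀ δ : ℝ, δ < 3 * Real.pi / m → ∀ k : ℕ, ∃ K R : ℝ, 0 ≤ K ∧ 0 ≤ R ∧ ∀ t : ℂ,
      R ≤ t.re → |t.im| ≤ δ →
      ‖U t * exp (-wkbLog m a t) -
          ∑ n ∈ Finset.range (k + 1), formalCoeff m (hPoly m a) e n *
            exp (-((n : ℂ) / 2) * t)‖ ≤
        K * Real.exp (-(((k + 1 : ℕ) : ℝ) / 2) * t.re) := by
    intro δ hδ k
    rw [lt_div_iff₀ hmR] at hδ
    set ε := min (Real.pi / 8) ((3 * Real.pi - δ * m) / 4) with hε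
    have hε0 : 0 < ε := lt_min (by positivity) (by linarith)
    have hε1 : ε ≤ Real.pi / 8 := min_le_left _ _
    have hε2 : ε ≤ (3 * Real.pi - δ * m) / 4 := min_le_right _ _
    obtain ⟨U₁, hU₁, K₁, R₁, hb₁⟩ := hside k 1 ε (Or.inl rfl) hε0 (by linarith)
    obtain ⟨U₂, hU₂, K₂, R₂, hb₂⟩ := hside k (-1) ε (Or.inr rfl) hε0 (by linarith)
    obtain rfl := IsAsymp.unique hm hU hU₁ hUA (hreal U₁ k 1 ε K₁ R₁ (by linarith) hb₁)
    obtain rfl := IsAsymp.unique hm hU hU₂ hUA (hreal U₂ k (-1) ε K₂ R₂ (by linarith) hb₂)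
    refine ⟨|K₁| + |K₂|, |R₁| + |R₂|, by positivity, by positivity, fun t ht hδt => ?_⟩
    have hsum : ∑ n ∈ Finset.range (k + 1), formalCoeff m (hPoly m a) e n *
        exp (-((n : ℂ) / 2) * t) = (formalSum m (hPoly m a) e k).eval (invSqrt t) := by
      rw [formalSum_eq, Polynomial.eval_finsetSum]
      refine Finset.sum_congr rfl fun n _ => ?_
      rw [← invSqrt_pow]
      simp
    rw [hsum]
    have hmt : (m : ℝ) * |t.im| ≤ 3 * Real.pi - 4 * ε := by
      have := mul_le_mul_of_nonneg_left hδt hmR.le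
      linarith
    have hR₁ : R₁ ≤ t.re := by
      linarith [le_abs_self R₁, abs_nonneg R₂]
    have hR₂ : R₂ ≤ t.re := by
      linarith [le_abs_self R₂, abs_nonneg R₁]
    have hexp := (Real.exp_pos (-(((k + 1 : ℕ) : ℝ) / 2) * t.re)).le
    rcases le_total 0 t.im with h | h
    · rw [abs_of_nonneg h] at hmt
      refine (hb₁ t hR₁ (by rwa [one_mul]) (by rwa [one_mul])).trans ?_
      refine mul_le_mul_of_nonneg_right ?_ hexp
      linarith [le_abs_self K₁, abs_nonneg K₂]
    · rw [abs_of_nonpos h] at hmt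
      refine (hb₂ t hR₂ (by linarith) (by linarith)).trans ?_
      refine mul_le_mul_of_nonneg_right ?_ hexp
      linarith [le_abs_self K₂, abs_nonneg K₁]
  refine ⟨fun t => exp (t / 2) * U t, (isSolution_iff fun t => rfl).2 hU,
    formalCoeff m (hPoly m a) e, rfl, fun hev n hn => ?_, fun δ hδ N => ?_⟩
  · have hh : IsEvenPoly (hPoly m a) := (isEvenPoly_sum _).neg.add
      ((isEvenPoly_C _).mul (isEvenPoly_X_pow hev))
    exact formalCoeff_eq_zero hev hh (heven hev) hn
  · rcases N with _ | k
    · obtain ⟨K, R, hK, hR, hb⟩ := hpos δ hδ 0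
      refine ⟨K + 1, R, fun t ht hδt => ?_⟩
      have h1 := hb t ht hδt
      rw [← normalForm_mul_exp m a (fun t => exp (t / 2) * U t), hnf]
      simp only [zero_add, Finset.range_one, Finset.sum_singleton, formalCoeff, Nat.cast_zero,
        zero_div, neg_zero, zero_mul, exp_zero, one_mul, Nat.cast_one] at h1
      simp only [Finset.range_zero, Finset.sum_empty, sub_zero, Nat.cast_zero, zero_div, neg_zero,
        zero_mul, Real.exp_zero, mul_one]
      have h2 : Real.exp (-(1 / 2) * t.re) ≤ 1 := Real.exp_le_one_iff.2 (by linarith)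
      have h3 := norm_le_norm_sub_add (U t * exp (-wkbLog m a t)) 1
      rw [norm_one] at h3
      have h4 := mul_le_mul_of_nonneg_left h2 hK
      linarith
    · obtain ⟨K, R, -, -, hb⟩ := hpos δ hδ k
      refine ⟨K, R, fun t ht hδt => ?_⟩
      rw [← normalForm_mul_exp m a (fun t => exp (t / 2) * U t), hnf]
      exact hb t ht hδt

theorem isCanonical_unique {m : ℕ} (hm : 0 < m) {a : Fin m → ℂ} {Φ Ψ : ℂ → ℂ}
    (hΦ : IsCanonical m a Φ) (hΨ : IsCanonical m a Ψ) : Φ = Ψ := by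
  have h0 : |(0 : ℝ)| < 3 * Real.pi / m := by
    rw [abs_zero]
    have : (0 : ℝ) < m := Nat.cast_pos.2 hm
    positivity
  have h := IsAsymp.unique hm ((isSolution_iff (eq_exp_mul_normalForm Φ)).1 hΦ.1)
    ((isSolution_iff (eq_exp_mul_normalForm Ψ)).1 hΨ.1) (hΦ.2.isAsymp h0) (hΨ.2.isAsymp h0)
  funext t
  rw [eq_exp_mul_normalForm Φ, eq_exp_mul_normalForm Ψ, h]

theorem isCanonical_Phi0 {m : ℕ} (hm : 0 < m) (a : Fin m → ℂ) : IsCanonical m a (Phi0 m a) :=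
  Classical.epsilon_spec (exists_isCanonical hm a)

end StokesSibuya

end

noncomputable section

namespace StokesSibuya

open Complex Filter Topology Metric Set

/-! ### Stokes–Sibuya coefficients -/

theorem eq_zero_of_lincomb_eq_zero {f g : ℂ → ℂ} (hf : Differentiable ℂ f)
    (hg : Differentiable ℂ g) {s : ℂ} (hw : wronsk f g s ≠ 0) {α β : ℂ}
    (h : ∀ t, α * f t + β * g t = 0) : α = 0 ∧ β = 0 := by
  have hd : α * deriv f s + β * deriv g s = 0 := by
    have h1 := ((hf s).hasDerivAt.const_mul α).add ((hg s).hasDerivAt.const_mul β)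
    have h2 : ((fun t => α * f t) + fun t => β * g t) = fun _ => 0 := funext h
    rw [h2] at h1
    exact (h1.unique (hasDerivAt_const s 0))
  rw [wronsk] at hw
  constructor
  · refine (mul_eq_zero.1 ?_).resolve_right hw
    linear_combination deriv g s * h s - g s * hd
  · refine (mul_eq_zero.1 ?_).resolve_right hw
    linear_combination f s * hd - deriv f s * h s

theorem normalForm_Phi (m : ℕ) (σ : ℤˣ) (k : ℤ) (a : Fin m → ℂ) (t : ℂ) :
    normalForm (Phi m σ k a) t = exp (k * logOmega m σ / 2) *
      normalForm (Phi0 m (scale (omega m σ ^ k) a)) (t + k * logOmega m σ) := by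
  rw [normalForm, normalForm, Phi, ← mul_assoc, ← exp_add]
  congr 2
  ring

theorem entireSol_normalForm_Phi {m : ℕ} (hm : 0 < m) (σ : ℤˣ) (k : ℤ) (a : Fin m → ℂ) :
    EntireSol (normalCoeff m a) (normalForm (Phi m σ k a)) := by
  have h := ((isSolution_iff (eq_exp_mul_normalForm _)).1
    (isCanonical_Phi0 hm (scale (omega m σ ^ k) a)).1).comp_add (k * logOmega m σ)
  simp only [normalCoeff_scale hm] at h
  have h2 := h.lincomb h (exp (k * logOmega m σ / 2)) 0
  have h3 : normalForm (Phi m σ k a) = fun t => exp (k * logOmega m σ / 2) *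
      normalForm (Phi0 m (scale (omega m σ ^ k) a)) (t + k * logOmega m σ) + 0 *
      normalForm (Phi0 m (scale (omega m σ ^ k) a)) (t + k * logOmega m σ) := by
    funext t
    rw [normalForm_Phi, zero_mul, add_zero]
  rw [h3]
  exact h2

theorem isAsymp_normalForm_Phi0 {m : ℕ} (hm : 0 < m) (a : Fin m → ℂ) {θ : ℝ}
    (hθ : |θ| < 3 * Real.pi / m) : IsAsymp m a θ (normalForm (Phi0 m a)) :=
  (isCanonical_Phi0 hm a).2.isAsymp hθ

/-- Consecutive solutions `Φ_k`, `Φ_{k+1}` are linearly independent. -/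
theorem wronsk_Phi_ne_zero {m : ℕ} (hm : 0 < m) (σ : ℤˣ) (k : ℤ) (a : Fin m → ℂ) :
    wronsk (normalForm (Phi m σ k a)) (normalForm (Phi m σ (k + 1) a)) 0 ≠ 0 := by
  have hmR : (0 : ℝ) < m := Nat.cast_pos.2 hm
  intro hw
  set ℓ := logOmega m σ with hℓ
  have hA := isAsymp_normalForm_Phi0 hm (scale (omega m σ ^ k) a) (θ := 0) (by
    rw [abs_zero]
    positivity)
  -- The expansion of Φ_0 holds beyond |arg x| < π/m: the angle 2π/m, where it grows, lies within
  -- 3π/m. In the variable where Φ_k decays on the real axis, Φ_{k+1} is seen at this angle.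
  have hB := isAsymp_normalForm_Phi0 hm (scale (omega m σ ^ (k + 1)) a)
    (θ := (σ : ℤ) * (2 * Real.pi / m)) (by
      have h1 : |(((σ : ℤ) : ℝ))| = 1 := by
        rcases Int.units_eq_one_or σ with rfl | rfl <;> simp
      rw [abs_mul, h1, one_mul, abs_of_pos (by positivity)]
      gcongr
      norm_num)
  obtain ⟨t₀, ht₀⟩ := hA.exists_ne_zero
  obtain ⟨c, hc⟩ := (entireSol_normalForm_Phi hm σ k a).exists_eq_mul
    (entireSol_normalForm_Phi hm σ (k + 1) a) hw ⟨t₀ - k * ℓ, by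
      rw [normalForm_Phi, sub_add_cancel]
      exact mul_ne_zero (exp_ne_zero _) ht₀⟩
  have h0 := ((hA.tendsto_zero hm).const_mul
    (c * exp (k * ℓ / 2) / exp ((k + 1 : ℤ) * ℓ / 2))).norm
  refine not_tendsto_nhds_of_tendsto_atTop
    (hB.tendsto_norm_atTop hm (exp_half_mul_two_pi_div hm σ)) _ (h0.congr fun τ => ?_)
  have h1 := hc (τ - k * ℓ)
  rw [normalForm_Phi, normalForm_Phi, ← hℓ] at h1
  have h2 : (τ : ℂ) - k * ℓ + (k + 1 : ℤ) * ℓ =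
      τ + (((σ : ℤ) * (2 * Real.pi / m) : ℝ) : ℂ) * I := by
    rw [hℓ, logOmega]
    push_cast
    ring
  rw [h2, sub_add_cancel] at h1
  congr 1
  rw [ofReal_zero, zero_mul, add_zero, div_mul_eq_mul_div, div_eq_iff (exp_ne_zero _)]
  linear_combination -h1

theorem isConnection_iff (m : ℕ) (σ : ℤˣ) (k : ℤ) (a : Fin m → ℂ) (c : ℂ × ℂ) :
    IsConnection m σ k a c ↔ ∀ t, normalForm (Phi m σ (k - 1) a) t =
      c.1 * normalForm (Phi m σ k a) t + c.2 * normalForm (Phi m σ (k + 1) a) t := by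
  refine forall_congr' fun t => ?_
  rw [normalForm, normalForm, normalForm, ← mul_right_inj' (exp_ne_zero (-t / 2))]
  constructor <;> intro h <;> linear_combination h

/-- Cramer's rule with Wronskians, whose denominator W(Φ_k, Φ_{k+1}) does not vanish. -/
theorem existsUnique_isConnection {m : ℕ} (hm : 0 < m) (σ : ℤˣ) (k : ℤ) (a : Fin m → ℂ) :
    ∃! c : ℂ × ℂ, IsConnection m σ k a c := by
  have hf := entireSol_normalForm_Phi hm σ (k - 1) a
  have hg := entireSol_normalForm_Phi hm σ k a
  have hh := entireSol_normalForm_Phi hm σ (k + 1) a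
  have hw := wronsk_Phi_ne_zero hm σ k a
  simp only [isConnection_iff]
  set f := normalForm (Phi m σ (k - 1) a)
  set g := normalForm (Phi m σ k a)
  set h := normalForm (Phi m σ (k + 1) a)
  have hc : ∀ t, f t = wronsk f h 0 / wronsk g h 0 * g t +
      -(wronsk f g 0 / wronsk g h 0) * h t := by
    intro t
    field_simp
    linear_combination hf.wronsk_relation hg hh t
  refine ⟨(_, _), hc, fun d hd => ?_⟩
  have := eq_zero_of_lincomb_eq_zero hg.1 hh.1 hw
    (α := d.1 - wronsk f h 0 / wronsk g h 0) (β := d.2 - -(wronsk f g 0 / wronsk g h 0))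
    fun t => by linear_combination hc t - hd t
  exact Prod.ext (sub_eq_zero.1 this.1) (sub_eq_zero.1 this.2)

theorem isConnection_coeff {m : ℕ} (hm : 0 < m) (σ : ℤˣ) (k : ℤ) (a : Fin m → ℂ) :
    IsConnection m σ k a (coeffC m σ k a, coeffCt m σ k a) :=
  Classical.epsilon_spec (existsUnique_isConnection hm σ k a).exists

theorem prod_stokesMatrix_mulVec {m : ℕ} (hm : 0 < m) (σ : ℤˣ) (a : Fin m → ℂ) (n : ℕ) (t : ℂ) :
    ![normalForm (Phi m σ (-1) a) t, normalForm (Phi m σ 0 a) t] =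
      (List.ofFn fun k : Fin n => stokesMatrix m σ ((k : ℕ) : ℤ) a).prod.mulVec
        ![normalForm (Phi m σ ((n : ℤ) - 1) a) t, normalForm (Phi m σ n a) t] := by
  induction n with
  | zero => simp
  | succ n ih =>
    rw [ih, List.ofFn_succ_last, List.prod_append, List.prod_singleton, ← Matrix.mulVec_mulVec]
    congr 1
    have h := (isConnection_iff m σ n a _).1 (isConnection_coeff hm σ n a) t
    ext i
    fin_cases i
    · simpa [stokesMatrix, Matrix.mulVec, dotProduct, Fin.sum_univ_two] using h
    · simp [stokesMatrix, Matrix.mulVec, dotProduct, Fin.sum_univ_two]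

/-- m rotations by ω return the parameters to themselves and shift t by ±2πi. The sign is e^(∓πi),
from the factor e^(-t/2) of the normal form. -/
theorem Phi_add_natCast {m : ℕ} (hm : 0 < m) (σ : ℤˣ) (k : ℤ) (a : Fin m → ℂ) (t : ℂ) :
    normalForm (Phi m σ (k + m) a) t =
      -normalForm (Phi m σ k a) (t + (σ : ℤ) * (2 * Real.pi * I)) := by
  have hm' : (m : ℂ) ≠ 0 := Nat.cast_ne_zero.2 hm.ne'
  have hω : omega m σ ≠ 0 := exp_ne_zero _
  have hpow : omega m σ ^ (k + m) = omega m σ ^ k := by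
    rw [zpow_add₀ hω, zpow_natCast, omega_pow hm, mul_one]
  have hℓ : (m : ℂ) * logOmega m σ = (σ : ℤ) * (2 * Real.pi * I) := by
    rw [logOmega]
    field_simp
  have harg : t + ((k + m : ℤ) : ℂ) * logOmega m σ =
      t + (σ : ℤ) * (2 * Real.pi * I) + k * logOmega m σ := by
    push_cast
    linear_combination hℓ
  have hexp : exp (-(t + (σ : ℤ) * (2 * Real.pi * I)) / 2) = -exp (-t / 2) := by
    rcases Int.units_eq_one_or σ with rfl | rfl
    · rw [show -(t + (((1 : ℤˣ) : ℤ) : ℂ) * (2 * Real.pi * I)) / 2 = -t / 2 - Real.pi * I by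
        push_cast; ring, exp_sub, exp_pi_mul_I, div_neg, div_one]
    · rw [show -(t + (((-1 : ℤˣ) : ℤ) : ℂ) * (2 * Real.pi * I)) / 2 = -t / 2 + Real.pi * I by
        push_cast; ring, exp_add, exp_pi_mul_I, mul_neg, mul_one]
  rw [normalForm, normalForm, Phi, Phi, hpow, harg, hexp]
  ring

end StokesSibuya

end

noncomputable section

namespace StokesSibuya

open Complex Filter Topology Metric Set

/-! ### The Floquet solution at `x = 0` and the trace of the monodromy -/

/-- Coefficients of the Frobenius series at `x = 0` with exponent of larger real part. -/
def frobCoeff (A : Polynomial ℂ) (p : ℂ) : ℕ → ℂ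
  | 0 => 1
  | n + 1 => (∑ i : Fin (n + 1), A.coeff (n - i.val) * frobCoeff A p i.val) /
      ((n + 1 : ℕ) * ((n + 1 : ℕ) + p))
decreasing_by
  exact i.isLt

theorem frobCoeff_succ (A : Polynomial ℂ) {p : ℂ} (hp : 0 ≤ p.re) (n : ℕ) :
    ((n + 1 : ℕ) : ℂ) * ((n + 1 : ℕ) + p) * frobCoeff A p (n + 1) =
      ∑ i ∈ Finset.range (n + 1), A.coeff (n - i) * frobCoeff A p i := by
  have h1 : ((n + 1 : ℕ) : ℂ) ≠ 0 := Nat.cast_ne_zero.2 n.succ_ne_zero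
  have h2 : ((n + 1 : ℕ) : ℂ) + p ≠ 0 := by
    intro h
    have := congrArg re h
    simp only [add_re, natCast_re, zero_re] at this
    have h3 : (0 : ℝ) < (n + 1 : ℕ) := by positivity
    linarith
  rw [frobCoeff, mul_div_cancel₀ _ (mul_ne_zero h1 h2),
    Fin.sum_univ_eq_sum_range (fun i => A.coeff (n - i) * frobCoeff A p i)]

/-- S dominates convolution with A, so a bound C on earlier terms gives (k+1) |k+1+p| |c_{k+1}|
r^(k+1) ≤ S C. Once k + 1 ≥ S the bound C reproduces itself, as Re p ≥ 0 gives |k+1+p| ≥ k + 1; the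
initial terms are covered by the choice of C. As r is arbitrary, the radius of convergence is
infinite. -/
theorem exists_bound_frobCoeff (A : Polynomial ℂ) {p : ℂ} (hp : 0 ≤ p.re) {r : ℝ} (hr : 0 < r) :
    ∃ C, ∀ n, ‖frobCoeff A p n‖ * r ^ n ≤ C := by
  set S := ∑ i ∈ Finset.range (A.natDegree + 1), ‖A.coeff i‖ * r ^ (i + 1) with hS
  have hS0 : 0 ≤ S := Finset.sum_nonneg fun i _ => by positivity
  obtain ⟨n₀, hn₀⟩ := exists_nat_ge S
  set C := ∑ j ∈ Finset.range (n₀ + 1), ‖frobCoeff A p j‖ * r ^ j with hC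
  have hC0 : 0 ≤ C := Finset.sum_nonneg fun i _ => by positivity
  refine ⟨C, fun n => ?_⟩
  induction n using Nat.strong_induction_on with
  | _ n ih =>
    rcases Nat.lt_or_ge n (n₀ + 1) with hn | hn
    · exact Finset.single_le_sum (f := fun j => ‖frobCoeff A p j‖ * r ^ j)
        (fun j _ => by positivity) (Finset.mem_range.2 hn)
    · obtain ⟨k, rfl⟩ : ∃ k, n = k + 1 := ⟨n - 1, by omega⟩
      have h1 := congrArg norm (frobCoeff_succ A hp k)
      rw [norm_mul, norm_mul, norm_natCast] at h1
      have h2 : ((k + 1 : ℕ) : ℝ) ≤ ‖((k + 1 : ℕ) : ℂ) + p‖ := by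
        refine le_trans ?_ (re_le_norm _)
        simp only [add_re, natCast_re]
        linarith
      have h3 : ‖∑ i ∈ Finset.range (k + 1), A.coeff (k - i) * frobCoeff A p i‖ * r ^ (k + 1) ≤
          S * C := by
        calc ‖∑ i ∈ Finset.range (k + 1), A.coeff (k - i) * frobCoeff A p i‖ * r ^ (k + 1)
            ≤ (∑ i ∈ Finset.range (k + 1), ‖A.coeff (k - i)‖ * ‖frobCoeff A p i‖) *
              r ^ (k + 1) := by
              gcongr
              refine (norm_sum_le _ _).trans_eq ?_
              simp only [norm_mul]
          _ = ∑ i ∈ Finset.range (k + 1), (‖A.coeff (k - i)‖ * r ^ (k - i + 1)) *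
                (‖frobCoeff A p i‖ * r ^ i) := by
              rw [Finset.sum_mul]
              refine Finset.sum_congr rfl fun i hi => ?_
              have hi' : i ≤ k := Nat.lt_succ_iff.1 (Finset.mem_range.1 hi)
              have : r ^ (k + 1) = r ^ (k - i + 1) * r ^ i := by
                rw [← pow_add]
                congr 1
                omega
              rw [this]
              ring
          _ ≤ ∑ i ∈ Finset.range (k + 1), (‖A.coeff (k - i)‖ * r ^ (k - i + 1)) * C := by
              gcongr with i hi
              exact ih i (Finset.mem_range.1 hi)
          _ = (∑ i ∈ Finset.range (k + 1), ‖A.coeff i‖ * r ^ (i + 1)) * C := by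
              rw [← Finset.sum_mul]
              congr 1
              exact Finset.sum_range_reflect (fun i => ‖A.coeff i‖ * r ^ (i + 1)) (k + 1)
          _ ≤ S * C := by
              refine mul_le_mul_of_nonneg_right ?_ hC0
              rcases le_total (k + 1) (A.natDegree + 1) with hle | hle
              · exact Finset.sum_le_sum_of_subset_of_nonneg (Finset.range_subset_range.2 hle)
                  fun i _ _ => by positivity
              · refine le_of_eq (Finset.sum_subset (Finset.range_subset_range.2 hle)
                  fun i _ hi => ?_).symm
                rw [Finset.mem_range, not_lt] at hi
                rw [Polynomial.coeff_eq_zero_of_natDegree_lt (by omega)]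
                simp
      rw [← h1] at h3
      have hkS : S ≤ ((k + 1 : ℕ) : ℝ) := hn₀.trans (by exact_mod_cast (by omega : n₀ ≤ k + 1))
      have hk1 : (1 : ℝ) ≤ ((k + 1 : ℕ) : ℝ) := by exact_mod_cast Nat.succ_pos k
      have hx : 0 ≤ ‖frobCoeff A p (k + 1)‖ * r ^ (k + 1) := by positivity
      have h4 : ((k + 1 : ℕ) : ℝ) * (‖frobCoeff A p (k + 1)‖ * r ^ (k + 1)) ≤
          ((k + 1 : ℕ) : ℝ) * C := by
        calc ((k + 1 : ℕ) : ℝ) * (‖frobCoeff A p (k + 1)‖ * r ^ (k + 1))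
            ≤ ((k + 1 : ℕ) : ℝ) * ‖((k + 1 : ℕ) : ℂ) + p‖ *
              (‖frobCoeff A p (k + 1)‖ * r ^ (k + 1)) := by
              refine mul_le_mul_of_nonneg_right ?_ hx
              exact le_mul_of_one_le_right (by positivity) (hk1.trans h2)
          _ ≤ S * C := by
              refine le_trans (le_of_eq ?_) h3
              ring
          _ ≤ _ := by gcongr
      exact le_of_mul_le_mul_left h4 (by positivity)

theorem summable_frobCoeff (A : Polynomial ℂ) {p : ℂ} (hp : 0 ≤ p.re) {r : ℝ} (hr : 0 < r) :
    Summable fun n => ‖frobCoeff A p n‖ * r ^ n := by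
  obtain ⟨C, hC⟩ := exists_bound_frobCoeff A hp (r := 2 * r) (by positivity)
  refine Summable.of_nonneg_of_le (fun n => by positivity) (fun n => ?_)
    ((summable_geometric_of_lt_one (r := (1 / 2 : ℝ)) (by norm_num) (by norm_num)).mul_left C)
  have h := hC n
  rw [mul_pow] at h
  have h2 : (0 : ℝ) < 2 ^ n := by positivity
  rw [one_div, inv_pow, ← div_eq_mul_inv, le_div_iff₀ h2]
  linarith

theorem hasSum_mul_eval (A : Polynomial ℂ) {c : ℕ → ℂ} {x : ℂ}
    (hc : Summable fun n => ‖c n * x ^ n‖) :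
    HasSum (fun n => ∑ i ∈ Finset.range (n + 1), (c i * x ^ i) * (A.coeff (n - i) * x ^ (n - i)))
      ((∑' n, c n * x ^ n) * A.eval x) := by
  have hzero : ∀ n ∉ Finset.range (A.natDegree + 1), A.coeff n * x ^ n = 0 := fun n hn => by
    rw [Finset.mem_range, not_lt] at hn
    rw [Polynomial.coeff_eq_zero_of_natDegree_lt (by omega), zero_mul]
  have hA : Summable fun n => ‖A.coeff n * x ^ n‖ :=
    summable_of_ne_finset_zero (s := Finset.range (A.natDegree + 1)) fun n hn => by
      rw [hzero n hn, norm_zero]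
  have hAe : A.eval x = ∑' n, A.coeff n * x ^ n := by
    rw [Polynomial.eval_eq_sum_range]
    exact (tsum_eq_sum hzero).symm
  rw [hAe]
  exact hasSum_sum_range_mul_of_summable_norm
    (f := fun n => c n * x ^ n) (g := fun n => A.coeff n * x ^ n) hc hA

theorem sum_range_mul_pow (A : Polynomial ℂ) {c : ℕ → ℂ} {x d : ℂ} {n : ℕ}
    (h : d = ∑ i ∈ Finset.range (n + 1), A.coeff (n - i) * c i) :
    ∑ i ∈ Finset.range (n + 1), (c i * x ^ i) * (A.coeff (n - i) * x ^ (n - i)) = d * x ^ n := by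
  rw [h, Finset.sum_mul]
  refine Finset.sum_congr rfl fun i hi => ?_
  have hi' : i ≤ n := Nat.lt_succ_iff.1 (Finset.mem_range.1 hi)
  have : x ^ n = x ^ i * x ^ (n - i) := by rw [← pow_add, Nat.add_sub_cancel' hi']
  rw [this]
  ring

/-- Frobenius's method at x = 0. Inserting e^(pt/2) Σ c_n e^(nt) yields (n + p/2)² - p²/4 = n (n +
p) as the factor of c_n, nonzero for n ≥ 1 when Re p ≥ 0. The series is a function of e^t, so only
e^(pt/2) contributes to the multiplier. -/
theorem exists_floquet {Q : ℂ → ℂ} {A : Polynomial ℂ} {p : ℂ} (hp : 0 ≤ p.re)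
    (hQ : ∀ t, Q t = p ^ 2 / 4 + exp t * A.eval (exp t)) :
    ∃ F, EntireSol Q F ∧ (∃ t, F t ≠ 0) ∧
      ∀ t, F (t + 2 * Real.pi * I) = exp (Real.pi * I * p) * F t := by
  obtain ⟨c, c0, hrec, hcs⟩ : ∃ c : ℕ → ℂ, c 0 = 1 ∧
      (∀ n : ℕ, ((n + 1 : ℕ) : ℂ) * ((n + 1 : ℕ) + p) * c (n + 1) =
        ∑ i ∈ Finset.range (n + 1), A.coeff (n - i) * c i) ∧
      ∀ r : ℝ, 0 < r → Summable fun n => ‖c n‖ * r ^ n :=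
    ⟨frobCoeff A p, by rw [frobCoeff], frobCoeff_succ A hp, fun r hr => summable_frobCoeff A hp hr⟩
  set f : ℕ → ℂ → ℂ := fun n t => c n * exp ((n + p / 2) * t) with hf
  have hfx : ∀ n t, f n t = exp (p / 2 * t) * (c n * exp t ^ n) := by
    intro n t
    simp only [hf]
    rw [← exp_nat_mul, add_mul, exp_add]
    ring
  have hlin : ∀ (n : ℕ) (t : ℂ), HasDerivAt (fun t => exp ((n + p / 2) * t))
      ((n + p / 2) * exp ((n + p / 2) * t)) t := by
    intro n t
    have h : HasDerivAt (fun t : ℂ => (n + p / 2) * t) (n + p / 2) t := by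
      simpa using (hasDerivAt_id t).const_mul (n + p / 2)
    convert! h.cexp using 1
    ring
  have hd : ∀ n, Differentiable ℂ (f n) := fun n t =>
    ((hlin n t).const_mul (c n)).differentiableAt
  have hd1 : ∀ n, deriv (f n) = fun t => c n * ((n + p / 2) * exp ((n + p / 2) * t)) := fun n =>
    funext fun t => ((hlin n t).const_mul (c n)).deriv
  have hd2 : ∀ n, deriv (deriv (f n)) =
      fun t => c n * ((n + p / 2) * ((n + p / 2) * exp ((n + p / 2) * t))) := fun n => by
    rw [hd1]
    exact funext fun t => (((hlin n t).const_mul _).const_mul (c n)).deriv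
  have hlim : TendstoLocallyUniformlyOn (fun N z => ∑ n ∈ Finset.range N, f n z)
      (fun z => ∑' n, f n z) atTop Set.univ := by
    refine tendstoLocallyUniformlyOn_sum_range fun z _ => ?_
    refine ⟨ball 0 (‖z‖ + 1), mem_nhdsWithin_of_mem_nhds (isOpen_ball.mem_nhds (by simp)), _,
      (hcs _ (Real.exp_pos (‖z‖ + 1))).mul_left
        (Real.exp (‖p / 2‖ * (‖z‖ + 1))), fun n w hw => ?_⟩
    rw [mem_ball_zero_iff] at hw
    rw [hfx, norm_mul, norm_mul, norm_pow]
    have h1 : ‖exp (p / 2 * w)‖ ≤ Real.exp (‖p / 2‖ * (‖z‖ + 1)) := by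
      refine (norm_exp_le_exp_norm _).trans (Real.exp_le_exp.2 ?_)
      rw [norm_mul]
      gcongr
    have h2 : ‖exp w‖ ≤ Real.exp (‖z‖ + 1) :=
      (norm_exp_le_exp_norm _).trans (Real.exp_le_exp.2 hw.le)
    gcongr
  set F : ℂ → ℂ := fun z => ∑' n, f n z with hF
  have hsumx : ∀ x : ℂ, x ≠ 0 → Summable fun n => ‖c n * x ^ n‖ := fun x hx => by
    simpa only [norm_mul, norm_pow] using hcs _ (norm_pos_iff.2 hx)
  have hFx : ∀ t, F t = exp (p / 2 * t) * ∑' n, c n * exp t ^ n := fun t => by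
    simp only [hF, hfx]
    rw [tsum_mul_left]
  have hS : ∀ N, Differentiable ℂ fun z => ∑ n ∈ Finset.range N, f n z := fun N =>
    Differentiable.fun_sum fun n _ => hd n
  have hS' : ∀ N, deriv (fun z => ∑ n ∈ Finset.range N, f n z) =
      fun z => ∑ n ∈ Finset.range N, deriv (f n) z := fun N =>
    funext fun z => deriv_fun_sum fun n _ => hd n z
  have hS'' : ∀ N, deriv (fun z => ∑ n ∈ Finset.range N, deriv (f n) z) =
      fun z => ∑ n ∈ Finset.range N, deriv (deriv (f n)) z := fun N =>
    funext fun z => deriv_fun_sum fun n _ => ((hd n).analyticAt z).deriv.differentiableAt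
  have hlim' := hlim.deriv (Eventually.of_forall fun N => (hS N).differentiableOn) isOpen_univ
  have hlim'' := hlim'.deriv (Eventually.of_forall fun N z _ =>
    (((hS N).analyticAt z).deriv.differentiableAt).differentiableWithinAt) isOpen_univ
  refine ⟨F, ⟨differentiableOn_univ.1 (hlim.differentiableOn
      (Eventually.of_forall fun N => (hS N).differentiableOn) isOpen_univ), fun t => ?_⟩, ?_,
      fun t => ?_⟩
  · set x := exp t with hx
    have hx0 : x ≠ 0 := exp_ne_zero t
    have hcauchy := hasSum_mul_eval A (hsumx x hx0)
    have hterm : ∀ n : ℕ, deriv (deriv (f (n + 1))) t = p ^ 2 / 4 * f (n + 1) t +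
        exp (p / 2 * t) * x * ∑ i ∈ Finset.range (n + 1),
          (c i * x ^ i) * (A.coeff (n - i) * x ^ (n - i)) := by
      intro n
      have h2 := hfx (n + 1) t
      rw [sum_range_mul_pow A (hrec n), hd2]
      simp only [hf, ← hx] at h2 ⊢
      generalize exp ((((n + 1 : ℕ) : ℂ) + p / 2) * t) = E at h2 ⊢
      generalize exp (p / 2 * t) = E' at h2 ⊢
      rw [pow_succ] at h2
      linear_combination (((n + 1 : ℕ) : ℂ) * (((n + 1 : ℕ) : ℂ) + p)) * h2
    have hterm0 : deriv (deriv (f 0)) t = p ^ 2 / 4 * f 0 t := by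
      rw [hd2]
      simp only [hf, Nat.cast_zero, zero_add]
      ring
    have h1 := (hlim''.tendsto_at (Set.mem_univ t)).comp (tendsto_add_atTop_nat 1)
    have h2 := ((hlim.tendsto_at (Set.mem_univ t)).comp (tendsto_add_atTop_nat 1)).const_mul
      (p ^ 2 / 4)
    have h3 := hcauchy.tendsto_sum_nat.const_mul (exp (p / 2 * t) * x)
    have h4 := tendsto_nhds_unique h1 ((h2.add h3).congr fun N => by
      simp only [Function.comp_apply, hS', hS'', Finset.sum_range_succ', hterm, hterm0,
        Finset.sum_add_distrib, mul_add, Finset.mul_sum]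
      ring)
    rw [h4, hQ, hFx]
    simp only [← hx]
    ring
  -- As t → -∞ along the reals the series tends to c_0 = 1, so it cannot vanish identically.
  · by_contra! h0
    have h1 : ∀ t, ∑' n, c n * exp t ^ n = 0 := fun t => by
      have := h0 t
      rw [hFx] at this
      exact (mul_eq_zero.1 this).resolve_left (exp_ne_zero _)
    have hbound := hcs 1 one_pos
    simp only [one_pow, mul_one] at hbound
    have h2 : Tendsto (fun τ : ℝ => ∑' n, c n * exp (-τ : ℂ) ^ n) atTop
        (𝓝 (∑' n, if n = 0 then (1 : ℂ) else 0)) := by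
      refine tendsto_tsum_of_dominated_convergence hbound (fun n => ?_) ?_
      · rcases Nat.eq_zero_or_pos n with rfl | hn
        · simp [c0]
        · rw [if_neg hn.ne']
          have h3 : Tendsto (fun τ : ℝ => exp (-τ : ℂ)) atTop (𝓝 0) := by
            have := (continuous_ofReal.tendsto 0).comp Real.tendsto_exp_neg_atTop_nhds_zero
            rw [ofReal_zero] at this
            refine this.congr fun τ => ?_
            simp
          have h4 := (h3.pow n).const_mul (c n)
          rwa [zero_pow hn.ne', mul_zero] at h4
      · filter_upwards [eventually_ge_atTop 0] with τ hτ n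
        rw [norm_mul, norm_pow, norm_exp]
        refine mul_le_of_le_one_right (norm_nonneg _) (pow_le_one₀ (Real.exp_pos _).le ?_)
        rw [Real.exp_le_one_iff]
        simpa using hτ
    simp only [h1, tsum_ite_eq] at h2
    exact zero_ne_one (tendsto_nhds_unique tendsto_const_nhds h2)
  · rw [hFx, hFx, exp_add t, exp_two_pi_mul_I, mul_one,
      show p / 2 * (t + 2 * Real.pi * I) = Real.pi * I * p + p / 2 * t by ring, exp_add, mul_assoc]

/-- The trace of the monodromy matrix in terms of a Floquet multiplier. -/
theorem trace_eq_of_floquet {Q f g F : ℂ → ℂ} (hf : EntireSol Q f) (hg : EntireSol Q g)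
    (hF : EntireSol Q F) (hw : wronsk f g 0 ≠ 0) {s κ : ℂ} (hκ : κ ≠ 0) (hF0 : ∃ t, F t ≠ 0)
    (hFs : ∀ t, F (t + s) = κ * F t) (M : Matrix (Fin 2) (Fin 2) ℂ)
    (hM0 : ∀ t, f t = -(M 0 0 * f (t + s) + M 0 1 * g (t + s)))
    (hM1 : ∀ t, g t = -(M 1 0 * f (t + s) + M 1 1 * g (t + s))) :
    M.trace = -(κ + κ⁻¹) := by
  have hds : ∀ {h : ℂ → ℂ}, Differentiable ℂ h → ∀ t,
      HasDerivAt (fun t => h (t + s)) (deriv h (t + s)) t := fun hh t =>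
    ((hh (t + s)).hasDerivAt).comp_add_const t s
  have hdf : deriv f 0 = -(M 0 0 * deriv f (0 + s) + M 0 1 * deriv g (0 + s)) := by
    have h1 := (((hds hf.1 0).const_mul (M 0 0)).add ((hds hg.1 0).const_mul (M 0 1))).neg
    have h2 : f = -((fun t => M 0 0 * f (t + s)) + fun t => M 0 1 * g (t + s)) := funext hM0
    rw [← h2] at h1
    exact h1.deriv
  have hdg : deriv g 0 = -(M 1 0 * deriv f (0 + s) + M 1 1 * deriv g (0 + s)) := by
    have h1 := (((hds hf.1 0).const_mul (M 1 0)).add ((hds hg.1 0).const_mul (M 1 1))).neg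
    have h2 : g = -((fun t => M 1 0 * f (t + s)) + fun t => M 1 1 * g (t + s)) := funext hM1
    rw [← h2] at h1
    exact h1.deriv
  have hdet : M 0 0 * M 1 1 - M 0 1 * M 1 0 = 1 := by
    have h1 := hf.wronsk_eq hg (0 + s) 0
    have h2 : wronsk f g 0 = (M 0 0 * M 1 1 - M 0 1 * M 1 0) * wronsk f g (0 + s) := by
      simp only [wronsk]
      rw [hdf, hdg, hM0 0, hM1 0]
      ring
    rw [h1] at h2
    exact (mul_right_cancel₀ hw (by linear_combination h2)).symm
  obtain ⟨α, β, hαβ⟩ : ∃ α β : ℂ, ∀ t, F t = α * f t + β * g t := by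
    refine ⟨-(wronsk g F 0) / wronsk f g 0, wronsk f F 0 / wronsk f g 0, fun t => ?_⟩
    field_simp
    linear_combination hf.wronsk_relation hg hF t
  -- The coordinates (α, β) of F form a row vector killed by 1 + κ M: compare F(t) = κ F(t - s) in
  -- the basis f, g.
  have hrel := eq_zero_of_lincomb_eq_zero hf.1 hg.1 hw
    (α := α + κ * (α * M 0 0 + β * M 1 0)) (β := β + κ * (α * M 0 1 + β * M 1 1)) fun t => by
      have h1 := hFs (t - s)
      rw [sub_add_cancel, hαβ, hαβ, hM0 (t - s), hM1 (t - s), sub_add_cancel] at h1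
      linear_combination h1
  have hne : α ≠ 0 ∨ β ≠ 0 := by
    by_contra! h
    obtain ⟨t, ht⟩ := hF0
    rw [hαβ, h.1, h.2] at ht
    simp at ht
  -- det (1 + κ M) = 0; with det M = 1 this reads 1 + κ Tr M + κ² = 0.
  have hchar : (1 + κ * M 0 0) * (1 + κ * M 1 1) - κ ^ 2 * M 0 1 * M 1 0 = 0 := by
    rcases hne with h | h
    · refine (mul_eq_zero.1 (?_ : α * _ = 0)).resolve_left h
      linear_combination (1 + κ * M 1 1) * hrel.1 - κ * M 1 0 * hrel.2
    · refine (mul_eq_zero.1 (?_ : β * _ = 0)).resolve_left h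
      linear_combination (1 + κ * M 0 0) * hrel.2 - κ * M 0 1 * hrel.1
  rw [Matrix.trace_fin_two]
  field_simp
  linear_combination hchar - κ ^ 2 * hdet

theorem exists_polynomial_normalCoeff {m : ℕ} (hm : 0 < m) (a : Fin m → ℂ) {p : ℂ}
    (hp : p ^ 2 = 1 + 4 * a ⟨m - 1, Nat.sub_lt hm Nat.one_pos⟩) :
    ∃ A : Polynomial ℂ, ∀ t, normalCoeff m a t = p ^ 2 / 4 + exp t * A.eval (exp t) := by
  obtain ⟨n, rfl⟩ : ∃ n, m = n + 1 := ⟨m - 1, by omega⟩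
  refine ⟨Polynomial.X ^ n + ∑ j : Fin n, Polynomial.C (a j.castSucc) *
    Polynomial.X ^ (n - (j.val + 1)), fun t => ?_⟩
  have hlast : a ⟨n + 1 - 1, Nat.sub_lt hm Nat.one_pos⟩ = a (Fin.last n) := rfl
  rw [hlast] at hp
  have hsum : ∀ x : ℂ, ∑ j : Fin n, a j.castSucc * x ^ (n + 1 - (j.val + 1)) =
      x * ∑ j : Fin n, a j.castSucc * x ^ (n - (j.val + 1)) := fun x => by
    rw [Finset.mul_sum]
    refine Finset.sum_congr rfl fun j _ => ?_
    have : n + 1 - (j.val + 1) = n - (j.val + 1) + 1 := by omega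
    rw [this, pow_succ]
    ring
  rw [normalCoeff, poly, Fin.sum_univ_castSucc]
  simp only [Fin.val_castSucc, Fin.val_last, Nat.sub_self, pow_zero, mul_one, hsum,
    Polynomial.eval_add, Polynomial.eval_pow, Polynomial.eval_X, Polynomial.eval_finsetSum,
    Polynomial.eval_mul, Polynomial.eval_C]
  rw [hp, pow_succ]
  ring

theorem trace_prod_stokesMatrix_of_re_nonneg {m : ℕ} (hm : 0 < m) (σ : ℤˣ) (a : Fin m → ℂ) {p : ℂ}
    (hp : p ^ 2 = 1 + 4 * a ⟨m - 1, Nat.sub_lt hm Nat.one_pos⟩) (hre : 0 ≤ p.re) :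
    Matrix.trace (List.ofFn fun k : Fin m => stokesMatrix m σ ((k : ℕ) : ℤ) a).prod =
      -2 * Complex.cos (Real.pi * p) := by
  obtain ⟨A, hA⟩ := exists_polynomial_normalCoeff hm a hp
  obtain ⟨F, hF, hF0, hFs⟩ := exists_floquet hre hA
  have hf := entireSol_normalForm_Phi hm σ (-1) a
  have hg := entireSol_normalForm_Phi hm σ 0 a
  have hw := wronsk_Phi_ne_zero hm σ (-1) a
  rw [show (-1 : ℤ) + 1 = 0 by norm_num] at hw
  set M := (List.ofFn fun k : Fin m => stokesMatrix m σ ((k : ℕ) : ℤ) a).prod with hM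
  have hvec := fun t => prod_stokesMatrix_mulVec hm σ a m t
  have h1 := fun t => Phi_add_natCast hm σ (-1) a t
  have h2 := fun t => Phi_add_natCast hm σ 0 a t
  rw [show (-1 : ℤ) + m = m - 1 by ring] at h1
  rw [zero_add] at h2
  simp only [h1, h2, ← hM] at hvec
  -- For the opposite choice of ω the turn is reversed and κ becomes its inverse, which leaves κ +
  -- 1/κ unchanged.
  have hFσ : ∀ t, F (t + (σ : ℤ) * (2 * Real.pi * I)) = exp ((σ : ℤ) * (Real.pi * I * p)) * F t := by
    intro t
    rcases Int.units_eq_one_or σ with rfl | rfl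
    · simpa using hFs t
    · have h := hFs (t + ((-1 : ℤˣ) : ℤ) * (2 * Real.pi * I))
      have h3 : t + (((-1 : ℤˣ) : ℤ) : ℂ) * (2 * Real.pi * I) + 2 * Real.pi * I = t := by
        push_cast
        ring
      rw [h3] at h
      have h4 : exp ((((-1 : ℤˣ) : ℤ) : ℂ) * (Real.pi * I * p)) * exp (Real.pi * I * p) = 1 := by
        rw [← exp_add]
        simp
      linear_combination (-exp ((((-1 : ℤˣ) : ℤ) : ℂ) * (Real.pi * I * p))) * h -
        F (t + (((-1 : ℤˣ) : ℤ) : ℂ) * (2 * Real.pi * I)) * h4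
  have htr := trace_eq_of_floquet hf hg hF hw (exp_ne_zero _) hF0 hFσ M
    (fun t => by
      have := congrFun (hvec t) 0
      simp only [Matrix.mulVec, dotProduct, Fin.sum_univ_two, Matrix.cons_val_zero,
        Matrix.cons_val_one] at this
      rw [this]
      ring)
    (fun t => by
      have := congrFun (hvec t) 1
      simp only [Matrix.mulVec, dotProduct, Fin.sum_univ_two, Matrix.cons_val_zero,
        Matrix.cons_val_one] at this
      rw [this]
      ring)
  rw [htr, ← exp_neg, Complex.cos]
  rcases Int.units_eq_one_or σ with rfl | rfl
  · push_cast
    ring_nf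
  · push_cast
    ring_nf

end StokesSibuya

end

/-! ### The trace formula for either square root p -/

theorem corollary6p3 (m : ℕ) (hm : 0 < m) (σ : ℤˣ) (a : Fin m → ℂ) (p : ℂ)
    (hp : p ^ 2 = 1 + 4 * a ⟨m - 1, Nat.sub_lt hm Nat.one_pos⟩) :
    (∃! Φ : ℂ → ℂ, StokesSibuya.IsCanonical m a Φ) ∧
    (∀ k : ℤ, ∃! c : ℂ × ℂ, StokesSibuya.IsConnection m σ k a c) ∧
    Matrix.trace (List.ofFn fun k : Fin m =>
        StokesSibuya.stokesMatrix m σ ((k : ℕ) : ℤ) a).prod =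
      -2 * Complex.cos (Real.pi * p) := by
  refine ⟨?_, fun k => StokesSibuya.existsUnique_isConnection hm σ k a, ?_⟩
  · exact ⟨_, StokesSibuya.isCanonical_Phi0 hm a, fun Ψ hΨ =>
      StokesSibuya.isCanonical_unique hm hΨ (StokesSibuya.isCanonical_Phi0 hm a)⟩
  -- Hypothesis and right side are even in p, so p may be replaced by -p to reach Re p ≥ 0.
  · rcases le_total 0 p.re with h | h
    · exact StokesSibuya.trace_prod_stokesMatrix_of_re_nonneg hm σ a hp h
    · have := StokesSibuya.trace_prod_stokesMatrix_of_re_nonneg hm σ a (p := -p)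
        (by rw [neg_sq, hp]) (by simpa using h)
      rw [this, mul_neg, Complex.cos_neg]
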